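/- A \emph{lattice} is a finite-dimensional free $\mathbb{Z}_2$-module $L$ with a nondegenerate symmetric bilinear form with values in $\mathbb{Q}_2$; lattices are isometric ($\cong$) if there is a $\mathbb{Z}_2$-linear isomorphism between them preserving the forms. A lattice $U$ is \emph{unimodular} if its form is $\mathbb{Z}_2$-valued and $U\to\mathrm{Hom}(U,\mathbb{Z}_2)$ is an isomorphism. It has \emph{type} $\mathrm{II}$ if all norms $(x,x)$ are even and type $\mathrm{I}$ otherwise. Its \emph{sign} is $+$ if $\det U\equiv\pm1 \pmod 8$ and $-$ if $\det U\equiv\pm3\pmod 8$. Its \emph{oddity} in $\mathbb{Z}/8$ is found by diagonalizing the form over $\mathbb{Q}_2$ and adding up the odd parts of the diagonal entries, plus $4$ for each entry of the form $2^{k}u$ with $k$ odd, $u\in\mathbb{Z}_2^\times$, $u\equiv\pm3\pmod 8$. A \emph{Jordan decomposition} of $L$ is an orthogonal direct sum decomposition $L=\bigoplus_{i\in\mathbb{Z}}L_i$, where $L_i$ is a (possibly zero) unimodular lattice with inner products multiplied by $2^i$. The \emph{term} of scale $2^i$ consists of the dimension, sign and type of that unimodular lattice; it is trivial if $L_i=0$.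 A \emph{compartment} is a maximal set of type $\mathrm{I}$ terms whose scales are consecutive powers of $2$; its oddity is the sum in $\mathbb{Z}/8$ of the oddities of the unimodular lattices underlying its terms, and its dimension is the sum of their dimensions. The \emph{$2$-adic symbol} of the Jordan decomposition is the list of all scales, dimensions, signs and types of the nontrivial terms, together with the oddity of each compartment. A $2$-adic symbol of $L$ is the $2$-adic symbol of some Jordan decomposition of $L$. In a $2$-adic symbol, two scales with nontrivial terms can \emph{interact} if one of the following holds: (1) they are adjacent powers of $2$ and the terms have different types; (2) they are adjacent powers of $2$, both terms have type $\mathrm{I}$, and their compartment has dimension $>2$ or oddity $\pm2$; (3) both terms have type $\mathrm{I}$, the scales differ by a factor of $4$, and the term between them is trivial. A \emph{signway} is an equivalence class of scales under the equivalence relation generated by interaction. A $2$-adic symbol is in \emph{canonical form} if every term with sign $-$ is the term of smallest scale in its signway. \textbf{Corollary (Canonical form).} Let $L,L'$ be lattices, and let $S,S'$ be $2$-adic symbols of $L,L'$ respectively, both in canonical form. Then $L\cong L'$ if and only if $S=S'$. -/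

import Mathlib

noncomputable section

namespace TwoAdic

/-- Reduction of `2`-adic integers modulo `8`. -/
def mod8 : ℤ_[2] →+* ZMod 8 := PadicInt.toZModPow 3

open Classical in
/-- The Legendre symbol `(u/2)` of a `2`-adic unit `u`: it is `+` if `u ≡ ±1` mod `8`
and `-` if `u ≡ ±3` mod `8`. -/
def legendre (u : ℤ_[2]) : ℤˣ := if mod8 u = 1 ∨ mod8 u = -1 then 1 else -1

theorem norm_oddPart_le (a : ℚ_[2]) : ‖a * (2 : ℚ_[2]) ^ (-a.valuation)‖ ≤ 1 := by
  rcases eq_or_ne a 0 with rfl | ha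
  · simp
  · have h2 : ‖(2 : ℚ_[2])‖ = (2 : ℝ)⁻¹ := by
      have := Padic.norm_p (p := 2)
      simpa using this
    have h3 : ((2 : ℝ) ^ a.valuation) ≠ 0 := zpow_ne_zero _ two_ne_zero
    rw [norm_mul, norm_zpow, h2, Padic.norm_eq_zpow_neg_valuation ha, inv_zpow']
    simp [h3]

/-- The odd part `u` of a `2`-adic number `a = 2 ^ k * u`, with `u` a `2`-adic unit
(and `0` if `a = 0`). -/
def oddPart (a : ℚ_[2]) : ℤ_[2] := ⟨a * (2 : ℚ_[2]) ^ (-a.valuation), norm_oddPart_le a⟩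

/-- An antisquare is a number `2 ^ odd * u` with `u` a `2`-adic unit of Legendre symbol `-`. -/
def IsAntisquare (a : ℚ_[2]) : Prop :=
  a ≠ 0 ∧ Odd a.valuation ∧ legendre (oddPart a) = -1

open Classical in
/-- The contribution of a diagonal entry to the oddity: its odd part mod `8`, plus `4` if the
entry is an antisquare. -/
def diagOddity (a : ℚ_[2]) : ZMod 8 := mod8 (oddPart a) + if IsAntisquare a then 4 else 0

section QuadraticSpace

variable {V : Type*} [AddCommGroup V] [Module ℚ_[2] V]

open Classical in
/-- The oddity of a finite-dimensional quadratic space over `ℚ₂`: diagonalize the form and add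
up the contributions of the diagonal entries. An orthogonal basis always exists, see
`exists_orthogonal_basis`. -/
def spaceOddity (Q : LinearMap.BilinForm ℚ_[2] V) : ZMod 8 :=
  if h : ∃ v : Module.Basis (Fin (Module.finrank ℚ_[2] V)) ℚ_[2] V, Q.IsOrthoᵢ v then
    ∑ i, diagOddity (Q (h.choose i) (h.choose i))
  else 0

theorem exists_orthogonal_basis [FiniteDimensional ℚ_[2] V] (Q : LinearMap.BilinForm ℚ_[2] V)
    (hQ : LinearMap.IsSymm Q) :
    ∃ v : Module.Basis (Fin (Module.finrank ℚ_[2] V)) ℚ_[2] V, Q.IsOrthoᵢ v := by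
  have : Invertible (2 : ℚ_[2]) := invertibleOfNonzero two_ne_zero
  exact LinearMap.BilinForm.exists_orthogonal_basis hQ

end QuadraticSpace

/-- The type of a lattice: `I` is odd, `II` is even. -/
inductive LatticeType where
  | I
  | II

section Integral

/-! Invariants of a lattice `U` with an integral form `b`. -/

variable {U : Type*} [AddCommGroup U] [Module ℤ_[2] U]

/-- The natural map from `U` to its dual lattice `Hom(U, ℤ₂)` is an isomorphism. -/
def IsUnimodular (b : LinearMap.BilinForm ℤ_[2] U) : Prop :=
  Function.Bijective (b : U → Module.Dual ℤ_[2] U)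

/-- All norms are even. -/
def IsEvenForm (b : LinearMap.BilinForm ℤ_[2] U) : Prop := ∀ x, Even (b x x)

open Classical in
def latticeType (b : LinearMap.BilinForm ℤ_[2] U) : LatticeType :=
  if IsEvenForm b then LatticeType.II else LatticeType.I

/-- The Legendre symbol of the determinant of an inner product matrix. -/
def sign [Module.Free ℤ_[2] U] [Module.Finite ℤ_[2] U] (b : LinearMap.BilinForm ℤ_[2] U) : ℤˣ :=
  legendre (LinearMap.BilinForm.toMatrix (Module.finBasis ℤ_[2] U) b).det

/-- The oddity of a lattice is the oddity of the quadratic space `U ⊗ ℚ₂`. -/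
def oddity (b : LinearMap.BilinForm ℤ_[2] U) : ZMod 8 :=
  spaceOddity (LinearMap.BilinForm.baseChange ℚ_[2] b)

end Integral

section Lattice

variable {L : Type*} [AddCommGroup L] [Module ℤ_[2] L]

/-- A Jordan decomposition: an orthogonal direct sum decomposition into constituents indexed by
`i : ℤ`, the one of index `i` being a unimodular lattice (its form is `form i`) with inner
products rescaled by `2 ^ i`. Trivial constituents are allowed, so that every scale has exactly
one constituent. -/
structure JordanDecomposition (B : L →ₗ[ℤ_[2]] L →ₗ[ℤ_[2]] ℚ_[2]) where
  constituent : ℤ → Submodule ℤ_[2] L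
  isInternal : DirectSum.IsInternal constituent
  orthogonal : ∀ i j, i ≠ j → ∀ x ∈ constituent i, ∀ y ∈ constituent j, B x y = 0
  form : ∀ i, LinearMap.BilinForm ℤ_[2] (constituent i)
  form_scaled : ∀ i (x y : constituent i),
    B (x : L) (y : L) = (2 : ℚ_[2]) ^ i * ((form i x y : ℤ_[2]) : ℚ_[2])
  unimodular : ∀ i, IsUnimodular (form i)

end Lattice

/-- The set of scales (each scale `2 ^ i` is recorded as `i`) of the compartment that contains
the scale `i`, given the types of the terms: all scales that are joined to `i` by consecutive
scales of type `I`. It is empty if the term of scale `i` has type `II`. -/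
def compartment (type : ℤ → LatticeType) (i : ℤ) : Set ℤ :=
  {j | ∀ k ∈ Set.uIcc i j, type k = LatticeType.I}

/-- The data of a `2`-adic symbol. Scales `2 ^ i` are recorded as `i : ℤ`, scales not present in
the symbol have trivial terms (dimension `0`, sign `+`, type `II`), and
`compartmentOddity i` is the subscript of the compartment that contains the term of scale `i`
if that term has type `I`, and is `0` otherwise. -/
@[ext]
structure Symbol where
  dim : ℤ → ℕ
  sign : ℤ → ℤˣ
  type : ℤ → LatticeType
  compartmentOddity : ℤ → ZMod 8

/-- The `2`-adic symbol of a Jordan decomposition. -/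
def JordanDecomposition.symbol {L : Type*} [AddCommGroup L] [Module ℤ_[2] L]
    [Module.Free ℤ_[2] L] [Module.Finite ℤ_[2] L] {B : L →ₗ[ℤ_[2]] L →ₗ[ℤ_[2]] ℚ_[2]}
    (J : JordanDecomposition B) : Symbol where
  dim i := Module.finrank ℤ_[2] (J.constituent i)
  sign i := TwoAdic.sign (J.form i)
  type i := latticeType (J.form i)
  compartmentOddity i :=
    ∑ᶠ j ∈ compartment (fun k => latticeType (J.form k)) i, oddity (J.form j)

/-- `S` is a `2`-adic symbol of the lattice with form `B`. -/
def IsSymbolOf {L : Type*} [AddCommGroup L] [Module ℤ_[2] L]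
    [Module.Free ℤ_[2] L] [Module.Finite ℤ_[2] L]
    (S : Symbol) (B : L →ₗ[ℤ_[2]] L →ₗ[ℤ_[2]] ℚ_[2]) : Prop :=
  ∃ J : JordanDecomposition B, J.symbol = S

namespace Symbol

/-- The total dimension of the compartment that contains the scale `i`. -/
def compartmentDim (S : Symbol) (i : ℤ) : ℕ := ∑ᶠ j ∈ compartment S.type i, S.dim j

/-- The scales `i < j` can interact, that is, a sign can walk between their terms. -/
structure Interact (S : Symbol) (i j : ℤ) : Prop where
  nontrivial_left : S.dim i ≠ 0
  nontrivial_right : S.dim j ≠ 0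
  walk :
    -- adjacent scales and different types
    (j = i + 1 ∧ S.type i ≠ S.type j) ∨
    -- adjacent scales in a compartment of dimension above 2 or oddity ±2
    (j = i + 1 ∧ S.type i = LatticeType.I ∧ S.type j = LatticeType.I ∧
      (2 < S.compartmentDim i ∨ S.compartmentOddity i = 2 ∨ S.compartmentOddity i = -2)) ∨
    -- both of type I, scales differing by a factor of 4, trivial term between them
    (j = i + 2 ∧ S.type i = LatticeType.I ∧ S.type j = LatticeType.I ∧ S.dim (i + 1) = 0)

/-- The signway of the scale `i`: its class under the equivalence relation generated by
interaction. -/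
def signway (S : Symbol) (i : ℤ) : Set ℤ := {j | Relation.EqvGen S.Interact i j}

/-- A symbol is in canonical form if every term with sign `-` is the term of smallest scale in
its signway. -/
def IsCanonical (S : Symbol) : Prop :=
  ∀ i, S.dim i ≠ 0 → S.sign i = -1 → ∀ j ∈ S.signway i, i ≤ j

end Symbol

/-- Two lattices are isometric. -/
def Isometric {L L' : Type*} [AddCommGroup L] [Module ℤ_[2] L] [AddCommGroup L']
    [Module ℤ_[2] L'] (B : L →ₗ[ℤ_[2]] L →ₗ[ℤ_[2]] ℚ_[2])
    (B' : L' →ₗ[ℤ_[2]] L' →ₗ[ℤ_[2]] ℚ_[2]) : Prop :=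
  ∃ e : L ≃ₗ[ℤ_[2]] L', ∀ x y, B' (e x) (e y) = B x y

end TwoAdic

end

noncomputable section

namespace TwoAdic

/-! ### Arithmetic of `2`-adic integers -/

/-! Isometry classes of `ℚ_[2]`-valued forms on finite free `ℤ_[2]`-modules form a commutative
monoid `FormClass` under orthogonal sum, and a Jordan decomposition writes the class of a lattice as
a sum of rescaled unimodular classes. Both directions are computations in this monoid.

Equal symbols give isometric lattices, canonical or not. Even unimodular forms are sums of planes
[0,1;1,0] and [2,1;1,2], and two planes of the second kind equal two of the first, so dimension and
sign suffice (`exists_plane_sum`, `nsmul_hypClass_add_nsmul_anisoClass`). Odd ones are diagonal with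
entries that matter only mod 8 (`exists_unaryClass_sum`). Collect all odd terms in one diagonal
form: explicit isometries change its entries within a scale or across adjacent scales, until only
the sign of each term and the sum of entries over each compartment matter (`diagClass_eq`).

For the converse, the invariants are the Gauss integrals γ_k = ∫ ψ(2^(-k-1) (x,x)) over L with Haar
probability measure, where ψ is a character of `ℚ_[2]` trivial on `ℤ_[2]`. They are multiplicative.
γ_k vanishes if the term of scale 2^k is odd; otherwise it is a positive multiple of an eighth root
of unity, whose exponent is the sum over i < k of the oddity of the i-th term, plus 4(k-i) if its
sign is -. After tensoring with a hyperbolic plane the integrals become powers of 1/2 that reveal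
the dimensions. So dimensions, types, and phases at scales of type II are invariants. At a place
that signs cannot cross (`Symbol.IsBreak`), a difference of phases gives the parity of the number of
minus signs up to there. In canonical form each stretch between breaks has at most one minus sign,
at its first nontrivial scale, so the signs are recovered (`Agree.sign`), and then the compartment
oddities.

The oddity is defined by an arbitrary diagonalization over `ℚ_[2]`. That it is the sum of the
entries of a diagonalization over `ℤ_[2]` is also read off a Gauss integral: passing to the
sublattice spanned by an orthogonal family changes an integral of high even level by a positive
factor only (`exists_hasPhase_of_orthogonal`). -/

theorem mod8_eq_zero_iff (x : ℤ_[2]) : mod8 x = 0 ↔ (8 : ℤ_[2]) ∣ x := by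
  have h : mod8 x = 0 ↔ x ∈ RingHom.ker (PadicInt.toZModPow (p := 2) 3) := Iff.rfl
  rw [h, PadicInt.ker_toZModPow, Ideal.mem_span_singleton]
  norm_num

theorem mod8_eq_iff (x y : ℤ_[2]) : mod8 x = mod8 y ↔ ∃ z, x = y + 8 * z := by
  rw [← sub_eq_zero, ← map_sub, mod8_eq_zero_iff]
  constructor
  · rintro ⟨z, hz⟩; exact ⟨z, by rw [← hz]; ring⟩
  · rintro ⟨z, rfl⟩; exact ⟨z, by ring⟩

theorem exists_mod8_eq (c : ZMod 8) : ∃ x, mod8 x = c :=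
  ⟨(c.val : ℤ_[2]), by rw [map_natCast]; exact ZMod.natCast_zmod_val c⟩

theorem not_isUnit_iff_two_dvd (x : ℤ_[2]) : ¬ IsUnit x ↔ (2 : ℤ_[2]) ∣ x := by
  have h := PadicInt.mem_nonunits (p := 2) (z := x)
  rw [mem_nonunits_iff] at h
  rw [h, PadicInt.norm_lt_one_iff_dvd]
  norm_num

theorem isUnit_iff_not_two_dvd (x : ℤ_[2]) : IsUnit x ↔ ¬ (2 : ℤ_[2]) ∣ x := by
  rw [← not_isUnit_iff_two_dvd, not_not]

theorem isUnit_iff_mod8 (x : ℤ_[2]) : IsUnit x ↔ mod8 x * mod8 x = 1 := by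
  constructor
  · intro h
    have h1 : IsUnit (mod8 x) := h.map mod8
    revert h1
    generalize mod8 x = c
    revert c
    decide
  · intro h
    rw [isUnit_iff_not_two_dvd]
    rintro ⟨y, rfl⟩
    revert h
    rw [map_mul, show mod8 2 = 2 from map_ofNat mod8 2]
    generalize mod8 y = c
    revert c
    decide

theorem two_dvd_iff_mod8 (x : ℤ_[2]) : (2 : ℤ_[2]) ∣ x ↔ mod8 x * mod8 x ≠ 1 := by
  rw [← not_isUnit_iff_two_dvd, isUnit_iff_mod8]

theorem two_dvd_or_eq (x : ℤ_[2]) : (∃ y, x = 2 * y) ∨ ∃ y, x = 2 * y + 1 := by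
  by_cases h : (2 : ℤ_[2]) ∣ x
  · obtain ⟨y, hy⟩ := h; exact Or.inl ⟨y, hy⟩
  · right
    have h1 : (2 : ℤ_[2]) ∣ x - 1 := by
      rw [two_dvd_iff_mod8] at h ⊢
      revert h
      rw [map_sub, map_one]
      generalize mod8 x = c
      revert c
      decide
    obtain ⟨y, hy⟩ := h1
    exact ⟨y, by rw [← hy]; ring⟩

theorem isUnit_two_mul_add_one (x : ℤ_[2]) : IsUnit (2 * x + 1) := by
  rw [isUnit_iff_not_two_dvd]
  rintro ⟨y, hy⟩
  have h2 : IsUnit (2 : ℤ_[2]) := IsUnit.of_mul_eq_one (y - x) (by linear_combination -hy)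
  exact (isUnit_iff_not_two_dvd 2).1 h2 dvd_rfl

theorem isUnit_of_add_even {u x : ℤ_[2]} (hu : IsUnit u) (hx : (2 : ℤ_[2]) ∣ x) :
    IsUnit (u + x) := by
  rw [isUnit_iff_not_two_dvd] at *
  rwa [dvd_add_left hx]

/-- Hensel's lemma for quadratic equations. -/
theorem exists_quadratic_root (a b c : ℤ_[2]) (hb : IsUnit b) (hc : (2 : ℤ_[2]) ∣ c) :
    ∃ x, a * x ^ 2 + b * x + c = 0 := by
  -- Newton iteration starts at 0, where the value `c` is even and the derivative `b` is a unit.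
  open Polynomial in
  have h := hensels_lemma (p := 2) (R := ℤ_[2]) (F := C a * X ^ 2 + C b * X + C c) (a := 0) (by
    simp only [map_add, map_mul, aeval_C, aeval_X, map_pow, derivative_mul,
      derivative_C, derivative_X_pow, derivative_X]
    simp [PadicInt.isUnit_iff.1 hb]
    rw [PadicInt.norm_lt_one_iff_dvd]
    simpa using hc)
  obtain ⟨z, hz, -⟩ := h
  exact ⟨z, by simpa using hz⟩

/-- Writing the root as 1 + 2y turns s² = 1 + 8z into y² + y - 2z = 0, whose linear coefficient is a
unit. -/
theorem exists_sq_of_mod8_eq_one {u : ℤ_[2]} (h : mod8 u = 1) : ∃ s, u = s ^ 2 := by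
  obtain ⟨z, hz⟩ := (mod8_eq_iff u 1).1 (by rw [h, map_one])
  obtain ⟨y, hy⟩ := exists_quadratic_root 1 1 (-2 * z) isUnit_one ⟨-z, by ring⟩
  exact ⟨1 + 2 * y, by rw [hz]; linear_combination -4 * hy⟩

theorem exists_mul_sq_of_mod8_eq {u v : ℤ_[2]} (hu : IsUnit u) (h : mod8 u = mod8 v) :
    ∃ s, IsUnit s ∧ v = u * s ^ 2 := by
  obtain ⟨w, hw⟩ := hu.exists_right_inv
  have hv : mod8 (w * v) = 1 := by rw [map_mul, ← h, ← map_mul, mul_comm, hw, map_one]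
  obtain ⟨s, hs⟩ := exists_sq_of_mod8_eq_one hv
  refine ⟨s, ?_, ?_⟩
  · have : IsUnit (w * v) := by rw [isUnit_iff_mod8, hv]; decide
    rw [hs] at this
    exact (isUnit_pow_iff two_ne_zero).1 this
  · rw [← hs, ← mul_assoc, hw, one_mul]

/-- The Legendre symbol of a class modulo `8`. -/
def sign8 (c : ZMod 8) : ℤˣ := if c = 1 ∨ c = -1 then 1 else -1

theorem legendre_eq (u : ℤ_[2]) : legendre u = sign8 (mod8 u) := by
  simp [legendre, sign8]

theorem sign8_mul (c d : ZMod 8) (hc : c * c = 1) (hd : d * d = 1) :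
    sign8 (c * d) = sign8 c * sign8 d := by
  revert c d; decide

theorem legendre_mul {u v : ℤ_[2]} (hu : IsUnit u) (hv : IsUnit v) :
    legendre (u * v) = legendre u * legendre v := by
  simp only [legendre_eq, map_mul]
  exact sign8_mul _ _ ((isUnit_iff_mod8 _).1 hu) ((isUnit_iff_mod8 _).1 hv)

theorem legendre_one : legendre 1 = 1 := by rw [legendre_eq, map_one]; decide

theorem legendre_mul_sq {u s : ℤ_[2]} (hs : IsUnit s) :
    legendre (u * s ^ 2) = legendre u := by
  rw [legendre_eq, legendre_eq, map_mul, pow_two, map_mul, (isUnit_iff_mod8 s).1 hs, mul_one]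

end TwoAdic

namespace TwoAdic

/-! ### The monoid of isometry classes -/

/-- The orthogonal direct sum of two bilinear forms with values in the same module. -/
def prodForm {N L L' : Type*} [AddCommGroup N] [Module ℤ_[2] N]
    [AddCommGroup L] [Module ℤ_[2] L] [AddCommGroup L'] [Module ℤ_[2] L']
    (B : L →ₗ[ℤ_[2]] L →ₗ[ℤ_[2]] N) (B' : L' →ₗ[ℤ_[2]] L' →ₗ[ℤ_[2]] N) :
    (L × L') →ₗ[ℤ_[2]] (L × L') →ₗ[ℤ_[2]] N :=
  B.compl₁₂ (LinearMap.fst _ _ _) (LinearMap.fst _ _ _) +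
    B'.compl₁₂ (LinearMap.snd _ _ _) (LinearMap.snd _ _ _)

@[simp]
theorem prodForm_apply {N L L' : Type*} [AddCommGroup N] [Module ℤ_[2] N]
    [AddCommGroup L] [Module ℤ_[2] L] [AddCommGroup L'] [Module ℤ_[2] L']
    (B : L →ₗ[ℤ_[2]] L →ₗ[ℤ_[2]] N) (B' : L' →ₗ[ℤ_[2]] L' →ₗ[ℤ_[2]] N) (x y : L × L') :
    prodForm B B' x y = B x.1 y.1 + B' x.2 y.2 := rfl

section

variable {L₁ L₂ L₃ L₄ : Type*} [AddCommGroup L₁] [Module ℤ_[2] L₁] [AddCommGroup L₂]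
  [Module ℤ_[2] L₂] [AddCommGroup L₃] [Module ℤ_[2] L₃] [AddCommGroup L₄] [Module ℤ_[2] L₄]
  {B₁ : L₁ →ₗ[ℤ_[2]] L₁ →ₗ[ℤ_[2]] ℚ_[2]} {B₂ : L₂ →ₗ[ℤ_[2]] L₂ →ₗ[ℤ_[2]] ℚ_[2]}
  {B₃ : L₃ →ₗ[ℤ_[2]] L₃ →ₗ[ℤ_[2]] ℚ_[2]} {B₄ : L₄ →ₗ[ℤ_[2]] L₄ →ₗ[ℤ_[2]] ℚ_[2]}

theorem Isometric.refl (B : L₁ →ₗ[ℤ_[2]] L₁ →ₗ[ℤ_[2]] ℚ_[2]) : Isometric B B :=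
  ⟨LinearEquiv.refl _ _, fun _ _ => rfl⟩

theorem Isometric.symm (h : Isometric B₁ B₂) : Isometric B₂ B₁ := by
  obtain ⟨e, he⟩ := h
  exact ⟨e.symm, fun x y => by rw [← he]; simp⟩

theorem Isometric.trans (h : Isometric B₁ B₂) (h' : Isometric B₂ B₃) : Isometric B₁ B₃ := by
  obtain ⟨e, he⟩ := h
  obtain ⟨e', he'⟩ := h'
  exact ⟨e.trans e', fun x y => by simp [he', he]⟩

theorem Isometric.prod (h : Isometric B₁ B₂) (h' : Isometric B₃ B₄) :
    Isometric (prodForm B₁ B₃) (prodForm B₂ B₄) := by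
  obtain ⟨e, he⟩ := h
  obtain ⟨e', he'⟩ := h'
  exact ⟨e.prodCongr e', fun x y => by simp [he', he]⟩

end

/-- Forms on the standard free modules. -/
abbrev CoordForm : Type :=
  Σ n : ℕ, (Fin n → ℤ_[2]) →ₗ[ℤ_[2]] (Fin n → ℤ_[2]) →ₗ[ℤ_[2]] ℚ_[2]

/-- Coordinates keep the quotient in `Type`, so lattices from different universes have classes in
one monoid. -/
instance coordFormSetoid : Setoid CoordForm where
  r X Y := Isometric X.2 Y.2
  iseqv := ⟨fun X => Isometric.refl X.2, Isometric.symm, Isometric.trans⟩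

/-- Isometry classes of finite free `ℤ₂`-modules with a `ℚ₂`-valued bilinear form. -/
def FormClass : Type := Quotient coordFormSetoid

section

variable {L L' : Type*} [AddCommGroup L] [Module ℤ_[2] L] [Module.Free ℤ_[2] L]
  [Module.Finite ℤ_[2] L] [AddCommGroup L'] [Module ℤ_[2] L'] [Module.Free ℤ_[2] L']
  [Module.Finite ℤ_[2] L']

/-- A form in coordinates with respect to the standard basis of a free module. -/
def coordForm (B : L →ₗ[ℤ_[2]] L →ₗ[ℤ_[2]] ℚ_[2]) : CoordForm :=
  ⟨Module.finrank ℤ_[2] L, B.compl₁₂ (Module.finBasis ℤ_[2] L).equivFun.symm.toLinearMap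
    (Module.finBasis ℤ_[2] L).equivFun.symm.toLinearMap⟩

theorem isometric_coordForm (B : L →ₗ[ℤ_[2]] L →ₗ[ℤ_[2]] ℚ_[2]) :
    Isometric (coordForm B).2 B :=
  ⟨(Module.finBasis ℤ_[2] L).equivFun.symm, fun _ _ => rfl⟩

/-- The isometry class of a form. -/
def formClass (B : L →ₗ[ℤ_[2]] L →ₗ[ℤ_[2]] ℚ_[2]) : FormClass := ⟦coordForm B⟧

theorem formClass_eq_iff {B : L →ₗ[ℤ_[2]] L →ₗ[ℤ_[2]] ℚ_[2]}
    {B' : L' →ₗ[ℤ_[2]] L' →ₗ[ℤ_[2]] ℚ_[2]} : formClass B = formClass B' ↔ Isometric B B' := by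
  refine (Quotient.eq (r := coordFormSetoid)).trans ?_
  exact ⟨fun h => ((isometric_coordForm B).symm.trans h).trans (isometric_coordForm B'),
    fun h => ((isometric_coordForm B).trans h).trans (isometric_coordForm B').symm⟩

theorem formClass_mk (X : CoordForm) : formClass X.2 = ⟦X⟧ :=
  Quotient.sound (isometric_coordForm X.2)

end

namespace FormClass

theorem ind {p : FormClass → Prop}
    (h : ∀ n (B : (Fin n → ℤ_[2]) →ₗ[ℤ_[2]] (Fin n → ℤ_[2]) →ₗ[ℤ_[2]] ℚ_[2]), p (formClass B)) :
    ∀ x, p x := by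
  intro x
  induction x using Quotient.inductionOn with
  | h X => rw [← formClass_mk]; exact h X.1 X.2

instance : Add FormClass where
  add := Quotient.lift₂ (fun X Y => formClass (prodForm X.2 Y.2))
    fun _ _ _ _ h h' => formClass_eq_iff.2 (Isometric.prod h h')

instance : Zero FormClass where
  zero := formClass (0 : PUnit →ₗ[ℤ_[2]] PUnit →ₗ[ℤ_[2]] ℚ_[2])

end FormClass

section

variable {L L' : Type*} [AddCommGroup L] [Module ℤ_[2] L] [Module.Free ℤ_[2] L]
  [Module.Finite ℤ_[2] L] [AddCommGroup L'] [Module ℤ_[2] L'] [Module.Free ℤ_[2] L']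
  [Module.Finite ℤ_[2] L']

theorem formClass_prodForm (B : L →ₗ[ℤ_[2]] L →ₗ[ℤ_[2]] ℚ_[2])
    (B' : L' →ₗ[ℤ_[2]] L' →ₗ[ℤ_[2]] ℚ_[2]) :
    formClass (prodForm B B') = formClass B + formClass B' :=
  formClass_eq_iff.2 (Isometric.prod (isometric_coordForm B).symm (isometric_coordForm B').symm)

theorem formClass_of_subsingleton [Subsingleton L] (B : L →ₗ[ℤ_[2]] L →ₗ[ℤ_[2]] ℚ_[2]) :
    formClass B = 0 :=
  formClass_eq_iff.2 ⟨0, fun x y => by simp [Subsingleton.elim x 0]⟩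

end

namespace FormClass

instance : AddCommMonoid FormClass where
  add_assoc x y z := by
    induction x using ind with
    | h _ B =>
    induction y using ind with
    | h _ B' =>
    induction z using ind with
    | h _ B'' =>
    simp only [← formClass_prodForm]
    exact formClass_eq_iff.2 ⟨LinearEquiv.prodAssoc _ _ _ _, fun x y => by simp [add_assoc]⟩
  zero_add x := by
    induction x using ind with
    | h _ B =>
    change formClass _ + _ = _
    rw [← formClass_prodForm]
    exact formClass_eq_iff.2 ⟨LinearEquiv.uniqueProd, fun x y => by simp⟩
  add_zero x := by
    induction x using ind with
    | h _ B =>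
    change _ + formClass _ = _
    rw [← formClass_prodForm]
    exact formClass_eq_iff.2 ⟨LinearEquiv.prodUnique, fun x y => by simp⟩
  add_comm x y := by
    induction x using ind with
    | h _ B =>
    induction y using ind with
    | h _ B' =>
    simp only [← formClass_prodForm]
    exact formClass_eq_iff.2 ⟨LinearEquiv.prodComm _ _ _, fun x y => by simp [add_comm]⟩
  nsmul := nsmulRec

end FormClass

/-! ### Orthogonal sums of submodules -/

section

variable {L : Type*} [AddCommGroup L] [Module ℤ_[2] L]

/-- The restriction of a form to a submodule. -/
def restrictForm (B : L →ₗ[ℤ_[2]] L →ₗ[ℤ_[2]] ℚ_[2]) (N : Submodule ℤ_[2] L) :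
    N →ₗ[ℤ_[2]] N →ₗ[ℤ_[2]] ℚ_[2] := B.compl₁₂ N.subtype N.subtype

@[simp]
theorem restrictForm_apply (B : L →ₗ[ℤ_[2]] L →ₗ[ℤ_[2]] ℚ_[2]) (N : Submodule ℤ_[2] L) (x y : N) :
    restrictForm B N x y = B x y := rfl

variable [Module.Free ℤ_[2] L] [Module.Finite ℤ_[2] L]

theorem formClass_restrict_top (B : L →ₗ[ℤ_[2]] L →ₗ[ℤ_[2]] ℚ_[2]) :
    formClass (restrictForm B ⊤) = formClass B :=
  formClass_eq_iff.2 ⟨Submodule.topEquiv, fun _ _ => rfl⟩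

theorem formClass_restrict_congr (B : L →ₗ[ℤ_[2]] L →ₗ[ℤ_[2]] ℚ_[2]) {N P : Submodule ℤ_[2] L}
    (h : N = P) : formClass (restrictForm B N) = formClass (restrictForm B P) := by
  subst h; rfl

theorem formClass_restrict_sup (B : L →ₗ[ℤ_[2]] L →ₗ[ℤ_[2]] ℚ_[2]) (N P : Submodule ℤ_[2] L)
    (hd : Disjoint N P) (h : ∀ x ∈ N, ∀ y ∈ P, B x y = 0) (h' : ∀ x ∈ N, ∀ y ∈ P, B y x = 0) :
    formClass (restrictForm B (N ⊔ P)) =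
      formClass (restrictForm B N) + formClass (restrictForm B P) := by
  rw [← formClass_prodForm]
  let φ : (N × P) →ₗ[ℤ_[2]] (N ⊔ P : Submodule ℤ_[2] L) :=
    (Submodule.inclusion le_sup_left).coprod (Submodule.inclusion le_sup_right)
  have hφ (x : N × P) : (φ x : L) = x.1 + x.2 := rfl
  have hb : Function.Bijective φ := by
    constructor
    · rw [← LinearMap.ker_eq_bot, LinearMap.ker_eq_bot']
      rintro ⟨x, y⟩ hxy
      have h1 : (x : L) + y = 0 := by rw [← hφ (x, y), hxy]; rfl
      have h2 : (x : L) = -y := eq_neg_of_add_eq_zero_left h1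
      have h3 : (x : L) = 0 := Submodule.disjoint_def.1 hd x x.2 (h2 ▸ P.neg_mem y.2)
      have h4 : (y : L) = 0 := by simpa [h3] using h1
      ext <;> simp [h3, h4]
    · rintro ⟨z, hz⟩
      obtain ⟨x, hx, y, hy, rfl⟩ := Submodule.mem_sup.1 hz
      exact ⟨(⟨x, hx⟩, ⟨y, hy⟩), rfl⟩
  refine formClass_eq_iff.2 (Isometric.symm ⟨LinearEquiv.ofBijective φ hb, fun x y => ?_⟩)
  simp [hφ, h x.1 x.1.2 y.2 y.2.2, h' y.1 y.1.2 x.2 x.2.2]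

theorem formClass_restrict_finset_sup {ι : Type*} (B : L →ₗ[ℤ_[2]] L →ₗ[ℤ_[2]] ℚ_[2])
    (C : ι → Submodule ℤ_[2] L) (hi : iSupIndep C)
    (h : ∀ i j, i ≠ j → ∀ x ∈ C i, ∀ y ∈ C j, B x y = 0) (s : Finset ι) :
    formClass (restrictForm B (s.sup C)) = ∑ i ∈ s, formClass (restrictForm B (C i)) := by
  classical
  induction s using Finset.induction_on with
  | empty =>
    rw [Finset.sum_empty]
    have : Subsingleton ((∅ : Finset ι).sup C : Submodule ℤ_[2] L) := by
      rw [Finset.sup_empty]; infer_instance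
    exact formClass_of_subsingleton _
  | insert a s ha ih =>
    -- `B` is not assumed symmetric, so orthogonality is needed in both orders; a kernel that
    -- contains every summand contains their supremum.
    have hl : C a ≤ (LinearMap.ker (B.flip.domRestrict (s.sup C)).flip) := by
      intro x hx
      rw [LinearMap.mem_ker]
      ext ⟨y, hy⟩
      change B x y = 0
      have : s.sup C ≤ LinearMap.ker (B x) :=
        Finset.sup_le fun i hi y hy => h a i (fun hh => ha (hh ▸ hi)) x hx y hy
      exact this hy
    have hl' (x) (hx : x ∈ C a) (y) (hy : y ∈ s.sup C) : B y x = 0 := by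
      have : s.sup C ≤ LinearMap.ker (B.flip x) :=
        Finset.sup_le fun i hi y hy => h i a (fun hh => ha (hh ▸ hi)) y hy x hx
      exact this hy
    rw [formClass_restrict_congr B Finset.sup_insert, Finset.sum_insert ha, ← ih]
    refine formClass_restrict_sup B _ _ ?_ ?_ hl'
    · exact (hi a).mono_right (Finset.sup_le fun i his =>
        le_iSup₂_of_le i (fun hh : i = a => ha (hh ▸ his)) le_rfl)
    · intro x hx y hy
      have := hl hx
      exact LinearMap.congr_fun this ⟨y, hy⟩

end

end TwoAdic

namespace TwoAdic

/-! ### Integral forms -/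

section

variable {U U' U'' K K' : Type*} [AddCommGroup U] [Module ℤ_[2] U] [AddCommGroup U']
  [Module ℤ_[2] U'] [AddCommGroup U''] [Module ℤ_[2] U''] [AddCommGroup K] [Module ℤ_[2] K]
  [AddCommGroup K'] [Module ℤ_[2] K']

/-- Isometry of integral forms. -/
def IntIsometric (f : LinearMap.BilinForm ℤ_[2] U) (g : LinearMap.BilinForm ℤ_[2] U') : Prop :=
  ∃ e : U ≃ₗ[ℤ_[2]] U', ∀ x y, g (e x) (e y) = f x y

theorem IntIsometric.symm {f : LinearMap.BilinForm ℤ_[2] U} {g : LinearMap.BilinForm ℤ_[2] U'}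
    (h : IntIsometric f g) : IntIsometric g f := by
  obtain ⟨e, he⟩ := h
  exact ⟨e.symm, fun x y => by rw [← he]; simp⟩

/-- The form `2 ^ i * f`. -/
def scaledForm (i : ℤ) (f : LinearMap.BilinForm ℤ_[2] U) : U →ₗ[ℤ_[2]] U →ₗ[ℤ_[2]] ℚ_[2] :=
  f.compr₂ ((2 : ℚ_[2]) ^ i • Algebra.linearMap ℤ_[2] ℚ_[2])

@[simp]
theorem scaledForm_apply (i : ℤ) (f : LinearMap.BilinForm ℤ_[2] U) (x y : U) :
    scaledForm i f x y = (2 : ℚ_[2]) ^ i * ((f x y : ℤ_[2]) : ℚ_[2]) := rfl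

theorem IsUnimodular.of_isometric {f : LinearMap.BilinForm ℤ_[2] U}
    {g : LinearMap.BilinForm ℤ_[2] U'} (hf : IsUnimodular f) (h : IntIsometric f g) :
    IsUnimodular g := by
  obtain ⟨e, he⟩ := h
  have : (g : U' → Module.Dual ℤ_[2] U') = e.symm.dualMap.symm.symm ∘ f ∘ e.symm := by
    funext x
    ext y
    simp [← he]
  rw [IsUnimodular, this]
  exact e.symm.dualMap.symm.symm.bijective.comp (hf.comp e.symm.bijective)

theorem IsUnimodular.prod {f : LinearMap.BilinForm ℤ_[2] U} {g : LinearMap.BilinForm ℤ_[2] U'}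
    (hf : IsUnimodular f) (hg : IsUnimodular g) : IsUnimodular (U := U × U') (prodForm f g) := by
  constructor
  · intro x y hxy
    refine Prod.ext (hf.1 ?_) (hg.1 ?_)
    · ext z
      simpa using LinearMap.congr_fun hxy (z, 0)
    · ext z
      simpa using LinearMap.congr_fun hxy (0, z)
  · intro α
    obtain ⟨x, hx⟩ := hf.2 (α ∘ₗ LinearMap.inl _ _ _)
    obtain ⟨y, hy⟩ := hg.2 (α ∘ₗ LinearMap.inr _ _ _)
    refine ⟨(x, y), LinearMap.ext fun z => ?_⟩
    rw [prodForm_apply, hx, hy]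
    simp [← map_add]

theorem IsUnimodular.right_of_prod {f : LinearMap.BilinForm ℤ_[2] U}
    {g : LinearMap.BilinForm ℤ_[2] U'} (h : IsUnimodular (U := U × U') (prodForm f g)) :
    IsUnimodular g := by
  constructor
  · intro x y hxy
    have : ((0 : U), x) = (0, y) := h.1 (LinearMap.ext fun z => by simp [hxy])
    exact (Prod.ext_iff.1 this).2
  · intro α
    obtain ⟨x, hx⟩ := h.2 (α ∘ₗ LinearMap.snd _ _ _)
    exact ⟨x.2, LinearMap.ext fun z => by simpa using LinearMap.congr_fun hx (0, z)⟩

/-- The restriction of an integral form to a submodule. -/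
def restrictInt (f : LinearMap.BilinForm ℤ_[2] U) (N : Submodule ℤ_[2] U) :
    LinearMap.BilinForm ℤ_[2] N := f.compl₁₂ N.subtype N.subtype

@[simp]
theorem restrictInt_apply (f : LinearMap.BilinForm ℤ_[2] U) (N : Submodule ℤ_[2] U) (x y : N) :
    restrictInt f N x y = f x y := rfl

/-- The vectors orthogonal to the image of `φ`. -/
def orthCompl (f : LinearMap.BilinForm ℤ_[2] U) (φ : K →ₗ[ℤ_[2]] U) : Submodule ℤ_[2] U :=
  LinearMap.ker (f ∘ₗ φ).flip

theorem mem_orthCompl {f : LinearMap.BilinForm ℤ_[2] U} {φ : K →ₗ[ℤ_[2]] U} {z : U} :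
    z ∈ orthCompl f φ ↔ ∀ k, f (φ k) z = 0 := by
  rw [orthCompl, LinearMap.mem_ker, LinearMap.ext_iff]; rfl

/-- A unimodular sublattice is an orthogonal direct summand. -/
theorem intIsometric_prod_orthCompl (f : LinearMap.BilinForm ℤ_[2] U) (hs : ∀ x y, f x y = f y x)
    (g : LinearMap.BilinForm ℤ_[2] K) (hg : IsUnimodular g) (φ : K →ₗ[ℤ_[2]] U)
    (hφ : ∀ x y, f (φ x) (φ y) = g x y) :
    IntIsometric (prodForm g (restrictInt f (orthCompl f φ))) f := by
  have hgs (x y : K) : g x y = g y x := by rw [← hφ, ← hφ, hs]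
  have hb : Function.Bijective (φ.coprod (orthCompl f φ).subtype) := by
    constructor
    · rw [← LinearMap.ker_eq_bot, LinearMap.ker_eq_bot']
      rintro ⟨x, y, hy⟩ hxy
      have hxy : φ x + y = 0 := by simpa using hxy
      have hx : x = 0 := by
        refine hg.1 (LinearMap.ext fun k => ?_)
        have h2 : f (φ k) (φ x + y) = 0 := by rw [hxy, map_zero]
        rw [map_add, hφ, mem_orthCompl.1 hy k, add_zero] at h2
        rw [hgs, h2]; simp
      subst hx
      simpa using hxy
    · intro z
      -- Unimodularity of `g` represents the functional `f (φ ·) z` by a vector `k`, and subtracting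
      -- `φ k` projects `z` to the complement.
      obtain ⟨k, hk⟩ := hg.2 ((f ∘ₗ φ).flip z)
      have hz : z - φ k ∈ orthCompl f φ := by
        rw [mem_orthCompl]
        intro l
        have : g k l = f (φ l) z := LinearMap.congr_fun hk l
        rw [map_sub, hφ, hgs, this, sub_self]
      exact ⟨(k, ⟨_, hz⟩), by simp⟩
  refine ⟨LinearEquiv.ofBijective _ hb, ?_⟩
  rintro ⟨x, y, hy⟩ ⟨x', y', hy'⟩
  have h1 := mem_orthCompl.1 hy' x
  have h2 := mem_orthCompl.1 hy x'
  rw [hs] at h2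
  simp [hφ, h1, h2]

theorem IntIsometric.finrank_eq {f : LinearMap.BilinForm ℤ_[2] U}
    {g : LinearMap.BilinForm ℤ_[2] U'} (h : IntIsometric f g) :
    Module.finrank ℤ_[2] U = Module.finrank ℤ_[2] U' := h.choose.finrank_eq

variable [Module.Free ℤ_[2] U] [Module.Finite ℤ_[2] U] [Module.Free ℤ_[2] U']
  [Module.Finite ℤ_[2] U'] [Module.Free ℤ_[2] K] [Module.Finite ℤ_[2] K]

/-- The complement of the embedded unimodular form has rank zero. Later isometries can thus be given
by listing vectors with the right inner products, without an inverse map. -/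
theorem intIsometric_of_finrank_eq (f : LinearMap.BilinForm ℤ_[2] U) (hs : ∀ x y, f x y = f y x)
    (g : LinearMap.BilinForm ℤ_[2] K) (hg : IsUnimodular g) (φ : K →ₗ[ℤ_[2]] U)
    (hφ : ∀ x y, f (φ x) (φ y) = g x y) (hr : Module.finrank ℤ_[2] K = Module.finrank ℤ_[2] U) :
    IntIsometric g f := by
  have h := intIsometric_prod_orthCompl f hs g hg φ hφ
  have h1 := h.finrank_eq
  rw [Module.finrank_prod, hr] at h1
  have h2 : Module.finrank ℤ_[2] (orthCompl f φ) = 0 := by omega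
  have : Subsingleton (orthCompl f φ) := Module.finrank_zero_iff.1 h2
  obtain ⟨e, he⟩ := h
  have hb : Function.Bijective (e.toLinearMap ∘ₗ LinearMap.inl ℤ_[2] K (orthCompl f φ)) := by
    rw [LinearMap.coe_comp]
    refine e.bijective.comp ⟨LinearMap.inl_injective, fun y => ⟨y.1, ?_⟩⟩
    exact Prod.ext rfl (Subsingleton.elim _ _)
  exact ⟨LinearEquiv.ofBijective _ hb, fun x y => by simp [he]⟩

/-- The isometry class of the form `2 ^ i * f`. -/
def intClass (i : ℤ) (f : LinearMap.BilinForm ℤ_[2] U) : FormClass := formClass (scaledForm i f)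

theorem intClass_congr (i : ℤ) {f : LinearMap.BilinForm ℤ_[2] U}
    {g : LinearMap.BilinForm ℤ_[2] U'} (h : IntIsometric f g) : intClass i f = intClass i g := by
  obtain ⟨e, he⟩ := h
  exact formClass_eq_iff.2 ⟨e, fun x y => by simp [he]⟩

theorem intClass_prod (i : ℤ) (f : LinearMap.BilinForm ℤ_[2] U)
    (g : LinearMap.BilinForm ℤ_[2] U') :
    intClass i (U := U × U') (prodForm f g) = intClass i f + intClass i g := by
  rw [intClass, intClass, intClass, ← formClass_prodForm]
  exact formClass_eq_iff.2 ⟨LinearEquiv.refl _ _, fun x y => by simp [mul_add]⟩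

theorem intClass_of_subsingleton [Subsingleton U] (i : ℤ) (f : LinearMap.BilinForm ℤ_[2] U) :
    intClass i f = 0 := formClass_of_subsingleton _

/-! ### The sign -/

/-- A change of basis multiplies the determinant by the square of a unit, which is 1 mod 8. -/
theorem sign_eq_legendre_det {κ : Type*} [Fintype κ] [DecidableEq κ]
    (f : LinearMap.BilinForm ℤ_[2] U) (w : Module.Basis κ ℤ_[2] U) :
    sign f = legendre (LinearMap.BilinForm.toMatrix w f).det := by
  let e := w.indexEquiv (Module.finBasis ℤ_[2] U)
  let b := (Module.finBasis ℤ_[2] U).reindex e.symm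
  have hb : (LinearMap.BilinForm.toMatrix b f).det =
      (LinearMap.BilinForm.toMatrix (Module.finBasis ℤ_[2] U) f).det := by
    have : LinearMap.BilinForm.toMatrix b f =
        (LinearMap.BilinForm.toMatrix (Module.finBasis ℤ_[2] U) f).submatrix e e := by
      ext i j
      simp [b, LinearMap.BilinForm.toMatrix_apply]
    rw [this, Matrix.det_submatrix_equiv_self]
  rw [sign, ← hb, ← LinearMap.BilinForm.toMatrix_mul_basis_toMatrix b w f, Matrix.det_mul,
    Matrix.det_mul, Matrix.det_transpose]
  have hu : IsUnit (b.toMatrix w).det := by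
    refine IsUnit.of_mul_eq_one (w.toMatrix b).det ?_
    rw [← Matrix.det_mul, Module.Basis.toMatrix_mul_toMatrix_flip, Matrix.det_one]
  rw [← legendre_mul_sq (hu), pow_two]
  congr 1
  ring

/-- The Gram matrix is, up to transposition, the matrix of the isomorphism onto the dual in a basis
and its dual basis. -/
theorem IsUnimodular.isUnit_det {κ : Type*} [Fintype κ] [DecidableEq κ]
    {f : LinearMap.BilinForm ℤ_[2] U} (hf : IsUnimodular f) (w : Module.Basis κ ℤ_[2] U) :
    IsUnit (LinearMap.BilinForm.toMatrix w f).det := by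
  have h := LinearEquiv.isUnit_det (LinearEquiv.ofBijective f hf) w w.dualBasis
  rw [← Matrix.det_transpose]
  convert h using 2
  ext i j
  simp only [LinearMap.toMatrix_apply, LinearMap.BilinForm.toMatrix_apply, Matrix.transpose_apply,
    Module.Basis.dualBasis_repr]
  rfl

theorem sign_congr {f : LinearMap.BilinForm ℤ_[2] U} {g : LinearMap.BilinForm ℤ_[2] U'}
    (h : IntIsometric f g) : sign f = sign g := by
  obtain ⟨e, he⟩ := h
  rw [sign_eq_legendre_det f (Module.finBasis ℤ_[2] U),
    sign_eq_legendre_det g ((Module.finBasis ℤ_[2] U).map e)]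
  congr 2
  ext i j
  simp [LinearMap.BilinForm.toMatrix_apply, he]

theorem sign_prod {f : LinearMap.BilinForm ℤ_[2] U} {g : LinearMap.BilinForm ℤ_[2] U'}
    (hf : IsUnimodular f) (hg : IsUnimodular g) :
    sign (U := U × U') (prodForm f g) = sign f * sign g := by
  let b := Module.finBasis ℤ_[2] U
  let c := Module.finBasis ℤ_[2] U'
  rw [sign_eq_legendre_det f b, sign_eq_legendre_det g c,
    sign_eq_legendre_det (U := U × U') (prodForm f g) (b.prod c),
    ← legendre_mul (hf.isUnit_det b) (hg.isUnit_det c), ← Matrix.det_fromBlocks_zero₂₁ _ 0]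
  congr 2
  ext i j
  rcases i with i | i <;> rcases j with j | j <;> simp [LinearMap.BilinForm.toMatrix_apply]

theorem sign_of_subsingleton [Subsingleton U] (f : LinearMap.BilinForm ℤ_[2] U) : sign f = 1 := by
  rw [sign_eq_legendre_det f (Module.Basis.empty (ι := Empty) U), Matrix.det_isEmpty, legendre_one]

end

/-! ### Forms of dimension one and two -/

/-- The form `u * x * y` of dimension one. -/
def unaryForm (u : ℤ_[2]) : LinearMap.BilinForm ℤ_[2] ℤ_[2] := u • LinearMap.mul ℤ_[2] ℤ_[2]

@[simp]
theorem unaryForm_apply (u x y : ℤ_[2]) : unaryForm u x y = u * (x * y) := rfl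

/-- The even form with inner product matrix `[2a, 1; 1, 2c]`. -/
def planeForm (a c : ℤ_[2]) : LinearMap.BilinForm ℤ_[2] (ℤ_[2] × ℤ_[2]) :=
  LinearMap.mk₂ ℤ_[2] (fun x y => 2 * a * (x.1 * y.1) + (x.1 * y.2 + x.2 * y.1) +
    2 * c * (x.2 * y.2)) (by intros; simp; ring) (by intros; simp; ring)
    (by intros; simp; ring) (by intros; simp; ring)

@[simp]
theorem planeForm_apply (a c : ℤ_[2]) (x y : ℤ_[2] × ℤ_[2]) :
    planeForm a c x y = 2 * a * (x.1 * y.1) + (x.1 * y.2 + x.2 * y.1) + 2 * c * (x.2 * y.2) := rfl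

theorem isUnimodular_unaryForm {u : ℤ_[2]} (hu : IsUnit u) : IsUnimodular (unaryForm u) := by
  obtain ⟨v, hv⟩ := hu.exists_right_inv
  constructor
  · intro x y hxy
    have h : u * (x * 1) = u * (y * 1) := LinearMap.congr_fun hxy 1
    simpa using hu.mul_left_cancel h
  · intro α
    refine ⟨v * α 1, LinearMap.ext_ring ?_⟩
    rw [unaryForm_apply]
    linear_combination α 1 * hv

theorem isUnimodular_planeForm (a c : ℤ_[2]) : IsUnimodular (planeForm a c) := by
  -- 2(2ac - 1) + 1 = 4ac - 1 is the determinant; the formulas below are its adjugate matrix times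
  -- `r`.
  obtain ⟨r, hr⟩ := (isUnit_two_mul_add_one (2 * a * c - 1)).exists_right_inv
  constructor
  · rintro ⟨x, y⟩ ⟨x', y'⟩ hxy
    have h1 := LinearMap.congr_fun hxy (1, 0)
    have h2 := LinearMap.congr_fun hxy (0, 1)
    simp only [planeForm_apply, mul_one, mul_zero, add_zero, zero_add] at h1 h2
    refine Prod.ext (show x = x' from ?_) (show y = y' from ?_)
    · linear_combination (-(x - x')) * hr + r * (2 * c * h1 - h2)
    · linear_combination (-(y - y')) * hr + r * (2 * a * h2 - h1)
  · intro α
    refine ⟨(r * (2 * c * α (1, 0) - α (0, 1)), r * (2 * a * α (0, 1) - α (1, 0))), ?_⟩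
    ext
    · simp
      linear_combination α (1, 0) * hr
    · simp
      linear_combination α (0, 1) * hr

theorem sign_unaryForm (u : ℤ_[2]) : sign (unaryForm u) = legendre u := by
  rw [sign_eq_legendre_det _ (Module.Basis.singleton Unit ℤ_[2])]
  simp [LinearMap.BilinForm.toMatrix_apply]

theorem sign_planeForm (a c : ℤ_[2]) : sign (planeForm a c) = legendre (4 * a * c - 1) := by
  rw [sign_eq_legendre_det _ (Module.Basis.finTwoProd ℤ_[2]), Matrix.det_fin_two]
  simp [LinearMap.BilinForm.toMatrix_apply]
  congr 1
  ring

end TwoAdic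

namespace TwoAdic

/-! ### Relations between forms of small dimension -/

/-- The class of the form `2 ^ i * u * x * y` for `u ≡ c` modulo `8`. -/
def unaryClass (i : ℤ) (c : ZMod 8) : FormClass := intClass i (unaryForm (c.val : ℤ_[2]))

/-- The class of the form with matrix `2 ^ i * [0, 1; 1, 0]`. -/
def hypClass (i : ℤ) : FormClass := intClass i (planeForm 0 0)

/-- The class of the form with matrix `2 ^ i * [2, 1; 1, 2]`. -/
def anisoClass (i : ℤ) : FormClass := intClass i (planeForm 1 1)

theorem intIsometric_unaryForm {u v : ℤ_[2]} (hu : IsUnit u) (h : mod8 u = mod8 v) :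
    IntIsometric (unaryForm u) (unaryForm v) := by
  obtain ⟨s, hs, rfl⟩ := exists_mul_sq_of_mod8_eq hu h
  refine IntIsometric.symm ⟨LinearEquiv.smulOfUnit hs.unit, fun x y => ?_⟩
  simp [LinearEquiv.smulOfUnit, Units.smul_def]
  ring

theorem mod8_natCast_val (c : ZMod 8) : mod8 (c.val : ℤ_[2]) = c := by
  rw [map_natCast]; exact ZMod.natCast_zmod_val c

theorem intClass_unaryForm (i : ℤ) {u : ℤ_[2]} (hu : IsUnit u) :
    intClass i (unaryForm u) = unaryClass i (mod8 u) :=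
  intClass_congr i (intIsometric_unaryForm hu (mod8_natCast_val _).symm)

theorem intClass_unaryForm_two_mul (i : ℤ) {u : ℤ_[2]} (hu : IsUnit u) :
    intClass i (unaryForm (2 * u)) = unaryClass (i + 1) (mod8 u) := by
  rw [← intClass_unaryForm _ hu]
  refine formClass_eq_iff.2 ⟨LinearEquiv.refl _ _, fun x y => ?_⟩
  rw [scaledForm_apply, scaledForm_apply, zpow_add_one₀ two_ne_zero]
  simp only [LinearEquiv.refl_apply, unaryForm_apply, PadicInt.coe_mul,
    show ((2 : ℤ_[2]) : ℚ_[2]) = 2 from rfl]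
  ring

/-- The vector (x, y) has norm N, and (-by, ax) is orthogonal to it with norm abN. The determinant
of the two vectors is again N, a unit, so they form a basis. -/
theorem intIsometric_binary (a b x y N : ℤ_[2]) (hN : a * x ^ 2 + b * y ^ 2 = N) (hu : IsUnit N) :
    IntIsometric (prodForm (unaryForm N) (unaryForm (a * b * N)))
      (prodForm (unaryForm a) (unaryForm b)) := by
  obtain ⟨r, hr⟩ := hu.exists_right_inv
  let φ : (ℤ_[2] × ℤ_[2]) →ₗ[ℤ_[2]] (ℤ_[2] × ℤ_[2]) :=
    { toFun := fun p => (x * p.1 - b * y * p.2, y * p.1 + a * x * p.2)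
      map_add' := fun p q => by ext <;> simp <;> ring
      map_smul' := fun p q => by ext <;> simp <;> ring }
  let ψ : (ℤ_[2] × ℤ_[2]) →ₗ[ℤ_[2]] (ℤ_[2] × ℤ_[2]) :=
    { toFun := fun p => (r * (a * x * p.1 + b * y * p.2), r * (-y * p.1 + x * p.2))
      map_add' := fun p q => by ext <;> simp <;> ring
      map_smul' := fun p q => by ext <;> simp <;> ring }
  refine ⟨LinearEquiv.ofLinearMap φ ψ ?_ ?_, fun p q => ?_⟩
  · refine LinearMap.ext fun p => Prod.ext ?_ ?_
    · simp only [φ, ψ, LinearMap.comp_apply, LinearMap.coe_mk, AddHom.coe_mk, LinearMap.id_apply]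
      linear_combination p.1 * hr + r * p.1 * hN
    · simp only [φ, ψ, LinearMap.comp_apply, LinearMap.coe_mk, AddHom.coe_mk, LinearMap.id_apply]
      linear_combination p.2 * hr + r * p.2 * hN
  · refine LinearMap.ext fun p => Prod.ext ?_ ?_
    · simp only [φ, ψ, LinearMap.comp_apply, LinearMap.coe_mk, AddHom.coe_mk, LinearMap.id_apply]
      linear_combination p.1 * hr + r * p.1 * hN
    · simp only [φ, ψ, LinearMap.comp_apply, LinearMap.coe_mk, AddHom.coe_mk, LinearMap.id_apply]
      linear_combination p.2 * hr + r * p.2 * hN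
  · simp only [φ, ψ, LinearEquiv.coe_ofLinearMap, LinearMap.coe_mk, AddHom.coe_mk, prodForm_apply,
      unaryForm_apply]
    linear_combination (p.1 * q.1 + a * b * p.2 * q.2) * hN

theorem exists_isUnit_mod8_eq {c : ZMod 8} (hc : c * c = 1) : ∃ u, IsUnit u ∧ mod8 u = c := by
  obtain ⟨u, rfl⟩ := exists_mod8_eq c
  exact ⟨u, (isUnit_iff_mod8 u).2 hc, rfl⟩

/-- Two signs of the same term can be changed. -/
theorem unaryClass_add_self_scale (i : ℤ) (c d : ZMod 8) (hc : c * c = 1) (hd : d * d = 1) :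
    unaryClass i c + unaryClass i d = unaryClass i (c + 4) + unaryClass i (d + 4) := by
  obtain ⟨u, hu, rfl⟩ := exists_isUnit_mod8_eq hc
  obtain ⟨v, hv, rfl⟩ := exists_isUnit_mod8_eq hd
  -- The vector (1, 2) has norm u + 4v, and the complementary entry uv(u + 4v) is v + 4 mod 8
  -- because squares of units are 1.
  have hN : IsUnit (u + 4 * v) := isUnit_of_add_even hu ⟨2 * v, by ring⟩
  have h := intClass_congr i (intIsometric_binary u v 1 2 _ (by ring) hN)
  rw [intClass_prod, intClass_prod, intClass_unaryForm _ hN,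
    intClass_unaryForm _ ((hu.mul hv).mul hN), intClass_unaryForm _ hu, intClass_unaryForm _ hv] at h
  rw [← h]
  simp only [map_add, map_mul, show mod8 4 = 4 from map_ofNat mod8 4]
  revert hc hd
  generalize mod8 v = d
  generalize mod8 u = c
  intro hc hd
  congr 2
  · revert c d; decide
  · revert c d; decide

/-- In the form with entries u and 2v the vector (1, 1) has norm u + 2v, and the complementary entry
is twice uv(u + 2v), which is v + 2u mod 8. This move is what ties adjacent scales into
compartments. -/
theorem unaryClass_add_next_scale (i : ℤ) (c d : ZMod 8) (hc : c * c = 1) (hd : d * d = 1) :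
    unaryClass i c + unaryClass (i + 1) d =
      unaryClass i (c + 2 * d) + unaryClass (i + 1) (d + 2 * c) := by
  obtain ⟨u, hu, rfl⟩ := exists_isUnit_mod8_eq hc
  obtain ⟨v, hv, rfl⟩ := exists_isUnit_mod8_eq hd
  have hN : IsUnit (u + 2 * v) := isUnit_of_add_even hu ⟨v, by ring⟩
  have h := intClass_congr i (intIsometric_binary u (2 * v) 1 1 _ (by ring) hN)
  rw [intClass_prod, intClass_prod, intClass_unaryForm _ hN,
    show u * (2 * v) * (u + 2 * v) = 2 * (u * v * (u + 2 * v)) by ring,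
    intClass_unaryForm_two_mul _ ((hu.mul hv).mul hN), intClass_unaryForm _ hu,
    intClass_unaryForm_two_mul _ hv] at h
  rw [← h]
  simp only [map_add, map_mul, show mod8 2 = 2 from map_ofNat mod8 2]
  congr 2
  revert hc hd; generalize mod8 v = d; generalize mod8 u = c; revert c d; decide

/-! ### Even binary forms -/

section Plane

variable {U : Type*} [AddCommGroup U] [Module ℤ_[2] U]

/-- The linear map that sends the standard basis to `x, y`. -/
def pairMap (x y : U) :
    (ℤ_[2] × ℤ_[2]) →ₗ[ℤ_[2]] U :=
  (LinearMap.toSpanSingleton ℤ_[2] U x).coprod (LinearMap.toSpanSingleton ℤ_[2] U y)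

@[simp]
theorem pairMap_apply (x y : U)
    (p : ℤ_[2] × ℤ_[2]) : pairMap x y p = p.1 • x + p.2 • y := rfl

theorem form_pairMap (f : LinearMap.BilinForm ℤ_[2] U) (hs : ∀ x y, f x y = f y x) (x y : U)
    (a c : ℤ_[2]) (hx : f x x = 2 * a) (hxy : f x y = 1) (hy : f y y = 2 * c) (p q) :
    f (pairMap x y p) (pairMap x y q) = planeForm a c p q := by
  have hyx : f y x = 1 := by rw [hs, hxy]
  simp only [pairMap_apply, map_add, map_smul, LinearMap.add_apply, LinearMap.smul_apply,
    smul_eq_mul, hx, hxy, hy, hyx, planeForm_apply]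
  ring

theorem planeForm_symm (a c : ℤ_[2]) (x y) : planeForm a c x y = planeForm a c y x := by
  simp; ring

theorem intIsometric_planeForm (a c a' c' : ℤ_[2]) (x y : ℤ_[2] × ℤ_[2])
    (hx : planeForm a c x x = 2 * a') (hxy : planeForm a c x y = 1)
    (hy : planeForm a c y y = 2 * c') : IntIsometric (planeForm a' c') (planeForm a c) :=
  intIsometric_of_finrank_eq _ (planeForm_symm a c) _ (isUnimodular_planeForm a' c') (pairMap x y)
    (form_pairMap _ (planeForm_symm a c) x y a' c' hx hxy hy) rfl

theorem intClass_planeForm_swap (i : ℤ) (a c : ℤ_[2]) :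
    intClass i (planeForm a c) = intClass i (planeForm c a) :=
  (intClass_congr i (intIsometric_planeForm a c c a (0, 1) (1, 0) (by simp) (by simp)
    (by simp))).symm

/-- A root x of at² + t + c makes (x, 1) isotropic. A vector that pairs to 1 with it becomes
isotropic after subtracting half its norm times (x, 1). -/
theorem intClass_planeForm_of_even (i : ℤ) {a c : ℤ_[2]} (hc : (2 : ℤ_[2]) ∣ c) :
    intClass i (planeForm a c) = hypClass i := by
  obtain ⟨x, hx⟩ := exists_quadratic_root a 1 c isUnit_one hc
  obtain ⟨r, hr⟩ := (isUnit_two_mul_add_one (a * x)).exists_right_inv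
  refine (intClass_congr i (intIsometric_planeForm a c 0 0 (x, 1) (r - r ^ 2 * a * x,
    - r ^ 2 * a) ?_ ?_ ?_)).symm
  · simp; linear_combination 2 * hx
  · simp only [planeForm_apply]
    linear_combination hr - 2 * a * r ^ 2 * hx
  · simp only [planeForm_apply]
    linear_combination (-2 * a * r ^ 2) * hr + 2 * a ^ 2 * r ^ 4 * hx

/-- Hensel's lemma finds a vector of norm 2, which reduces to a = 1; then the second basis vector is
changed, keeping inner product 1 with the first, until its norm is 2 as well. -/
theorem intClass_planeForm_of_isUnit (i : ℤ) {a c : ℤ_[2]} (ha : IsUnit a) (hc : IsUnit c) :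
    intClass i (planeForm a c) = anisoClass i := by
  have h2 {u : ℤ_[2]} (hu : IsUnit u) : (2 : ℤ_[2]) ∣ u - 1 := by
    rcases two_dvd_or_eq u with ⟨y, rfl⟩ | ⟨y, rfl⟩
    · exact absurd (dvd_mul_right 2 y) ((isUnit_iff_not_two_dvd _).1 hu)
    · exact ⟨y, by ring⟩
  have key {c : ℤ_[2]} (hc : IsUnit c) : intClass i (planeForm 1 c) = anisoClass i := by
    -- The vectors of inner product 1 with (1, 0) are the (x, 1 - 2x); this equation says that such
    -- a vector has norm 2.
    obtain ⟨x, hx⟩ := exists_quadratic_root (4 * c - 1) (1 - 4 * c) (c - 1)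
      (by rw [sub_eq_add_neg]; exact isUnit_of_add_even isUnit_one ⟨-2 * c, by ring⟩) (h2 hc)
    refine (intClass_congr i (intIsometric_planeForm 1 c 1 1 (1, 0) (x, 1 - 2 * x) ?_ ?_ ?_)).symm
    · simp
    · simp only [planeForm_apply]; ring
    · simp only [planeForm_apply]; linear_combination 2 * hx
  obtain ⟨x, hx⟩ := exists_quadratic_root a 1 (c - 1) isUnit_one (h2 hc)
  obtain ⟨r, hr⟩ := (isUnit_two_mul_add_one (a * x)).exists_right_inv
  rw [intClass_congr i (intIsometric_planeForm a c 1 (r ^ 2 * a) (x, 1) (r, 0) ?_ ?_ ?_).symm]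
  · refine key (IsUnit.mul (IsUnit.pow 2 (IsUnit.of_mul_eq_one _ (by rw [mul_comm]; exact hr))) ha)
  · simp only [planeForm_apply]; linear_combination 2 * hx
  · simp only [planeForm_apply]; linear_combination hr
  · simp only [planeForm_apply]; ring

/-- The sign tells the two planes apart: 4ac - 1 is -1 mod 8 if ac is even and 3 if ac is odd. -/
theorem intClass_planeForm (i : ℤ) (a c : ℤ_[2]) :
    (intClass i (planeForm a c) = hypClass i ∧ sign (planeForm a c) = 1) ∨
      (intClass i (planeForm a c) = anisoClass i ∧ sign (planeForm a c) = -1) := by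
  by_cases hc : (2 : ℤ_[2]) ∣ c
  · refine Or.inl ⟨intClass_planeForm_of_even i hc, ?_⟩
    obtain ⟨y, rfl⟩ := hc
    rw [sign_planeForm, legendre_eq, show mod8 (4 * a * (2 * y) - 1) = mod8 (-1) from
      (mod8_eq_iff _ _).2 ⟨a * y, by ring⟩, map_neg, map_one]
    decide
  by_cases ha : (2 : ℤ_[2]) ∣ a
  · refine Or.inl ⟨by rw [intClass_planeForm_swap]; exact intClass_planeForm_of_even i ha, ?_⟩
    obtain ⟨y, rfl⟩ := ha
    rw [sign_planeForm, legendre_eq, show mod8 (4 * (2 * y) * c - 1) = mod8 (-1) from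
      (mod8_eq_iff _ _).2 ⟨y * c, by ring⟩, map_neg, map_one]
    decide
  rw [← isUnit_iff_not_two_dvd] at ha hc
  refine Or.inr ⟨intClass_planeForm_of_isUnit i ha hc, ?_⟩
  rw [sign_planeForm, legendre_eq]
  have h1 := (isUnit_iff_mod8 _).1 ha
  have h2 := (isUnit_iff_mod8 _).1 hc
  simp only [map_sub, map_mul, map_one, show mod8 4 = 4 from map_ofNat mod8 4]
  revert h1 h2
  generalize mod8 a = a
  generalize mod8 c = c
  revert a c
  decide

/-- One of the planes may be given norms -2. It is then the negative of the other up to the sign of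
a basis vector, and an even unimodular form plus its negative is hyperbolic, the diagonal vectors
being isotropic. -/
theorem anisoClass_add_self (i : ℤ) : anisoClass i + anisoClass i = hypClass i + hypClass i := by
  have h1 : IsUnit (-1 : ℤ_[2]) := isUnit_one.neg
  -- `r` inverts 3, the determinant of [2,1;1,2]; it occurs in the partners of the diagonal vectors.
  obtain ⟨r, hr⟩ := (isUnit_two_mul_add_one 1).exists_right_inv
  have hr3 : 3 * r = 1 := by linear_combination hr
  nth_rewrite 2 [← intClass_planeForm_of_isUnit i h1 h1]
  rw [anisoClass, hypClass, ← intClass_prod, ← intClass_prod]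
  refine (intClass_congr i (intIsometric_of_finrank_eq _ ?_ _
    ((isUnimodular_planeForm 0 0).prod (isUnimodular_planeForm 0 0))
    ((pairMap ((1, 0), (1, 0)) ((r, -r), (-r, 0))).coprod
      (pairMap ((0, 1), (0, -1)) ((0, r), (r, r)))) ?_ (by simp))).symm
  · intro x y; simp; ring
  · rintro ⟨⟨p1, p2⟩, p3, p4⟩ ⟨⟨q1, q2⟩, q3, q4⟩
    simp
    linear_combination (p1 * q2 + p2 * q1 + p3 * q4 + p4 * q3) * hr3

/-- The vector (1,1,1) has norm 3u. With r the inverse of u, its complement is spanned by (1,-1,0)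
and (0,-r,r), of norms 2u and 2r and inner product 1. -/
theorem unaryClass_triple (i : ℤ) (c : ZMod 8) (hc : c * c = 1) :
    unaryClass i c + unaryClass i c + unaryClass i c = unaryClass i (3 * c) + anisoClass i := by
  obtain ⟨u, hu, rfl⟩ := exists_isUnit_mod8_eq hc
  obtain ⟨r, hr⟩ := hu.exists_right_inv
  have h3 : IsUnit (3 * u) := by
    refine IsUnit.mul ?_ hu
    have := isUnit_two_mul_add_one 1
    norm_num at this; exact this
  have hru : IsUnit r := IsUnit.of_mul_eq_one u (by rw [mul_comm]; exact hr)
  rw [show 3 * mod8 u = mod8 (3 * u) by rw [map_mul, map_ofNat mod8 3], ← intClass_unaryForm i hu,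
    ← intClass_unaryForm i h3, ← intClass_planeForm_of_isUnit i hu hru,
    ← intClass_prod, ← intClass_prod, ← intClass_prod]
  refine (intClass_congr i (intIsometric_of_finrank_eq _ ?_ _
    ((isUnimodular_unaryForm h3).prod (isUnimodular_planeForm u r))
    ((LinearMap.toSpanSingleton ℤ_[2] _ ((1, 1), 1)).coprod
      (pairMap ((1, -1), 0) ((0, -r), r))) ?_ (by simp))).symm
  · intro x y; simp; ring
  · rintro ⟨p1, p2, p3⟩ ⟨q1, q2, q3⟩
    simp
    linear_combination (p2 * q3 + p3 * q2 + 2 * r * p3 * q3) * hr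

/-- The vector (1,1,1) has norm 1, with complement spanned by the isotropic vectors (1,0,1) and
(0,-1,-1). The relation later evaluates Gauss integrals of hyperbolic planes. -/
theorem unaryClass_add_hypClass (i : ℤ) :
    unaryClass i 1 + unaryClass i 1 + unaryClass i (-1) = unaryClass i 1 + hypClass i := by
  have h1 : unaryClass i 1 = intClass i (unaryForm 1) := by
    rw [intClass_unaryForm i isUnit_one, map_one]
  have h2 : unaryClass i (-1) = intClass i (unaryForm (-1)) := by
    rw [intClass_unaryForm i isUnit_one.neg, map_neg, map_one]
  rw [h1, h2, hypClass, ← intClass_prod, ← intClass_prod, ← intClass_prod]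
  refine (intClass_congr i (intIsometric_of_finrank_eq _ ?_ _
    ((isUnimodular_unaryForm isUnit_one).prod (isUnimodular_planeForm 0 0))
    ((LinearMap.toSpanSingleton ℤ_[2] _ ((1, 1), 1)).coprod
      (pairMap ((1, 0), 1) ((0, -1), -1))) ?_ (by simp))).symm
  · intro x y; simp; ring
  · rintro ⟨p1, p2, p3⟩ ⟨q1, q2, q3⟩
    simp
    ring

end Plane

end TwoAdic

namespace TwoAdic

/-! ### Classification of unimodular forms -/

universe u

theorem exists_form_eq_one {U : Type u} [AddCommGroup U] [Module ℤ_[2] U] [Module.Free ℤ_[2] U]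
    [Module.Finite ℤ_[2] U] {f : LinearMap.BilinForm ℤ_[2] U} (hf : IsUnimodular f)
    (hr : 0 < Module.finrank ℤ_[2] U) : ∃ x y, f x y = 1 := by
  let b := Module.finBasis ℤ_[2] U
  obtain ⟨x, hx⟩ := hf.2 (b.coord ⟨0, hr⟩)
  exact ⟨x, b ⟨0, hr⟩, by rw [hx]; simp⟩

theorem isUnit_of_not_even {x : ℤ_[2]} (h : ¬ Even x) : IsUnit x := by
  rw [isUnit_iff_not_two_dvd]
  exact fun h2 => h (even_iff_two_dvd.2 h2)

section Split

variable {U : Type u} [AddCommGroup U] [Module ℤ_[2] U]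

/-- Splitting off a vector whose norm is a unit. -/
theorem intIsometric_unary_split (f : LinearMap.BilinForm ℤ_[2] U) (hs : ∀ x y, f x y = f y x)
    (x : U) (hx : IsUnit (f x x)) :
    IntIsometric (prodForm (unaryForm (f x x))
      (restrictInt f (orthCompl f (LinearMap.toSpanSingleton ℤ_[2] U x)))) f :=
  intIsometric_prod_orthCompl f hs _ (isUnimodular_unaryForm hx) _ fun a b => by
    simp; ring

/-- In an odd unimodular form of dimension at least two there is a vector of odd norm with odd
orthogonal complement. -/
theorem exists_odd_complement [Module.Free ℤ_[2] U] [Module.Finite ℤ_[2] U]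
    (f : LinearMap.BilinForm ℤ_[2] U) (hs : ∀ x y, f x y = f y x)
    (hf : IsUnimodular f) (ho : ¬ IsEvenForm f) (hr : 1 < Module.finrank ℤ_[2] U) :
    ∃ x, IsUnit (f x x) ∧
      ¬ IsEvenForm (restrictInt f (orthCompl f (LinearMap.toSpanSingleton ℤ_[2] U x))) := by
  obtain ⟨x, hx⟩ := not_forall.1 ho
  have hx := isUnit_of_not_even hx
  by_cases he : IsEvenForm (restrictInt f (orthCompl f (LinearMap.toSpanSingleton ℤ_[2] U x)))
  swap
  · exact ⟨x, hx, he⟩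
  have h := intIsometric_unary_split f hs x hx
  have hP := (hf.of_isometric h.symm).right_of_prod
  have hr' := h.finrank_eq
  rw [Module.finrank_prod, Module.finrank_self] at hr'
  -- If the complement of `x` is even, then `x + y` works instead: the projection of `z` to its
  -- complement has norm `f z z - r`, an even number minus a unit.
  obtain ⟨⟨y, hy⟩, ⟨z, hz⟩, hyz⟩ := exists_form_eq_one hP (by omega)
  replace hyz : f y z = 1 := hyz
  have hxy : f x y = 0 := by simpa using mem_orthCompl.1 hy 1
  have hxz : f x z = 0 := by simpa using mem_orthCompl.1 hz 1
  have hyx : f y x = 0 := by rw [hs, hxy]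
  have hzx : f z x = 0 := by rw [hs, hxz]
  have hzy : f z y = 1 := by rw [hs, hyz]
  have hye : (2 : ℤ_[2]) ∣ f y y := even_iff_two_dvd.1 (he ⟨y, hy⟩)
  have hze : (2 : ℤ_[2]) ∣ f z z := even_iff_two_dvd.1 (he ⟨z, hz⟩)
  have hu : IsUnit (f (x + y) (x + y)) := by
    simp only [map_add, LinearMap.add_apply, hxy, hyx, add_zero, zero_add]
    exact isUnit_of_add_even hx hye
  refine ⟨x + y, hu, fun he' => ?_⟩
  obtain ⟨r, hr⟩ := hu.exists_right_inv
  have hw : z - r • (x + y) ∈ orthCompl f (LinearMap.toSpanSingleton ℤ_[2] U (x + y)) := by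
    rw [mem_orthCompl]
    intro k
    rw [LinearMap.toSpanSingleton_apply, map_smul, LinearMap.smul_apply, map_sub, map_smul]
    simp only [smul_eq_mul]
    rw [mul_comm r, hr]
    simp [hxz, hyz]
  have h2 := even_iff_two_dvd.1 (he' ⟨_, hw⟩)
  rw [restrictInt_apply] at h2
  have h3 : f (z - r • (x + y)) (z - r • (x + y)) = f z z - r := by
    have hr2 : f (z - r • (x + y)) (z - r • (x + y)) = f z z - r * f z (x + y) -
        r * f (x + y) z + r * (f (x + y) (x + y) * r) := by
      simp only [map_sub, map_smul, LinearMap.sub_apply, LinearMap.smul_apply, smul_eq_mul]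
      ring
    rw [hr2, hr]
    simp [hxz, hyz, hzx, hzy]
  rw [h3] at h2
  have h4 : (2 : ℤ_[2]) ∣ r := (dvd_sub_right hze).1 h2
  exact (isUnit_iff_not_two_dvd r).1 (IsUnit.of_mul_eq_one _ (by rw [mul_comm]; exact hr)) h4

end Split

/-- Odd unimodular forms are diagonalizable. -/
theorem exists_unaryClass_sum (n : ℕ) : ∀ {U : Type u} [AddCommGroup U] [Module ℤ_[2] U]
    [Module.Free ℤ_[2] U] [Module.Finite ℤ_[2] U] (f : LinearMap.BilinForm ℤ_[2] U),
    (∀ x y, f x y = f y x) → IsUnimodular f → ¬ IsEvenForm f → Module.finrank ℤ_[2] U = n →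
    ∃ c : Fin n → ZMod 8, (∀ j, c j * c j = 1) ∧
      (∀ i, intClass i f = ∑ j, unaryClass i (c j)) ∧ sign f = ∏ j, sign8 (c j) := by
  induction n with
  | zero =>
    intro U _ _ _ _ f hs hf ho hr
    have : Subsingleton U := Module.finrank_zero_iff.1 hr
    exact absurd (fun x => by rw [Subsingleton.elim x 0]; simp) ho
  | succ n ih =>
    intro U _ _ _ _ f hs hf ho hr
    -- The induction needs an odd complement, except in the last step, where the complement is zero.
    have key : ∃ x, IsUnit (f x x) ∧ (n = 0 ∨
      ¬ IsEvenForm (restrictInt f (orthCompl f (LinearMap.toSpanSingleton ℤ_[2] U x)))) := by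
      by_cases hn : n = 0
      · obtain ⟨x, hx⟩ := not_forall.1 ho
        exact ⟨x, isUnit_of_not_even hx, Or.inl hn⟩
      · obtain ⟨x, hx, hx'⟩ := exists_odd_complement f hs hf ho (by omega)
        exact ⟨x, hx, Or.inr hx'⟩
    obtain ⟨x, hx, hx'⟩ := key
    have h := intIsometric_unary_split f hs x hx
    set P := orthCompl f (LinearMap.toSpanSingleton ℤ_[2] U x)
    have hP := (hf.of_isometric h.symm).right_of_prod
    have hr' := h.finrank_eq
    rw [Module.finrank_prod, Module.finrank_self] at hr'
    have hn : Module.finrank ℤ_[2] P = n := by omega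
    have h' : ∃ c : Fin n → ZMod 8, (∀ j, c j * c j = 1) ∧
      (∀ i, intClass i (restrictInt f P) = ∑ j, unaryClass i (c j)) ∧
      sign (restrictInt f P) = ∏ j, sign8 (c j) := by
      rcases hx' with rfl | hx'
      · have : Subsingleton P := Module.finrank_zero_iff.1 hn
        exact ⟨0, fun j => j.elim0, fun i => by simp [intClass_of_subsingleton],
          by simp [sign_of_subsingleton]⟩
      · exact ih _ (fun y z => hs _ _) hP hx' hn
    obtain ⟨c, hc, hc', hc''⟩ := h'
    refine ⟨Fin.cons (mod8 (f x x)) c, ?_, fun i => ?_, ?_⟩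
    · refine Fin.cases ?_ hc
      exact (isUnit_iff_mod8 _).1 hx
    · rw [← intClass_congr i h, intClass_prod, intClass_unaryForm i hx, hc', Fin.sum_univ_succ]
      simp
    · rw [← sign_congr h, sign_prod (isUnimodular_unaryForm hx) hP, sign_unaryForm, hc'',
        Fin.prod_univ_succ, legendre_eq]
      simp

/-- Even unimodular forms are sums of planes. -/
theorem exists_plane_sum (k : ℕ) : ∀ {U : Type u} [AddCommGroup U] [Module ℤ_[2] U]
    [Module.Free ℤ_[2] U] [Module.Finite ℤ_[2] U] (f : LinearMap.BilinForm ℤ_[2] U),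
    (∀ x y, f x y = f y x) → IsUnimodular f → IsEvenForm f → Module.finrank ℤ_[2] U ≤ k →
    ∃ m n : ℕ, Module.finrank ℤ_[2] U = 2 * (m + n) ∧
      (∀ i, intClass i f = m • hypClass i + n • anisoClass i) ∧ sign f = (-1) ^ n := by
  induction k with
  | zero =>
    intro U _ _ _ _ f hs hf he hr
    have hr : Module.finrank ℤ_[2] U = 0 := by omega
    have : Subsingleton U := Module.finrank_zero_iff.1 hr
    exact ⟨0, 0, by simp [hr], by simp [intClass_of_subsingleton], by simp [sign_of_subsingleton]⟩
  | succ k ih =>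
    intro U _ _ _ _ f hs hf he hr
    rcases Nat.eq_zero_or_pos (Module.finrank ℤ_[2] U) with h0 | h0
    · exact ih f hs hf he (by omega)
    -- Two vectors of inner product 1 and even norms span a unimodular plane, which splits off.
    obtain ⟨x, y, hxy⟩ := exists_form_eq_one hf h0
    obtain ⟨a, ha⟩ := even_iff_two_dvd.1 (he x)
    obtain ⟨c, hc⟩ := even_iff_two_dvd.1 (he y)
    have h := intIsometric_prod_orthCompl f hs (planeForm a c) (isUnimodular_planeForm a c)
      (pairMap x y) (form_pairMap f hs x y a c ha hxy hc)
    set P := orthCompl f (pairMap x y)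
    have hP := (hf.of_isometric h.symm).right_of_prod
    have hr' := h.finrank_eq
    rw [Module.finrank_prod, Module.finrank_prod, Module.finrank_self] at hr'
    obtain ⟨m, n, h1, h2, h3⟩ := ih (restrictInt f P) (fun y z => hs _ _) hP (fun z => he _)
      (by omega)
    have hsg : sign f = sign (planeForm a c) * (-1) ^ n := by
      rw [← sign_congr h, sign_prod (isUnimodular_planeForm a c) hP, h3]
    have hcl (i : ℤ) : intClass i f =
        intClass i (planeForm a c) + (m • hypClass i + n • anisoClass i) := by
      rw [← intClass_congr i h, intClass_prod, h2]
    by_cases hsp : sign (planeForm a c) = 1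
    · refine ⟨m + 1, n, by omega, fun i => ?_, by rw [hsg, hsp, one_mul]⟩
      rcases intClass_planeForm i a c with h4 | h4
      · rw [hcl, h4.1, succ_nsmul]; abel
      · rw [h4.2] at hsp; exact absurd hsp (by decide)
    · refine ⟨m, n + 1, by omega, fun i => ?_, ?_⟩
      · rcases intClass_planeForm i a c with h4 | h4
        · exact absurd h4.2 hsp
        · rw [hcl, h4.1, succ_nsmul]; abel
      · rcases intClass_planeForm 0 a c with h4 | h4
        · exact absurd h4.2 hsp
        · rw [hsg, h4.2, pow_succ, mul_comm]

/-- Anisotropic planes turn hyperbolic in pairs, so only the number of planes and the parity of `n`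
matter. -/
theorem nsmul_hypClass_add_nsmul_anisoClass (i : ℤ) (m n m' n' : ℕ) (h : m + n = m' + n')
    (h' : (-1 : ℤˣ) ^ n = (-1) ^ n') :
    m • hypClass i + n • anisoClass i = m' • hypClass i + n' • anisoClass i := by
  have key (n m : ℕ) : m • hypClass i + n • anisoClass i =
      (m + 2 * (n / 2)) • hypClass i + (n % 2) • anisoClass i := by
    conv_lhs => rw [← Nat.mod_add_div n 2]
    rw [add_nsmul, add_nsmul, mul_nsmul (anisoClass i), mul_nsmul (hypClass i), two_nsmul,
      two_nsmul, anisoClass_add_self]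
    abel
  have hp : n % 2 = n' % 2 := by
    rcases Nat.even_or_odd n with hn | hn <;> rcases Nat.even_or_odd n' with hn' | hn'
    · rw [Nat.even_iff.1 hn, Nat.even_iff.1 hn']
    · simp [hn.neg_one_pow, hn'.neg_one_pow] at h'
    · simp [hn.neg_one_pow, hn'.neg_one_pow] at h'
    · rw [Nat.odd_iff.1 hn, Nat.odd_iff.1 hn']
  rw [key n, key n', hp, show m + 2 * (n / 2) = m' + 2 * (n' / 2) by omega]

end TwoAdic

namespace TwoAdic

/-! ### Oddity fusion -/

/-- The entries are congruent mod 4, so shifts by 4 produce three equal entries t and a fourth one.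
The triple relation replaces t, t, t by 3t = 4 - t and the anisotropic plane. The plane does not see
the sign of t, and a relation between binary forms remains. -/
theorem unaryClass_four_neg (i : ℤ) (c₁ c₂ c₃ c₄ : ZMod 8) (h₁ : c₁ * c₁ = 1) (h₂ : c₂ * c₂ = 1)
    (h₃ : c₃ * c₃ = 1) (h₄ : c₄ * c₄ = 1) (h₁₂ : 2 * (c₁ + c₂) = 4) (h₁₃ : 2 * (c₁ + c₃) = 4)
    (h₁₄ : 2 * (c₁ + c₄) = 4) :
    unaryClass i c₁ + unaryClass i c₂ + unaryClass i c₃ + unaryClass i c₄ =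
      unaryClass i (-c₁) + unaryClass i (-c₂) + unaryClass i (-c₃) + unaryClass i (-c₄) := by
  have d1 : ∀ t : ZMod 8, t * t = 1 → (t + 4) * (t + 4) = 1 := by decide
  have d2 : ∀ t : ZMod 8, t * t = 1 → 3 * t = 4 - t := by decide
  have d3 : ∀ t : ZMod 8, t * t = 1 → (4 - t) * (4 - t) = 1 := by decide
  have d4 : ∀ t : ZMod 8, 4 - t + 4 = -t := by decide
  have d5 : ∀ t : ZMod 8, 4 - t = -(t + 4) := by decide
  have h8 : (4 : ZMod 8) + 4 = 0 := by decide
  have key (t c d : ZMod 8) (ht : t * t = 1) (hc : c = t ∨ c = t + 4) (hd : d = t ∨ d = t + 4) :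
      unaryClass i c + unaryClass i d = unaryClass i (c + d - t) + unaryClass i t := by
    rcases hd with rfl | rfl
    · congr 2; ring
    · rw [unaryClass_add_self_scale i c (t + 4)]
      · congr 2
        · ring
        · rw [add_assoc, show (4 : ZMod 8) + 4 = 0 by decide, add_zero]
      · rcases hc with rfl | rfl
        · exact ht
        · exact d1 t ht
      · exact d1 t ht
  have key' (t c₂ c₃ c₄ : ZMod 8) (ht : t * t = 1) (hc₂ : c₂ = t ∨ c₂ = t + 4)
      (hc₃ : c₃ = t ∨ c₃ = t + 4) (hc₄ : c₄ = t ∨ c₄ = t + 4) :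
      unaryClass i t + unaryClass i c₂ + unaryClass i c₃ + unaryClass i c₄ =
        unaryClass i (c₂ + c₃ + c₄ - 2 * t) + unaryClass i (4 - t) + anisoClass i := by
    have e1 : c₂ + c₃ - t = t ∨ c₂ + c₃ - t = t + 4 := by
      rcases hc₂ with rfl | rfl <;> rcases hc₃ with rfl | rfl
      · left; ring
      · right; ring
      · right; ring
      · left; linear_combination h8
    have e3 := unaryClass_triple i t ht
    have e4 := d2 t ht
    calc unaryClass i t + unaryClass i c₂ + unaryClass i c₃ + unaryClass i c₄
        = unaryClass i t + (unaryClass i c₂ + unaryClass i c₃) + unaryClass i c₄ := by abel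
      _ = unaryClass i t + unaryClass i t + (unaryClass i (c₂ + c₃ - t) + unaryClass i c₄) := by
          rw [key t c₂ c₃ ht hc₂ hc₃]; abel
      _ = (unaryClass i t + unaryClass i t + unaryClass i t) +
            unaryClass i (c₂ + c₃ + c₄ - 2 * t) := by
          rw [key t _ c₄ ht e1 hc₄, show c₂ + c₃ - t + c₄ - t = c₂ + c₃ + c₄ - 2 * t by ring]; abel
      _ = _ := by rw [e3, e4]; abel
  have hcl (c d : ZMod 8) (hc : c * c = 1) (hd : d * d = 1) (h : 2 * (c + d) = 4) :
      d = c ∨ d = c + 4 := by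
    revert hc hd h; revert c d; decide
  have hneg (c d : ZMod 8) (h : d = c ∨ d = c + 4) : -d = -c ∨ -d = -c + 4 := by
    revert h; revert c d; decide
  have g₂ := hcl _ _ h₁ h₂ h₁₂
  have g₃ := hcl _ _ h₁ h₃ h₁₃
  have g₄ := hcl _ _ h₁ h₄ h₁₄
  rw [key' c₁ c₂ c₃ c₄ h₁ g₂ g₃ g₄, key' (-c₁) (-c₂) (-c₃) (-c₄) (by rw [neg_mul_neg, h₁])
    (hneg _ _ g₂) (hneg _ _ g₃) (hneg _ _ g₄)]
  congr 1
  have hw : c₂ + c₃ + c₄ - 2 * c₁ = c₁ ∨ c₂ + c₃ + c₄ - 2 * c₁ = c₁ + 4 := by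
    rcases g₂ with rfl | rfl <;> rcases g₃ with rfl | rfl <;> rcases g₄ with rfl | rfl
    · left; ring
    · right; ring
    · right; ring
    · left; linear_combination h8
    · right; ring
    · left; linear_combination h8
    · left; linear_combination h8
    · right; linear_combination h8
  have hw' : -c₂ + -c₃ + -c₄ - 2 * -c₁ = -(c₂ + c₃ + c₄ - 2 * c₁) := by ring
  rw [hw']
  rcases hw with h | h
  · rw [h, unaryClass_add_self_scale i c₁ (4 - c₁) h₁ (d3 c₁ h₁), add_comm]
    congr 2
    · exact d4 c₁
    · ring
  · rw [h, add_comm]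
    congr 2
    · exact d5 c₁
    · ring

theorem unaryClass_neg_self_scale (i : ℤ) (c d : ZMod 8) (hc : c * c = 1) (hd : d * d = 1)
    (h : 2 * (c + d) = 0) :
    unaryClass i c + unaryClass i d = unaryClass i (-c) + unaryClass i (-d) := by
  have h1 : d = -c ∨ d = -c + 4 := by revert hc hd h; revert c d; decide
  rcases h1 with rfl | rfl
  · rw [neg_neg, add_comm]
  · rw [unaryClass_add_self_scale i _ _ hc hd, add_comm]
    congr 2
    · revert c; decide
    · revert c; decide

/-- Here d is -c mod 4, so c + 2d = -c: the move between adjacent scales just negates both entries.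
-/
theorem unaryClass_neg_next_scale (i : ℤ) (c d : ZMod 8) (hc : c * c = 1) (hd : d * d = 1)
    (h : 2 * (c + d) = 0) :
    unaryClass i c + unaryClass (i + 1) d = unaryClass i (-c) + unaryClass (i + 1) (-d) := by
  rw [unaryClass_add_next_scale i c d hc hd]
  congr 2
  · revert hc hd h; revert c d; decide
  · revert hc hd h; revert c d; decide

/-- Here d is c mod 4, so c + 2d = 3c = -c + 4: besides the negation, both Legendre symbols flip.
This is a sign walk. -/
theorem unaryClass_neg_add_next_scale (i : ℤ) (c d : ZMod 8) (hc : c * c = 1) (hd : d * d = 1)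
    (h : 2 * (c + d) = 4) :
    unaryClass i c + unaryClass (i + 1) d =
      unaryClass i (-c + 4) + unaryClass (i + 1) (-d + 4) := by
  rw [unaryClass_add_next_scale i c d hc hd]
  congr 2
  · revert hc hd h; revert c d; decide
  · revert hc hd h; revert c d; decide

/-! ### Moves on diagonal forms -/

section Slots

variable {ι : Type*} [Fintype ι] [DecidableEq ι]

/-- The class of the diagonal form with entries `2 ^ k s * c s`. -/
def diagClass (k : ι → ℤ) (c : ι → ZMod 8) : FormClass := ∑ s, unaryClass (k s) (c s)

theorem diagClass_congr {k : ι → ℤ} {c c' : ι → ZMod 8} (F : Finset ι)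
    (h : ∀ s ∉ F, c s = c' s)
    (h' : ∑ s ∈ F, unaryClass (k s) (c s) = ∑ s ∈ F, unaryClass (k s) (c' s)) :
    diagClass k c = diagClass k c' := by
  rw [diagClass, diagClass, ← Finset.sum_add_sum_compl F, ← Finset.sum_add_sum_compl F, h']
  congr 1
  exact Finset.sum_congr rfl fun s hs => by rw [h s (Finset.mem_compl.1 hs)]

/-- Change the signs of the entries in `F`. -/
def negOn (F : Finset ι) (c : ι → ZMod 8) : ι → ZMod 8 := fun s => if s ∈ F then -c s else c s

/-- Add `4` to the entries in `F`. -/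
def shiftOn (F : Finset ι) (c : ι → ZMod 8) : ι → ZMod 8 :=
  fun s => if s ∈ F then c s + 4 else c s

theorem negOn_mul_self (F : Finset ι) (c : ι → ZMod 8) (s : ι) :
    negOn F c s * negOn F c s = c s * c s := by
  unfold negOn; split_ifs <;> ring

theorem shiftOn_mul_self (F : Finset ι) (c : ι → ZMod 8) (s : ι) (h : c s * c s = 1) :
    shiftOn F c s * shiftOn F c s = 1 := by
  unfold shiftOn; split_ifs
  · revert h; generalize c s = d; revert d; decide
  · exact h

/-- Two slots belong to the same compartment. -/
def Joined (k : ι → ℤ) (s s' : ι) : Prop := ∀ x ∈ Set.uIcc (k s) (k s'), x ∈ Set.range k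

/-- Opposite residues modulo `4` in the slots `s`, `s'` can be exchanged. -/
def Exchangeable (k : ι → ℤ) (s s' : ι) : Prop :=
  ∀ c : ι → ZMod 8, (∀ s, c s * c s = 1) → 2 * (c s + c s') = 0 →
    diagClass k c = diagClass k (negOn {s, s'} c)

theorem Exchangeable.symm {k : ι → ℤ} {s s' : ι} (h : Exchangeable k s s') :
    Exchangeable k s' s := by
  intro c hc hcs
  rw [Finset.pair_comm]
  exact h c hc (by rw [add_comm]; exact hcs)

theorem two_mul_add_self_ne {c : ZMod 8} (hc : c * c = 1) : 2 * (c + c) ≠ 0 := by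
  revert hc; revert c; decide

theorem exchange_cases {a b c : ZMod 8} (ha : a * a = 1) (hb : b * b = 1) (hc : c * c = 1)
    (h : 2 * (a + c) = 0) : (2 * (b + c) = 0 ∧ 2 * (a + -b) = 0) ∨
      (2 * (a + b) = 0 ∧ 2 * (-b + c) = 0) := by
  revert ha hb hc h; revert a b c; decide

/-- Odd residues mod 4 take two values, so `b` is opposite to exactly one of `a` and `c`. That
exchange comes first and makes `b` opposite to the other one; in the end `b` has been negated twice.
-/
theorem Exchangeable.trans {k : ι → ℤ} {a b c : ι} (h : Exchangeable k a b)
    (h' : Exchangeable k b c) : Exchangeable k a c := by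
  intro d hd hac
  by_cases hab : a = b
  · subst hab; exact h' d hd hac
  by_cases hbc : b = c
  · subst hbc; exact h d hd hac
  have hac' : a ≠ c := by rintro rfl; exact two_mul_add_self_ne (hd a) hac
  rcases exchange_cases (hd a) (hd b) (hd c) hac with ⟨h1, h2⟩ | ⟨h1, h2⟩
  · rw [h' d hd h1, h (negOn {b, c} d) (fun s => by rw [negOn_mul_self, hd])
      (by simpa [negOn, hab, hac'] using h2)]
    congr 1
    funext s
    simp only [negOn, Finset.mem_insert, Finset.mem_singleton]
    by_cases h3 : s = a <;> by_cases h4 : s = b <;> by_cases h5 : s = c <;> simp_all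
  · rw [h d hd h1, h' (negOn {a, b} d) (fun s => by rw [negOn_mul_self, hd])
      (by simpa [negOn, Ne.symm hbc, Ne.symm hac'] using h2)]
    congr 1
    funext s
    simp only [negOn, Finset.mem_insert, Finset.mem_singleton]
    by_cases h3 : s = a <;> by_cases h4 : s = b <;> by_cases h5 : s = c <;> simp_all

theorem exchangeable_of_eq {k : ι → ℤ} {s s' : ι} (h : k s = k s') : Exchangeable k s s' := by
  intro c hc hcs
  have hne : s ≠ s' := by rintro rfl; exact two_mul_add_self_ne (hc s) hcs
  refine diagClass_congr {s, s'} (fun x hx => by simp [negOn, hx]) ?_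
  rw [Finset.sum_pair hne, Finset.sum_pair hne, h]
  simpa [negOn] using unaryClass_neg_self_scale (k s') _ _ (hc s) (hc s') hcs

theorem exchangeable_of_eq_add_one {k : ι → ℤ} {s s' : ι} (h : k s' = k s + 1) :
    Exchangeable k s s' := by
  intro c hc hcs
  have hne : s ≠ s' := by rintro rfl; omega
  refine diagClass_congr {s, s'} (fun x hx => by simp [negOn, hx]) ?_
  rw [Finset.sum_pair hne, Finset.sum_pair hne, h]
  simpa [negOn] using unaryClass_neg_next_scale (k s) _ _ (hc s) (hc s') hcs

theorem Joined.symm {k : ι → ℤ} {s s' : ι} (h : Joined k s s') : Joined k s' s := by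
  intro x hx; rw [Set.uIcc_comm] at hx; exact h x hx

theorem Joined.trans {k : ι → ℤ} {a b c : ι} (h : Joined k a b) (h' : Joined k b c) :
    Joined k a c := fun x hx =>
  (Set.uIcc_subset_uIcc_union_uIcc (b := k b) hx).elim (h x) (h' x)

theorem joined_refl (k : ι → ℤ) (s : ι) : Joined k s s := by
  intro x hx
  rw [Set.uIcc_self, Set.mem_singleton_iff] at hx
  exact ⟨s, hx.symm⟩

theorem exchangeable_of_add_nat {k : ι → ℤ} (n : ℕ) : ∀ {s s' : ι}, k s' = k s + n →
    Joined k s s' → Exchangeable k s s' := by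
  induction n with
  | zero => intro s s' h _; exact exchangeable_of_eq (by simpa using h.symm)
  | succ n ih =>
    intro s s' h hj
    push_cast at h
    obtain ⟨a, ha⟩ := hj (k s + n) (by rw [Set.mem_uIcc]; left; constructor <;> omega)
    refine (ih ha fun x hx => hj x ?_).trans (exchangeable_of_eq_add_one (by omega))
    rw [Set.mem_uIcc] at hx ⊢
    omega

theorem Joined.exchangeable {k : ι → ℤ} {s s' : ι} (h : Joined k s s') : Exchangeable k s s' := by
  rcases le_total (k s) (k s') with h1 | h1
  · exact exchangeable_of_add_nat (k s' - k s).toNat (by omega) h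
  · exact (exchangeable_of_add_nat (k s - k s').toNat (by omega) h.symm).symm

/-- Equal residues modulo `4` in the slots `a`, `b` can be negated at the price of changing
signs at `p`, `q`. -/
def PairNegatable (k : ι → ℤ) (p q a b : ι) : Prop :=
  ∀ c : ι → ZMod 8, (∀ s, c s * c s = 1) → 2 * (c a + c b) = 4 →
    diagClass k c = diagClass k (shiftOn {p, q} (negOn {a, b} c))

theorem PairNegatable.symm {k : ι → ℤ} {p q a b : ι} (h : PairNegatable k p q a b) :
    PairNegatable k p q b a := by
  intro c hc hcs
  rw [Finset.pair_comm b a]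
  exact h c hc (by rw [add_comm]; exact hcs)

theorem pairNegatable_adjacent {k : ι → ℤ} {p q : ι} (h : k q = k p + 1) :
    PairNegatable k p q p q := by
  intro c hc hcs
  have hne : p ≠ q := by rintro rfl; omega
  refine diagClass_congr {p, q} (fun x hx => by simp [negOn, shiftOn, hx]) ?_
  rw [Finset.sum_pair hne, Finset.sum_pair hne, h]
  simpa [negOn, shiftOn] using unaryClass_neg_add_next_scale (k p) _ _ (hc p) (hc q) hcs

theorem pair_exchange_cases {a b c : ZMod 8} (ha : a * a = 1) (hb : b * b = 1) (hc : c * c = 1)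
    (h : 2 * (a + c) = 4) : (2 * (b + c) = 0 ∧ 2 * (a + -b) = 4) ∨
      (2 * (a + b) = 4 ∧ 2 * (-b + c) = 0 ∧ 2 * (-b + 4 + c) = 0 ∧ 2 * (-b + (c + 4)) = 0 ∧
        2 * (-b + 4 + (c + 4)) = 0) := by
  revert ha hb hc h; revert a b c; decide

/-- The intermediate slot `b` is negated twice, as in `Exchangeable.trans`. Shifts by 4 do not
affect conditions on residues mod 4, so `p` and `q` may coincide with the other slots. -/
theorem PairNegatable.move {k : ι → ℤ} {p q a b c : ι} (h : PairNegatable k p q a b)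
    (hab : a ≠ b) (hac : a ≠ c) (hj : Joined k b c) : PairNegatable k p q a c := by
  intro d hd hcs
  by_cases hbc : b = c
  · subst hbc; exact h d hd hcs
  rcases pair_exchange_cases (hd a) (hd b) (hd c) hcs with ⟨h1, h2⟩ | ⟨h1, h2, h3, h4, h5⟩
  · rw [hj.exchangeable d hd h1, h (negOn {b, c} d) (fun s => by rw [negOn_mul_self, hd])
      (by simpa [negOn, hab, hac] using h2)]
    congr 2
    funext s
    simp only [negOn, Finset.mem_insert, Finset.mem_singleton]
    by_cases h3 : s = a <;> by_cases h4 : s = b <;> by_cases h5 : s = c <;> simp_all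
  · rw [h d hd h1, hj.exchangeable (shiftOn {p, q} (negOn {a, b} d))
      (fun s => shiftOn_mul_self _ _ _ (by rw [negOn_mul_self, hd]))]
    · congr 1
      funext s
      have h44 (x : ZMod 8) : -(x + 4) = -x + 4 := by revert x; decide
      simp only [negOn, shiftOn, Finset.mem_insert, Finset.mem_singleton]
      by_cases h3 : s = a <;> by_cases h4 : s = b <;> by_cases h5 : s = c <;> simp_all
      all_goals split_ifs <;> simp [← h44]
    · simp only [negOn, shiftOn, Finset.mem_insert, Finset.mem_singleton, Ne.symm hac, Ne.symm hbc]
      simp only [or_true, or_self, if_true, if_false]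
      split_ifs <;> assumption

/-- The adjacent pair `p`, `q` is moved to `a`, `b` one end at a time, so that the two ends stay
distinct. -/
theorem pairNegatable_of_joined {k : ι → ℤ} {p q a b : ι} (h : k q = k p + 1) (hpq : Joined k p q)
    (hpa : Joined k p a) (hpb : Joined k p b) (hab : a ≠ b) : PairNegatable k p q a b := by
  have hpq' : p ≠ q := by rintro rfl; omega
  have key {b} (hb : Joined k p b) (hne : p ≠ b) : PairNegatable k p q p b :=
    (pairNegatable_adjacent h).move hpq' hne (hpq.symm.trans hb)
  by_cases ha : p = a
  · subst ha; exact key hpb hab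
  by_cases hb : p = b
  · subst hb; exact (key hpa ha).symm
  · exact ((key hpb hb).symm.move (Ne.symm hb) (Ne.symm hab) hpa).symm

/-- Four equal residues modulo `4` in one compartment can be negated. -/
theorem diagClass_negOn_four {k : ι → ℤ} {a₁ a₂ a₃ a₄ : ι} (h₁₂ : a₁ ≠ a₂) (h₁₃ : a₁ ≠ a₃)
    (h₁₄ : a₁ ≠ a₄) (h₂₃ : a₂ ≠ a₃) (h₂₄ : a₂ ≠ a₄) (h₃₄ : a₃ ≠ a₄) (j₂ : Joined k a₁ a₂)
    (j₃ : Joined k a₁ a₃) (j₄ : Joined k a₁ a₄) (c : ι → ZMod 8) (hc : ∀ s, c s * c s = 1)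
    (c₂ : 2 * (c a₁ + c a₂) = 4) (c₃ : 2 * (c a₁ + c a₃) = 4) (c₄ : 2 * (c a₁ + c a₄) = 4) :
    diagClass k c = diagClass k (negOn {a₁, a₂, a₃, a₄} c) := by
  by_cases hk : k a₂ = k a₁ ∧ k a₃ = k a₁ ∧ k a₄ = k a₁
  · obtain ⟨k₂, k₃, k₄⟩ := hk
    refine diagClass_congr {a₁, a₂, a₃, a₄} (fun x hx => by rw [negOn, if_neg hx]) ?_
    have := unaryClass_four_neg (k a₁) _ _ _ _ (hc a₁) (hc a₂) (hc a₃) (hc a₄) c₂ c₃ c₄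
    rw [Finset.sum_insert (by simp [*]), Finset.sum_insert (by simp [*]), Finset.sum_pair h₃₄,
      Finset.sum_insert (by simp [*]), Finset.sum_insert (by simp [*]), Finset.sum_pair h₃₄]
    simp only [negOn, Finset.mem_insert, Finset.mem_singleton, true_or, or_true, if_true, k₂, k₃,
      k₄]
    simpa only [add_assoc] using this
  -- Otherwise the compartment contains two adjacent scales. Negating the four entries as two pairs
  -- shifts `p` and `q` by 4 twice, that is, not at all.
  · have hpq : ∃ p q, k q = k p + 1 ∧ Joined k a₁ p ∧ Joined k a₁ q := by
      have key (b) (hb : Joined k a₁ b) (hne : k b ≠ k a₁) :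
          ∃ p q, k q = k p + 1 ∧ Joined k a₁ p ∧ Joined k a₁ q := by
        rcases lt_or_gt_of_ne hne with h | h
        · obtain ⟨q, hq⟩ := hb (k b + 1) (by rw [Set.mem_uIcc]; right; constructor <;> omega)
          refine ⟨b, q, hq, hb, fun x hx => hb x ?_⟩
          rw [Set.mem_uIcc] at hx ⊢
          omega
        · obtain ⟨q, hq⟩ := hb (k a₁ + 1) (by rw [Set.mem_uIcc]; left; constructor <;> omega)
          refine ⟨a₁, q, hq, joined_refl k a₁, fun x hx => hb x ?_⟩
          rw [Set.mem_uIcc] at hx ⊢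
          omega
      by_cases k₂ : k a₂ = k a₁
      · by_cases k₃ : k a₃ = k a₁
        · exact key a₄ j₄ fun k₄ => hk ⟨k₂, k₃, k₄⟩
        · exact key a₃ j₃ k₃
      · exact key a₂ j₂ k₂
    obtain ⟨p, q, hpq, hp, hq⟩ := hpq
    have hp' := hp.symm
    rw [pairNegatable_of_joined hpq (hp'.trans hq) hp' (hp'.trans j₂) h₁₂ c hc c₂]
    have h34 : 2 * (c a₃ + c a₄) = 4 := by
      have g1 := hc a₁
      revert g1 c₃ c₄
      generalize c a₁ = x; generalize c a₃ = y; generalize c a₄ = z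
      revert x y z; decide
    have hsh (x y : ZMod 8) (h : 2 * (x + y) = 4) : 2 * (x + 4 + y) = 4 ∧ 2 * (x + (y + 4)) = 4 ∧
        2 * (x + 4 + (y + 4)) = 4 := by
      revert h; revert x y; decide
    obtain ⟨g1, g2, g3⟩ := hsh _ _ h34
    rw [pairNegatable_of_joined hpq (hp'.trans hq) (hp'.trans j₃) (hp'.trans j₄) h₃₄
      (shiftOn {p, q} (negOn {a₁, a₂} c))
      (fun s => shiftOn_mul_self _ _ _ (by rw [negOn_mul_self, hc]))]
    · congr 1
      funext s
      have h44 (x : ZMod 8) : -(x + 4) + 4 = -x := by revert x; decide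
      have h45 (x : ZMod 8) : x + 4 + 4 = x := by revert x; decide
      simp only [negOn, shiftOn, Finset.mem_insert, Finset.mem_singleton]
      by_cases h5 : s = p ∨ s = q
      · simp only [h5, if_true]
        by_cases h3 : s = a₁ <;> by_cases h4 : s = a₂ <;> by_cases h5 : s = a₃ <;>
          by_cases h6 : s = a₄ <;> simp_all
      · simp only [h5, if_false]
        by_cases h3 : s = a₁ <;> by_cases h4 : s = a₂ <;> by_cases h5 : s = a₃ <;>
          by_cases h6 : s = a₄ <;> simp_all
    · simp only [negOn, shiftOn, Finset.mem_insert, Finset.mem_singleton, Ne.symm h₁₃,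
        Ne.symm h₂₃, Ne.symm h₁₄, Ne.symm h₂₄, or_self, if_false]
      split_ifs <;> assumption

end Slots

end TwoAdic

namespace TwoAdic

/-! ### Diagonal forms are determined by signs and compartment sums -/

section Slots

variable {ι : Type*} [Fintype ι] [DecidableEq ι]

open Classical in
/-- The set of slots in which two lists of entries differ. -/
def diffSet (c c' : ι → ZMod 8) : Finset ι := Finset.univ.filter fun s => c s ≠ c' s

theorem mem_diffSet {c c' : ι → ZMod 8} {s : ι} : s ∈ diffSet c c' ↔ c s ≠ c' s := by
  simp [diffSet]

open Classical in
/-- Forms whose entries agree up to sign in each slot are isometric if the sums over each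
compartment agree. -/
theorem diagClass_eq_of_neg (k : ι → ℤ) (c' : ι → ZMod 8) (n : ℕ) : ∀ c : ι → ZMod 8,
    (∀ s, c s * c s = 1) → (∀ s, c' s = c s ∨ c' s = -c s) →
    (∀ s, ∑ x ∈ Finset.univ.filter (Joined k s), c x =
      ∑ x ∈ Finset.univ.filter (Joined k s), c' x) →
    (diffSet c c').card ≤ n → diagClass k c = diagClass k c' := by
  have hne : ∀ x : ZMod 8, x * x = 1 → -x ≠ x := by decide
  have h20 : ∀ x y : ZMod 8, x * x = 1 → y * y = 1 → 2 * (x + y) ≠ 0 → 2 * (x + y) = 4 := by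
    decide
  have h24 : ∀ x y : ZMod 8, x * x = 1 → y * y = 1 → 2 * (x + y) = 4 → 2 * y = 2 * x := by decide
  have hcard : ∀ x y : ZMod 8, x * x = 1 → y * (2 * x) = 0 → 2 * y = 0 := by decide
  induction n using Nat.strong_induction_on with
  | _ n ih =>
  intro c hc hcc hsum hn
  have hneg (s) (hs : s ∈ diffSet c c') : c' s = -c s :=
    (hcc s).resolve_left fun h => mem_diffSet.1 hs h.symm
  -- Negating the entries in `F` preserves the compartment sums as soon as the sums of `2 * c x`
  -- over `F` vanish in each compartment, and then the induction applies.
  have key (F : Finset ι) (hF : F ⊆ diffSet c c') (hF0 : F.Nonempty)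
      (h0 : ∀ s, ∑ x ∈ F.filter (Joined k s), (2 * c x) = 0)
      (h1 : diagClass k c = diagClass k (negOn F c)) : diagClass k c = diagClass k c' := by
    have hd : diffSet (negOn F c) c' = diffSet c c' \ F := by
      ext s
      simp only [mem_diffSet, Finset.mem_sdiff, negOn]
      by_cases hs : s ∈ F
      · simp [hs, hneg s (hF hs)]
      · simp [hs]
    have hlt : (diffSet (negOn F c) c').card < n := by
      rw [hd]
      exact lt_of_lt_of_le (Finset.card_lt_card (Finset.sdiff_ssubset hF hF0)) hn
    rw [h1]
    refine ih _ hlt (negOn F c) (fun s => by rw [negOn_mul_self, hc]) (fun s => ?_) (fun s => ?_)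
      le_rfl
    · by_cases hs : s ∈ F
      · left; rw [negOn, if_pos hs, hneg s (hF hs)]
      · rw [negOn, if_neg hs]; exact hcc s
    · rw [← hsum s, ← sub_eq_zero, ← Finset.sum_sub_distrib]
      have : ∀ x, negOn F c x - c x = if x ∈ F then -(2 * c x) else 0 := by
        intro x; unfold negOn; split_ifs <;> ring
      simp only [this]
      rw [← Finset.sum_filter, Finset.sum_neg_distrib, Finset.filter_filter]
      have h2 := h0 s
      rw [neg_eq_zero, ← h2]
      congr 1
      ext x
      simp [and_comm]
  by_cases hD : diffSet c c' = ∅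
  · congr 1
    funext s
    by_contra hs
    have := mem_diffSet.2 hs
    rw [hD] at this
    exact absurd this (Finset.notMem_empty s)
  obtain ⟨s, hs⟩ := Finset.nonempty_iff_ne_empty.2 hD
  set C := (diffSet c c').filter (Joined k s)
  by_cases hex : ∃ b ∈ C, 2 * (c s + c b) = 0
  · obtain ⟨b, hb, hsb⟩ := hex
    have hbC := Finset.mem_filter.1 hb
    have hsb' : s ≠ b := by rintro rfl; exact two_mul_add_self_ne (hc s) hsb
    refine key {s, b} (fun x hx => ?_) ⟨s, by simp⟩ (fun t => ?_) (hbC.2.exchangeable c hc hsb)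
    · rcases Finset.mem_insert.1 hx with rfl | hx
      · exact hs
      · rw [Finset.mem_singleton.1 hx]; exact hbC.1
    · have : Joined k t s ↔ Joined k t b := ⟨fun h => h.trans hbC.2, fun h => h.trans hbC.2.symm⟩
      rw [Finset.sum_filter, Finset.sum_pair hsb']
      simp only [this]
      split_ifs
      · rw [← mul_add, hsb]
      · simp
  -- Now all differing entries of the compartment are congruent mod 4. Equal compartment sums force
  -- their number to be a multiple of 4, so four of them can be negated at once.
  · push Not at hex
    have hC (b) (hb : b ∈ C) : 2 * (c s + c b) = 4 := h20 _ _ (hc s) (hc b) (hex b hb)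
    have hsC : s ∈ C := Finset.mem_filter.2 ⟨hs, joined_refl k s⟩
    have hsumC : ∑ x ∈ C, 2 * c x = 0 := by
      have h1 := hsum s
      rw [← sub_eq_zero, ← Finset.sum_sub_distrib] at h1
      rw [← h1, Finset.sum_filter, Finset.sum_filter, diffSet, Finset.sum_filter]
      refine Finset.sum_congr rfl fun x _ => ?_
      by_cases hx : c x = c' x
      · simp [hx]
      · have := hneg x (mem_diffSet.2 hx)
        by_cases hj : Joined k s x
        · simp only [hj, if_true]
          rw [if_pos hx, this]
          ring
        · simp [hj]
    rw [Finset.sum_congr rfl fun x hx => h24 _ _ (hc s) (hc x) (hC x hx), Finset.sum_const,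
      nsmul_eq_mul] at hsumC
    have h4 : 4 ∣ C.card := by
      have h5 := hcard _ _ (hc s) hsumC
      have h6 : ((2 * C.card : ℕ) : ZMod 8) = 0 := by push_cast; exact h5
      have h7 := (ZMod.natCast_eq_zero_iff _ _).1 h6
      omega
    have h4' : 3 ≤ (C.erase s).card := by
      rw [Finset.card_erase_of_mem hsC]
      have := Finset.card_pos.2 ⟨s, hsC⟩
      omega
    obtain ⟨F, hF, hF3⟩ := Finset.exists_subset_card_eq h4'
    obtain ⟨a₂, a₃, a₄, h₂₃, h₂₄, h₃₄, rfl⟩ := Finset.card_eq_three.1 hF3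
    have m₂ := Finset.mem_erase.1 (hF (by simp : a₂ ∈ _))
    have m₃ := Finset.mem_erase.1 (hF (by simp : a₃ ∈ _))
    have m₄ := Finset.mem_erase.1 (hF (by simp : a₄ ∈ _))
    have j₂ := (Finset.mem_filter.1 m₂.2).2
    have j₃ := (Finset.mem_filter.1 m₃.2).2
    have j₄ := (Finset.mem_filter.1 m₄.2).2
    have hFC : ({s, a₂, a₃, a₄} : Finset ι) ⊆ C := by
      intro x hx
      rcases Finset.mem_insert.1 hx with rfl | hx
      · exact hsC
      · exact Finset.mem_of_mem_erase (hF hx)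
    refine key {s, a₂, a₃, a₄} (hFC.trans (Finset.filter_subset _ _)) ⟨s, by simp⟩ (fun t => ?_)
      (diagClass_negOn_four m₂.1.symm m₃.1.symm m₄.1.symm h₂₃ h₂₄ h₃₄ j₂ j₃ j₄ c hc (hC _ m₂.2)
        (hC _ m₃.2) (hC _ m₄.2))
    have hj (x) (hx : Joined k s x) : Joined k t x ↔ Joined k t s :=
      ⟨fun h => h.trans hx.symm, fun h => h.trans hx⟩
    rw [Finset.sum_filter, Finset.sum_insert (by simp [m₂.1.symm, m₃.1.symm, m₄.1.symm]),
      Finset.sum_insert (by simp [h₂₃, h₂₄]), Finset.sum_pair h₃₄]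
    simp only [hj _ j₂, hj _ j₃, hj _ j₄]
    split_ifs
    · rw [h24 _ _ (hc s) (hc _) (hC _ m₂.2), h24 _ _ (hc s) (hc _) (hC _ m₃.2),
        h24 _ _ (hc s) (hc _) (hC _ m₄.2)]
      generalize c s = x
      revert x; decide
    · simp

open Classical in
/-- Signs of entries of the same scale can be redistributed. -/
theorem exists_diagClass_eq_sign8_eq (k : ι → ℤ) (c' : ι → ZMod 8) (n : ℕ) :
    ∀ c : ι → ZMod 8, (∀ s, c s * c s = 1) →
    (∀ i, ∏ s ∈ Finset.univ.filter (fun s => k s = i), sign8 (c s) =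
      ∏ s ∈ Finset.univ.filter (fun s => k s = i), sign8 (c' s)) →
    (Finset.univ.filter fun s => sign8 (c s) ≠ sign8 (c' s)).card ≤ n →
    ∃ d : ι → ZMod 8, (∀ s, d s * d s = 1) ∧ (∀ s, sign8 (d s) = sign8 (c' s)) ∧
      (∀ p : ℤ → Prop, ∑ s ∈ Finset.univ.filter (fun s => p (k s)), d s =
        ∑ s ∈ Finset.univ.filter (fun s => p (k s)), c s) ∧ diagClass k c = diagClass k d := by
  have hshift : ∀ x : ZMod 8, x * x = 1 → sign8 (x + 4) = -sign8 x := by decide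
  have h44 : (4 : ZMod 8) + 4 = 0 := by decide
  induction n with
  | zero =>
    intro c hc _ hn
    refine ⟨c, hc, fun s => ?_, fun p => rfl, rfl⟩
    by_contra hs
    have h0 := Finset.card_eq_zero.1 (Nat.le_zero.1 hn)
    have : s ∈ (Finset.univ.filter fun s => sign8 (c s) ≠ sign8 (c' s)) := by simp [hs]
    rw [h0] at this
    exact absurd this (Finset.notMem_empty s)
  | succ n ih =>
    intro c hc hprod hn
    by_cases hall : ∀ s, sign8 (c s) = sign8 (c' s)
    · exact ⟨c, hc, hall, fun p => rfl, rfl⟩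
    push Not at hall
    obtain ⟨a, ha⟩ := hall
    -- The products of signs over the scale of `a` agree, so `a` is not the only slot there with a
    -- wrong sign.
    have hb : ∃ b, b ≠ a ∧ k b = k a ∧ sign8 (c b) ≠ sign8 (c' b) := by
      by_contra hcon
      push Not at hcon
      have hm : a ∈ Finset.univ.filter (fun s => k s = k a) := by simp
      have h1 := hprod (k a)
      rw [← Finset.mul_prod_erase _ _ hm, ← Finset.mul_prod_erase _ _ hm,
        Finset.prod_congr rfl fun x hx => hcon x (Finset.ne_of_mem_erase hx)
          (Finset.mem_filter.1 (Finset.mem_of_mem_erase hx)).2] at h1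
      exact ha (mul_right_cancel h1)
    obtain ⟨b, hba, hk, hb⟩ := hb
    have hflip (s) (hs : s ∈ ({a, b} : Finset ι)) : sign8 (shiftOn {a, b} c s) = sign8 (c' s) := by
      rw [shiftOn, if_pos hs, hshift _ (hc s)]
      have hs' : sign8 (c s) ≠ sign8 (c' s) := by
        rcases Finset.mem_insert.1 hs with rfl | hs
        · exact ha
        · rw [Finset.mem_singleton.1 hs]; exact hb
      rw [Int.units_ne_iff_eq_neg.1 hs', neg_neg]
    have hD : diagClass k c = diagClass k (shiftOn {a, b} c) := by
      refine diagClass_congr {a, b} (fun x hx => by rw [shiftOn, if_neg hx]) ?_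
      rw [Finset.sum_pair hba.symm, Finset.sum_pair hba.symm, hk]
      simpa [shiftOn] using unaryClass_add_self_scale (k a) _ _ (hc a) (hc b)
    have hA : ∀ i, ∏ s ∈ Finset.univ.filter (fun s => k s = i), sign8 (shiftOn {a, b} c s) =
        ∏ s ∈ Finset.univ.filter (fun s => k s = i), sign8 (c' s) := by
      intro i
      rw [← hprod i]
      rw [Finset.prod_filter, Finset.prod_filter,
        ← Finset.prod_mul_prod_compl {a, b}, ← Finset.prod_mul_prod_compl {a, b}]
      congr 1
      · rw [Finset.prod_pair hba.symm, Finset.prod_pair hba.symm, hk]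
        simp only [shiftOn, Finset.mem_insert, Finset.mem_singleton, true_or, or_true, if_true,
          hshift _ (hc a), hshift _ (hc b)]
        split_ifs <;> simp
      · refine Finset.prod_congr rfl fun x hx => ?_
        rw [shiftOn, if_neg (Finset.mem_compl.1 hx)]
    have hB : (Finset.univ.filter fun s => sign8 (shiftOn {a, b} c s) ≠ sign8 (c' s)).card ≤ n := by
      refine Nat.le_of_lt_succ (lt_of_lt_of_le (Finset.card_lt_card ?_) hn)
      rw [Finset.ssubset_iff_of_subset]
      · exact ⟨a, by simp [ha], by simp [hflip a (by simp)]⟩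
      · intro x hx
        rw [Finset.mem_filter] at hx ⊢
        refine ⟨hx.1, ?_⟩
        by_cases hxab : x ∈ ({a, b} : Finset ι)
        · exact absurd (hflip x hxab) hx.2
        · rw [shiftOn, if_neg hxab] at hx; exact hx.2
    obtain ⟨d, hd, hd', hd'', hd'''⟩ := ih (shiftOn {a, b} c)
      (fun s => shiftOn_mul_self _ _ _ (hc s)) hA hB
    refine ⟨d, hd, hd', fun p => ?_, hD.trans hd'''⟩
    rw [hd'', ← sub_eq_zero, ← Finset.sum_sub_distrib]
    have : ∀ x, shiftOn {a, b} c x - c x = if x ∈ ({a, b} : Finset ι) then 4 else 0 := by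
      intro x; unfold shiftOn; split_ifs <;> ring
    simp only [this]
    rw [Finset.sum_filter]
    have h2 : ∀ x, (if p (k x) then (if x ∈ ({a, b} : Finset ι) then (4 : ZMod 8) else 0) else 0) =
        if x ∈ ({a, b} : Finset ι) then (if p (k x) then 4 else 0) else 0 := by
      intro x; split_ifs <;> rfl
    simp only [h2]
    rw [← Finset.sum_filter, Finset.filter_mem_eq_inter, Finset.univ_inter,
      Finset.sum_pair hba.symm, hk]
    split_ifs
    · exact h44
    · simp

open Classical in
/-- Diagonal forms are determined by the signs of their terms and the oddities of their
compartments. -/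
theorem diagClass_eq (k : ι → ℤ) (c c' : ι → ZMod 8) (hc : ∀ s, c s * c s = 1)
    (hc' : ∀ s, c' s * c' s = 1)
    (hprod : ∀ i, ∏ s ∈ Finset.univ.filter (fun s => k s = i), sign8 (c s) =
      ∏ s ∈ Finset.univ.filter (fun s => k s = i), sign8 (c' s))
    (hsum : ∀ s, ∑ x ∈ Finset.univ.filter (Joined k s), c x =
      ∑ x ∈ Finset.univ.filter (Joined k s), c' x) : diagClass k c = diagClass k c' := by
  -- Units mod 8 of equal sign differ by a factor ±1, so once the signs agree slot by slot
  -- `diagClass_eq_of_neg` applies.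
  have h8 : ∀ x y : ZMod 8, x * x = 1 → y * y = 1 → sign8 x = sign8 y → y = x ∨ y = -x := by decide
  obtain ⟨d, hd, hd', hd'', hd'''⟩ := exists_diagClass_eq_sign8_eq k c' _ c hc hprod le_rfl
  rw [hd''']
  refine diagClass_eq_of_neg k c' _ d hd (fun s => h8 _ _ (hd s) (hc' s) (hd' s)) (fun s => ?_)
    le_rfl
  rw [← hsum s]
  -- Being joined to `s` depends only on the scale of a slot, so it is one of the predicates allowed
  -- in `hd''`.
  exact hd'' fun i => ∀ x ∈ Set.uIcc (k s) i, x ∈ Set.range k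

end Slots

end TwoAdic

namespace TwoAdic

open MeasureTheory

/-! ### An additive character of `ℚ₂` -/

/-- Characters to ℚ/ℤ separate points, so some character of ℚ_2/ℤ_2 is nonzero at 1/2, and ℚ/ℤ
embeds in the circle by the exponential. -/
theorem exists_addChar_half : ∃ ψ : AddChar ℚ_[2] Circle, (∀ x : ℤ_[2], ψ x = 1) ∧ ψ (1 / 2) ≠ 1 := by
  let Z : AddSubgroup ℚ_[2] := (Algebra.linearMap ℤ_[2] ℚ_[2]).toAddMonoidHom.range
  have hhalf : (QuotientAddGroup.mk (1 / 2) : ℚ_[2] ⧸ Z) ≠ 0 := by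
    intro h
    rw [QuotientAddGroup.eq_zero_iff] at h
    obtain ⟨x, hx⟩ := h
    have hx : (x : ℚ_[2]) = 1 / 2 := hx
    have h2 : (2 * x : ℤ_[2]) = 1 := by
      apply Subtype.coe_injective
      change ((2 * x : ℤ_[2]) : ℚ_[2]) = 1
      rw [PadicInt.coe_mul, hx, show ((2 : ℤ_[2]) : ℚ_[2]) = 2 from rfl]
      norm_num
    exact (isUnit_iff_not_two_dvd (2 : ℤ_[2])).1 (IsUnit.of_mul_eq_one x h2) dvd_rfl
  obtain ⟨c, hc⟩ := CharacterModule.exists_character_apply_ne_zero_of_ne_zero hhalf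
  let h : ℚ →+ Additive Circle :=
    { toFun := fun q => Additive.ofMul (Circle.exp (2 * Real.pi * q))
      map_zero' := by simp
      map_add' := fun a b => by
        rw [← ofMul_mul, ← Circle.exp_add]
        push_cast
        ring_nf }
  have hker (q : ℚ) : h q = 0 ↔ q ∈ AddSubgroup.zmultiples (1 : ℚ) := by
    change Circle.exp (2 * Real.pi * q) = 1 ↔ _
    rw [Circle.exp_eq_one, AddSubgroup.mem_zmultiples_iff]
    refine exists_congr fun n => ?_
    have hpi : (2 * Real.pi) ≠ 0 := by positivity
    rw [mul_comm (n : ℝ), mul_right_inj' hpi, zsmul_one]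
    constructor
    · intro h; exact_mod_cast h.symm
    · intro h; exact_mod_cast h.symm
  let h' : AddCircle (1 : ℚ) →+ Additive Circle :=
    QuotientAddGroup.lift _ h fun q hq => (hker q).2 hq
  have hinj (x : AddCircle (1 : ℚ)) (hx : h' x = 0) : x = 0 := by
    induction x using QuotientAddGroup.induction_on with
    | H q => exact (QuotientAddGroup.eq_zero_iff q).2 ((hker q).1 hx)
  let g : ℚ_[2] →+ Additive Circle := h'.comp (c.comp (QuotientAddGroup.mk' Z))
  refine ⟨⟨fun x => (g x).toMul, by simp, fun a b => by simp⟩, fun x => ?_, fun h1 => ?_⟩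
  · have hx : (QuotientAddGroup.mk (x : ℚ_[2]) : ℚ_[2] ⧸ Z) = 0 :=
      (QuotientAddGroup.eq_zero_iff _).2 ⟨x, rfl⟩
    change (h' (c (QuotientAddGroup.mk (x : ℚ_[2])))).toMul = 1
    rw [hx, map_zero, map_zero]; rfl
  · exact hc (hinj _ h1)

/-- The value ω at 1/8 is a primitive eighth root of unity, and ω³ is minus the conjugate of ω. So
ψ(x) or ψ(3x) has positive real part at 1/8; this normalization fixes the signs of the Gauss
integrals. -/
theorem exists_addChar : ∃ ψ : AddChar ℚ_[2] Circle, (∀ x : ℤ_[2], ψ x = 1) ∧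
    ψ (1 / 2) = -1 ∧ 0 < ((ψ (1 / 8) : Circle) : ℂ).re := by
  have key : ∀ ψ : AddChar ℚ_[2] Circle, (∀ x : ℤ_[2], ψ x = 1) → ψ (1 / 2) ≠ 1 →
      ψ (1 / 2) = -1 := by
    intro ψ h h'
    have h1 : ψ (1 / 2) * ψ (1 / 2) = 1 := by
      rw [← AddChar.map_add_eq_mul, show (1 / 2 : ℚ_[2]) + 1 / 2 = ((1 : ℤ_[2]) : ℚ_[2]) by
        rw [PadicInt.coe_one]; norm_num, h]
    have h2 : ((ψ (1 / 2) : Circle) : ℂ) * (ψ (1 / 2) : Circle) = 1 := by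
      rw [← Circle.coe_mul, h1, Circle.coe_one]
    rcases mul_self_eq_one_iff.1 h2 with h3 | h3
    · exact absurd (Circle.coe_eq_one.1 h3) h'
    · ext; rw [h3]; rfl
  obtain ⟨ψ, h, h'⟩ := exists_addChar_half
  have hhalf := key ψ h h'
  set ω : ℂ := ((ψ (1 / 8) : Circle) : ℂ)
  have h4 : ω ^ 4 = -1 := by
    have : ((ψ (1 / 8)) ^ 4 : Circle) = -1 := by
      rw [← AddChar.map_nsmul_eq_pow, ← hhalf]; norm_num
    exact (Circle.coe_pow _ _).symm.trans (congrArg (fun x : Circle => (x : ℂ)) this)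
  have hn : ω.re ^ 2 + ω.im ^ 2 = 1 := by
    have := Circle.normSq_coe (ψ (1 / 8))
    rw [Complex.normSq_apply] at this
    rw [← this]; ring
  have h3 : ω ^ 3 = -(starRingEnd ℂ ω) := by
    have h5 : ω * starRingEnd ℂ ω = 1 := by
      rw [Complex.mul_conj, Circle.normSq_coe]; norm_num
    have h6 : ω ≠ 0 := Circle.coe_ne_zero _
    apply mul_left_cancel₀ h6
    linear_combination h4 + h5
  have hre : ω.re ≠ 0 := by
    intro h0
    have h1 : ω = ω.im * Complex.I := by
      apply Complex.ext <;> simp [h0]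
    rw [h0] at hn
    have h2 : (ω.im : ℂ) ^ 2 = 1 := by exact_mod_cast (by linarith : ω.im ^ 2 = 1)
    rw [h1, mul_pow, Complex.I_pow_four, mul_one,
      show (ω.im : ℂ) ^ 4 = ((ω.im : ℂ) ^ 2) ^ 2 by ring, h2] at h4
    norm_num at h4
  rcases lt_or_gt_of_ne hre with hlt | hgt
  · have h83 : ψ (3 * (1 / 8)) = ψ (1 / 8) ^ 3 := by
      rw [← AddChar.map_nsmul_eq_pow]; norm_num
    refine ⟨⟨fun x => ψ (3 * x), by simp, fun a b => by rw [mul_add, AddChar.map_add_eq_mul]⟩,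
      fun x => ?_, ?_, ?_⟩
    · change ψ (3 * x) = 1
      rw [← h (3 * x)]; rfl
    · change ψ (3 * (1 / 2)) = -1
      rw [show (3 : ℚ_[2]) * (1 / 2) = 1 / 2 + ((1 : ℤ_[2]) : ℚ_[2]) by
        rw [PadicInt.coe_one]; norm_num, AddChar.map_add_eq_mul, h, hhalf, mul_one]
    · change 0 < ((ψ (3 * (1 / 8)) : Circle) : ℂ).re
      rw [h83, Circle.coe_pow]
      change 0 < (ω ^ 3).re
      rw [h3]; simpa using hlt
  · exact ⟨ψ, h, hhalf, hgt⟩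

/-- An additive character of `ℚ₂` that is trivial exactly on `ℤ₂`. -/
def psi : AddChar ℚ_[2] ℂ :=
  Circle.coeHom.compAddChar exists_addChar.choose

theorem psi_apply (x : ℚ_[2]) : psi x = ((exists_addChar.choose x : Circle) : ℂ) := rfl

theorem psi_coe (x : ℤ_[2]) : psi x = 1 := by
  rw [psi_apply, exists_addChar.choose_spec.1 x, Circle.coe_one]

theorem psi_half : psi (1 / 2) = -1 := by
  rw [psi_apply, exists_addChar.choose_spec.2.1]
  rfl

theorem norm_psi (x : ℚ_[2]) : ‖psi x‖ = 1 := by rw [psi_apply, Circle.norm_coe]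

theorem re_psi_eighth_pos : 0 < (psi (1 / 8)).re := exists_addChar.choose_spec.2.2

theorem psi_of_norm_le_one {x : ℚ_[2]} (hx : ‖x‖ ≤ 1) : psi x = 1 := psi_coe ⟨x, hx⟩

theorem psi_add_coe (x : ℚ_[2]) (y : ℤ_[2]) : psi (x + y) = psi x := by
  rw [AddChar.map_add_eq_mul, psi_coe, mul_one]

theorem continuous_psi : Continuous psi := by
  rw [Metric.continuous_iff]
  intro b ε hε
  refine ⟨1, one_pos, fun a ha => ?_⟩
  rw [dist_eq_norm] at ha
  have : psi a = psi b := by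
    rw [← sub_add_cancel a b, AddChar.map_add_eq_mul, psi_of_norm_le_one ha.le, one_mul]
  rw [this, dist_self]
  exact hε

/-- The character `x ↦ ψ(x)` is trivial on `a ℤ₂` only if `a` is integral. -/
theorem exists_psi_mul_ne_one {a : ℚ_[2]} (ha : ¬ ‖a‖ ≤ 1) : ∃ z : ℤ_[2], psi (a * z) ≠ 1 := by
  have ha0 : a ≠ 0 := by rintro rfl; simp at ha
  -- The witness is 1/(2a), where the character takes the value ψ(1/2) = -1.
  have hz : ‖(1 / 2 : ℚ_[2]) / a‖ ≤ 1 := by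
    have h1 : 0 < -a.valuation := by
      rw [Padic.norm_eq_zpow_neg_valuation ha0] at ha
      by_contra hcon
      exact ha (zpow_le_one_of_nonpos₀ (by norm_num) (by omega))
    have h2 : ‖(2 : ℚ_[2])‖ = 2⁻¹ := by simpa using Padic.norm_p (p := 2)
    rw [norm_div, norm_div, norm_one, h2, Padic.norm_eq_zpow_neg_valuation ha0,
      div_le_one (by positivity)]
    have : ((2 : ℕ) : ℝ) ^ (1 : ℤ) ≤ ((2 : ℕ) : ℝ) ^ (-a.valuation) :=
      zpow_le_zpow_right₀ (by norm_num) (by omega)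
    simpa using this
  refine ⟨⟨_, hz⟩, ?_⟩
  change psi (a * (1 / 2 / a)) ≠ 1
  rw [mul_div_cancel₀ _ ha0, psi_half]
  norm_num

/-! ### Haar measure -/

instance : MeasurableSpace ℤ_[2] := borel _

instance : BorelSpace ℤ_[2] := ⟨rfl⟩

instance : SecondCountableTopology ℤ_[2] := inferInstance

instance : MeasureSpace ℤ_[2] := ⟨Measure.addHaarMeasure ⊤⟩

instance : (volume : Measure ℤ_[2]).IsAddHaarMeasure :=
  inferInstanceAs (Measure.addHaarMeasure (⊤ : TopologicalSpace.PositiveCompacts ℤ_[2])).IsAddHaarMeasure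

instance : IsProbabilityMeasure (volume : Measure ℤ_[2]) :=
  ⟨Measure.addHaarMeasure_self (K₀ := (⊤ : TopologicalSpace.PositiveCompacts ℤ_[2]))⟩

end TwoAdic

namespace TwoAdic

open MeasureTheory

/-- Integration over an open subgroup. -/
theorem exists_setIntegral_range {G H : Type*} [AddCommGroup G] [TopologicalSpace G]
    [IsTopologicalAddGroup G] [CompactSpace G] [T2Space G] [MeasurableSpace G] [BorelSpace G]
    [SecondCountableTopology G]
    [AddCommGroup H] [TopologicalSpace H] [IsTopologicalAddGroup H] [CompactSpace H] [T2Space H]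
    [MeasurableSpace H] [BorelSpace H] [SecondCountableTopology H]
    (μ : Measure G) [μ.IsAddHaarMeasure] (ν : Measure H) [ν.IsAddHaarMeasure]
    (A : H →+ G) (hA : Continuous A) (hinj : Function.Injective A) (ho : IsOpen (Set.range A)) :
    ∃ c : ℝ, 0 < c ∧ ∀ F : G → ℂ, ∫ x in Set.range A, F x ∂μ = c * ∫ y, F (A y) ∂ν := by
  have hemb : MeasurableEmbedding A :=
    (hA.isClosedEmbedding hinj).measurableEmbedding
  have huniv : (μ.comap A) Set.univ = μ (Set.range A) := by
    rw [hemb.comap_apply, Set.image_univ]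
  have hpos : 0 < μ (Set.range A) := ho.measure_pos μ ⟨0, 0, map_zero A⟩
  have hfin : IsFiniteMeasure (μ.comap A) :=
    ⟨by rw [huniv]; exact measure_lt_top μ _⟩
  have hinv : (μ.comap A).IsAddLeftInvariant := by
    refine ⟨fun g => ?_⟩
    ext s hs
    rw [Measure.map_apply (measurable_const_add g) hs, hemb.comap_apply, hemb.comap_apply,
      ← measure_preimage_add μ (A g) (A '' s)]
    congr 1
    ext x
    constructor
    · rintro ⟨y, hy, rfl⟩
      exact ⟨g + y, hy, map_add A g y⟩
    · rintro ⟨y, hy, hyx⟩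
      refine ⟨-g + y, by simpa using hy, ?_⟩
      rw [map_add, hyx, map_neg]
      exact neg_add_cancel_left _ _
  -- Uniqueness of Haar measure: the pullback of `μ` is a multiple of `ν`, nonzero because an open
  -- set has positive measure.
  have hsmul := Measure.isAddLeftInvariant_eq_smul (μ.comap A) ν
  set c := Measure.addHaarScalarFactor (μ.comap A) ν
  have hc : 0 < c := by
    rw [pos_iff_ne_zero]
    intro h0
    rw [h0, zero_smul] at hsmul
    rw [← huniv, hsmul] at hpos
    simp at hpos
  refine ⟨c, by exact_mod_cast hc, fun F => ?_⟩
  rw [← hemb.map_comap, hemb.integral_map, hsmul, integral_smul_nnreal_measure, NNReal.smul_def,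
    Complex.real_smul]

/-! ### Gauss integrals of isometry classes -/

section Gauss

variable {ι κ : Type*} [Fintype ι] [Fintype κ]

theorem integrable_of_continuous {G : Type*} [TopologicalSpace G] [CompactSpace G]
    [MeasurableSpace G] [BorelSpace G] (μ : Measure G) [IsFiniteMeasure μ]
    {F : G → ℂ} (hF : Continuous F) : Integrable F μ :=
  hF.integrable_of_hasCompactSupport (HasCompactSupport.of_compactSpace F)

theorem continuous_linearMap_pi (e : (ι → ℤ_[2]) →ₗ[ℤ_[2]] (κ → ℤ_[2])) : Continuous e := by
  exact LinearMap.continuous_on_pi e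

/-- The image of Haar probability measure under a topological isomorphism is again one, hence the
same by uniqueness. This makes Gauss integrals independent of coordinates. -/
theorem measurePreserving_linearEquiv (e : (ι → ℤ_[2]) ≃ₗ[ℤ_[2]] (κ → ℤ_[2])) :
    MeasurePreserving e volume volume := by
  have h1 : Continuous e := continuous_linearMap_pi e.toLinearMap
  have h2 : Continuous e.symm := continuous_linearMap_pi e.symm.toLinearMap
  let e' : (ι → ℤ_[2]) ≃ₜ+ (κ → ℤ_[2]) := { e.toAddEquiv with
    continuous_toFun := h1
    continuous_invFun := h2 }
  have h3 : (Measure.map e' volume).IsAddHaarMeasure := e'.isAddHaarMeasure_map volume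
  have h4 : IsProbabilityMeasure (Measure.map e' (volume : Measure (ι → ℤ_[2]))) :=
    Measure.isProbabilityMeasure_map h1.measurable.aemeasurable
  exact ⟨h1.measurable, Measure.isAddHaarMeasure_eq_of_isProbabilityMeasure _ _⟩

theorem integral_comp_linearEquiv (e : (ι → ℤ_[2]) ≃ₗ[ℤ_[2]] (κ → ℤ_[2])) (F : (κ → ℤ_[2]) → ℂ) :
    ∫ x, F (e x) = ∫ y, F y := by
  have h1 : Continuous e := continuous_linearMap_pi e.toLinearMap
  exact (measurePreserving_linearEquiv e).integral_comp
    (h1.isClosedEmbedding e.injective).measurableEmbedding F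

/-- The normalized Gauss sum of a form in coordinates. -/
def coordGauss (k : ℤ) (X : CoordForm) : ℂ :=
  ∫ x, psi ((2 : ℚ_[2]) ^ (-k - 1) * X.2 x x)

theorem coordGauss_congr (k : ℤ) (X Y : CoordForm) (h : Isometric X.2 Y.2) :
    coordGauss k X = coordGauss k Y := by
  obtain ⟨e, he⟩ := h
  rw [coordGauss, coordGauss, ← integral_comp_linearEquiv e]
  simp only [he]

theorem coordGauss_eq {L : Type*} [AddCommGroup L] [Module ℤ_[2] L] [Module.Free ℤ_[2] L]
    [Module.Finite ℤ_[2] L] (k : ℤ) (B : L →ₗ[ℤ_[2]] L →ₗ[ℤ_[2]] ℚ_[2])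
    (e : (ι → ℤ_[2]) ≃ₗ[ℤ_[2]] L) :
    coordGauss k (coordForm B) = ∫ x, psi ((2 : ℚ_[2]) ^ (-k - 1) * B (e x) (e x)) := by
  obtain ⟨e', he'⟩ := isometric_coordForm B
  rw [coordGauss, ← integral_comp_linearEquiv (e.trans e'.symm)]
  refine integral_congr_ae (Filter.Eventually.of_forall fun x => ?_)
  simp only [LinearEquiv.trans_apply]
  rw [← he' (e'.symm (e x)) (e'.symm (e x)), LinearEquiv.apply_symm_apply]

/-- The normalized Gauss sum of a class of forms. -/
def gauss (k : ℤ) : AddChar FormClass ℂ where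
  toFun := Quotient.lift (coordGauss k) (coordGauss_congr k)
  map_zero_eq_one' := by
    change coordGauss k (coordForm (0 : PUnit →ₗ[ℤ_[2]] PUnit →ₗ[ℤ_[2]] ℚ_[2])) = 1
    have h (x) : (coordForm (0 : PUnit →ₗ[ℤ_[2]] PUnit →ₗ[ℤ_[2]] ℚ_[2])).2 x x = 0 := rfl
    rw [coordGauss]
    simp [h]
  map_add_eq_mul' x y := by
    induction x using Quotient.inductionOn with
    | h X =>
    induction y using Quotient.inductionOn with
    | h Y =>
    change coordGauss k (coordForm (prodForm X.2 Y.2)) = coordGauss k X * coordGauss k Y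
    rw [coordGauss_eq k _ (LinearEquiv.sumArrowLequivProdArrow (Fin X.1) (Fin Y.1) ℤ_[2] ℤ_[2]),
      coordGauss, coordGauss, ← integral_prod_mul, ← Measure.volume_eq_prod]
    refine Eq.trans ?_ ((volume_measurePreserving_sumPiEquivProdPi fun _ => ℤ_[2]).integral_comp
      (MeasurableEquiv.measurableEmbedding _) _)
    refine integral_congr_ae (Filter.Eventually.of_forall fun x => ?_)
    simp only [prodForm_apply, mul_add, AddChar.map_add_eq_mul]
    rfl

theorem gauss_formClass {L : Type*} [AddCommGroup L] [Module ℤ_[2] L] [Module.Free ℤ_[2] L]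
    [Module.Finite ℤ_[2] L] (k : ℤ) (B : L →ₗ[ℤ_[2]] L →ₗ[ℤ_[2]] ℚ_[2])
    (e : (ι → ℤ_[2]) ≃ₗ[ℤ_[2]] L) :
    gauss k (formClass B) = ∫ x, psi ((2 : ℚ_[2]) ^ (-k - 1) * B (e x) (e x)) :=
  coordGauss_eq k B e

end Gauss

end TwoAdic

namespace TwoAdic

open MeasureTheory

/-! ### Eighth roots of unity -/

theorem psi_congr {a b : ℚ_[2]} (z : ℤ_[2]) (h : a = b + z) : psi a = psi b := by
  rw [h, psi_add_coe]

/-- The character `c ↦ ψ(c / 8)` of `ℤ / 8`. -/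
def chi : AddChar (ZMod 8) ℂ where
  toFun c := psi ((c.val : ℤ_[2]) / 8)
  map_zero_eq_one' := by simp
  map_add_eq_mul' a b := by
    rw [← AddChar.map_add_eq_mul]
    obtain ⟨z, hz⟩ := (mod8_eq_iff ((a + b).val : ℤ_[2]) ((a.val : ℤ_[2]) + b.val)).1 (by
      rw [map_add, mod8_natCast_val, mod8_natCast_val, mod8_natCast_val])
    refine psi_congr z ?_
    rw [hz]
    push_cast
    rw [show ((8 : ℤ_[2]) : ℚ_[2]) = 8 from rfl]
    ring

theorem psi_div_eight (u : ℤ_[2]) : psi ((u : ℚ_[2]) / 8) = chi (mod8 u) := by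
  obtain ⟨z, hz⟩ := (mod8_eq_iff u ((mod8 u).val : ℤ_[2])).1 (by rw [mod8_natCast_val])
  change _ = psi (((mod8 u).val : ℤ_[2]) / 8)
  rw [← psi_add_coe (((mod8 u).val : ℤ_[2]) / 8) z]
  congr 1
  nth_rewrite 1 [hz]
  push_cast
  rw [show ((8 : ℤ_[2]) : ℚ_[2]) = 8 from rfl]
  ring

theorem chi_four : chi 4 = -1 := by
  have := psi_div_eight 4
  rw [map_ofNat mod8 4] at this
  rw [show (OfNat.ofNat 4 : ZMod 8) = 4 from rfl] at this
  rw [← this, ← psi_half]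
  congr 1
  rw [show ((4 : ℤ_[2]) : ℚ_[2]) = 4 from rfl]
  norm_num

theorem norm_chi (c : ZMod 8) : ‖chi c‖ = 1 := norm_psi _

theorem chi_ne_zero (c : ZMod 8) : chi c ≠ 0 := by
  rw [← norm_ne_zero_iff, norm_chi]; exact one_ne_zero

/-- Every nonzero class mod 8 has a multiple equal to 4, where the character is -1. -/
theorem eq_zero_of_chi_eq_one {c : ZMod 8} (h : chi c = 1) : c = 0 := by
  by_contra hc
  have h1 : ∃ n : Fin 8, (n : ℕ) • c = 4 := by revert hc; clear h; revert c; decide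
  obtain ⟨n, hn⟩ := h1
  have h2 := chi_four
  rw [← hn, AddChar.map_nsmul_eq_pow, h, one_pow] at h2
  norm_num at h2

/-- The complex number `z` is a positive multiple of the eighth root of unity belonging to `o`. -/
def HasPhase (z : ℂ) (o : ZMod 8) : Prop := ∃ r : ℝ, 0 < r ∧ z = r * chi o

theorem HasPhase.mul {z w : ℂ} {a b : ZMod 8} (h : HasPhase z a) (h' : HasPhase w b) :
    HasPhase (z * w) (a + b) := by
  obtain ⟨r, hr, rfl⟩ := h
  obtain ⟨s, hs, rfl⟩ := h'
  exact ⟨r * s, mul_pos hr hs, by rw [AddChar.map_add_eq_mul]; push_cast; ring⟩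

theorem hasPhase_one : HasPhase 1 0 := ⟨1, one_pos, by simp⟩

theorem hasPhase_prod {α : Type*} (s : Finset α) (z : α → ℂ) (o : α → ZMod 8)
    (h : ∀ i ∈ s, HasPhase (z i) (o i)) : HasPhase (∏ i ∈ s, z i) (∑ i ∈ s, o i) := by
  classical
  induction s using Finset.induction_on with
  | empty => simpa using hasPhase_one
  | insert a s ha ih =>
    rw [Finset.prod_insert ha, Finset.sum_insert ha]
    exact (h a (Finset.mem_insert_self _ _)).mul
      (ih fun i hi => h i (Finset.mem_insert_of_mem hi))

theorem HasPhase.pow {z : ℂ} {a : ZMod 8} (h : HasPhase z a) (n : ℕ) :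
    HasPhase (z ^ n) (n * a) := by
  have := hasPhase_prod (Finset.range n) (fun _ => z) (fun _ => a) fun _ _ => h
  simpa using this

theorem HasPhase.ne_zero {z : ℂ} {a : ZMod 8} (h : HasPhase z a) : z ≠ 0 := by
  obtain ⟨r, hr, rfl⟩ := h
  exact mul_ne_zero (by exact_mod_cast hr.ne') (chi_ne_zero a)

theorem HasPhase.unique {z : ℂ} {a b : ZMod 8} (h : HasPhase z a) (h' : HasPhase z b) : a = b := by
  obtain ⟨r, hr, rfl⟩ := h
  obtain ⟨s, hs, h⟩ := h'
  have h1 := congrArg norm h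
  rw [norm_mul, norm_mul, norm_chi, norm_chi, mul_one, mul_one, Complex.norm_real,
    Complex.norm_real, Real.norm_of_nonneg hr.le, Real.norm_of_nonneg hs.le] at h1
  subst h1
  have h2 : chi a = chi b := mul_left_cancel₀ (by exact_mod_cast hr.ne') h
  rw [← sub_eq_zero]
  apply eq_zero_of_chi_eq_one
  rw [AddChar.map_sub_eq_div, h2, div_self (chi_ne_zero b)]

theorem HasPhase.of_mul_left {z w : ℂ} {a b : ZMod 8} (h : HasPhase (z * w) a)
    (h' : HasPhase z b) : HasPhase w (a - b) := by
  have hz := h'.ne_zero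
  obtain ⟨r, hr, h⟩ := h
  obtain ⟨s, hs, rfl⟩ := h'
  refine ⟨r / s, div_pos hr hs, ?_⟩
  apply mul_left_cancel₀ hz
  rw [h, AddChar.map_sub_eq_div]
  have hs' : (s : ℂ) ≠ 0 := by exact_mod_cast hs.ne'
  have := chi_ne_zero b
  push_cast
  field_simp

/-! ### Gauss sums in one variable -/

theorem continuous_coe_padicInt : Continuous (fun x : ℤ_[2] => (x : ℚ_[2])) := continuous_subtype_val

/-- Orthogonality of characters: translation by y multiplies the integral by ψ(ay), which differs
from 1 for some y unless a is integral. -/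
theorem integral_psi_mul (a : ℚ_[2]) [Decidable (‖a‖ ≤ 1)] :
    ∫ z : ℤ_[2], psi (a * z) = if ‖a‖ ≤ 1 then 1 else 0 := by
  split_ifs with h
  · have : ∀ z : ℤ_[2], psi (a * z) = 1 := fun z =>
      psi_of_norm_le_one (by rw [norm_mul]; exact mul_le_one₀ h (norm_nonneg _) z.2)
    simp [this]
  · obtain ⟨y, hy⟩ := exists_psi_mul_ne_one h
    have h1 : ∫ z : ℤ_[2], psi (a * (z + y : ℤ_[2])) = ∫ z : ℤ_[2], psi (a * z) :=
      integral_add_right_eq_self (fun z : ℤ_[2] => psi (a * z)) y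
    have h2 : ∀ z : ℤ_[2], psi (a * (z + y : ℤ_[2])) = psi (a * z) * psi (a * y) := fun z => by
      rw [PadicInt.coe_add, mul_add, AddChar.map_add_eq_mul]
    simp only [h2] at h1
    rw [integral_mul_const] at h1
    have h3 : (∫ z : ℤ_[2], psi (a * z)) * (psi (a * y) - 1) = 0 := by rw [mul_sub, h1]; ring
    exact (mul_eq_zero.1 h3).resolve_right (sub_ne_zero.2 hy)

/-- The even and the odd numbers are translates of each other, so their integrals carry the same
constant; the function 1 shows that it is 1/2. -/
theorem integral_eq_even_add_odd {F : ℤ_[2] → ℂ} (hF : Continuous F) :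
    ∫ t, F t = ((∫ t, F (2 * t)) + ∫ t, F (2 * t + 1)) / 2 := by
  let A : ℤ_[2] →+ ℤ_[2] := AddMonoidHom.mulLeft 2
  have hA : Continuous A := continuous_const.mul continuous_id
  have hr : Set.range A = {x | ¬ IsUnit x} := by
    ext x
    change (∃ y, 2 * y = x) ↔ ¬ IsUnit x
    rw [not_isUnit_iff_two_dvd]
    exact ⟨fun ⟨y, h⟩ => ⟨y, h.symm⟩, fun ⟨y, h⟩ => ⟨y, h.symm⟩⟩
  have ho : IsOpen (Set.range A) := by
    have : Set.range A = Metric.ball 0 1 := by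
      rw [hr]
      ext x
      rw [mem_ball_zero_iff, Set.mem_ofPred_eq, ← mem_nonunits_iff, PadicInt.mem_nonunits]
    rw [this]; exact Metric.isOpen_ball
  obtain ⟨c, hc, h⟩ := exists_setIntegral_range (volume : Measure ℤ_[2]) (volume : Measure ℤ_[2])
    A hA (mul_right_injective₀ two_ne_zero) ho
  have key {F : ℤ_[2] → ℂ} (hF : Continuous F) :
      ∫ t, F t = c * (∫ t, F (2 * t)) + c * ∫ t, F (2 * t + 1) := by
    rw [← integral_add_compl ho.measurableSet (integrable_of_continuous _ hF), h F]
    congr 1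
    have h1 : ∫ t in Set.range A, F (t + 1) = ∫ t in (Set.range A)ᶜ, F t := by
      have hp : (fun t : ℤ_[2] => t + 1) ⁻¹' (Set.range A)ᶜ = Set.range A := by
        rw [hr]
        ext x
        simp only [Set.preimage_compl, Set.mem_compl_iff, Set.mem_preimage, Set.mem_ofPred_eq,
          not_not]
        rcases two_dvd_or_eq x with ⟨y, rfl⟩ | ⟨y, rfl⟩
        · simp only [isUnit_two_mul_add_one, true_iff]
          rw [not_isUnit_iff_two_dvd]; exact dvd_mul_right _ _
        · simp only [isUnit_two_mul_add_one, not_true_eq_false, iff_false]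
          rw [not_isUnit_iff_two_dvd]; exact ⟨y + 1, by ring⟩
      have hmp : MeasurePreserving (fun t : ℤ_[2] => t + 1) volume volume :=
        measurePreserving_add_right volume 1
      rw [← hmp.setIntegral_preimage_emb (measurableEmbedding_addRight 1) F (Set.range A)ᶜ, hp]
    rw [← h1]
    exact h fun t => F (t + 1)
  have h1 := key (F := fun _ => 1) continuous_const
  simp only [integral_const, probReal_univ, one_smul, mul_one] at h1
  have h2 : (c : ℂ) = 1 / 2 := by linear_combination -h1 / 2
  rw [key hF, h2]
  ring

/-- The Gauss sum of the form `u * t ^ 2 / 2 ^ m`. -/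
def unaryGauss (u : ℤ_[2]) (m : ℕ) : ℂ := ∫ t : ℤ_[2], psi (u * t ^ 2 / 2 ^ (m + 1))

theorem continuous_unary (u : ℤ_[2]) (m : ℕ) :
    Continuous fun t : ℤ_[2] => psi (u * t ^ 2 / 2 ^ (m + 1)) :=
  continuous_psi.comp (((continuous_const.mul (continuous_coe_padicInt.pow 2))).div_const _)

theorem coe_two : ((2 : ℤ_[2]) : ℚ_[2]) = 2 := rfl

theorem coe_eight : ((8 : ℤ_[2]) : ℚ_[2]) = 8 := rfl

theorem unaryGauss_eq (u : ℤ_[2]) (m : ℕ) : unaryGauss u m =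
    ((∫ t : ℤ_[2], psi (u * t ^ 2 * 4 / 2 ^ (m + 1))) +
      ∫ t : ℤ_[2], psi (u * (2 * t + 1) ^ 2 / 2 ^ (m + 1))) / 2 := by
  rw [unaryGauss, integral_eq_even_add_odd (continuous_unary u m)]
  congr 3
  · funext t
    rw [PadicInt.coe_mul, coe_two]
    congr 1; ring

theorem unaryGauss_add_two' (u : ℤ_[2]) (m : ℕ) :
    ∫ t : ℤ_[2], psi (u * t ^ 2 * 4 / 2 ^ (m + 2 + 1)) = unaryGauss u m := by
  rw [unaryGauss]
  congr 1
  funext t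
  congr 1
  rw [show m + 2 + 1 = m + 1 + 2 by ring, pow_add (2 : ℚ_[2]) (m + 1)]
  field_simp
  norm_num

theorem exists_odd_sq (t : ℤ_[2]) : ∃ z : ℤ_[2], (2 * t + 1) ^ 2 = 1 + 8 * z := by
  rw [← mod8_eq_iff, map_pow, pow_two, (isUnit_iff_mod8 _).1 (isUnit_two_mul_add_one t), map_one]

theorem odd_unit_div_two {u : ℤ_[2]} (hu : IsUnit u) : psi ((u : ℚ_[2]) / 2) = -1 := by
  rcases two_dvd_or_eq u with ⟨y, rfl⟩ | ⟨y, rfl⟩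
  · exact absurd (dvd_mul_right 2 y) ((isUnit_iff_not_two_dvd _).1 hu)
  · rw [← psi_half, ← psi_add_coe (1 / 2) y]
    congr 1
    push_cast
    rw [coe_two]; ring

/-- The integrand is 1 for even t and -1 for odd t. This vanishing makes odd terms visible. -/
theorem unaryGauss_zero {u : ℤ_[2]} (hu : IsUnit u) : unaryGauss u 0 = 0 := by
  rw [unaryGauss_eq]
  have h1 (t : ℤ_[2]) : psi (u * t ^ 2 * 4 / 2 ^ (0 + 1)) = 1 := by
    rw [← psi_coe (u * t ^ 2 * 2)]
    congr 1; push_cast; rw [coe_two]; ring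
  have h2 (t : ℤ_[2]) : psi (u * (2 * t + 1) ^ 2 / 2 ^ (0 + 1)) = -1 := by
    rw [← odd_unit_div_two hu]
    refine psi_congr (u * (2 * t ^ 2 + 2 * t)) ?_
    push_cast; rw [coe_two]; ring
  have h2' (t : ℤ_[2]) : psi (u * ((2 * t + 1 : ℤ_[2]) : ℚ_[2]) ^ 2 / 2 ^ (0 + 1)) = -1 := by
    rw [← h2 t]; push_cast; rw [coe_two]
  simp only [h1, h2]
  simp

/-- Odd classes are ±1 or ±1 + 4; negation conjugates the character and adding 4 changes its sign.
This is how the Legendre symbol enters the phase. -/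
theorem re_chi_of_sign (c : ZMod 8) (hc : c * c = 1) :
    chi c + (chi c)⁻¹ = (if sign8 c = 1 then 1 else -1) * (2 * (chi 1).re : ℝ) := by
  have hconj (d : ZMod 8) : (chi d)⁻¹ = starRingEnd ℂ (chi d) := by
    rw [Complex.inv_def, Complex.normSq_eq_norm_sq, norm_chi]; simp
  have hadd (d : ZMod 8) : chi d + (chi d)⁻¹ = ((2 * (chi d).re : ℝ) : ℂ) := by
    rw [hconj, Complex.add_conj]; 
  have h4 (d : ZMod 8) : chi (d + 4) = -chi d := by
    rw [AddChar.map_add_eq_mul, chi_four, mul_neg_one]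
  have hcases : c = 1 ∨ c = -1 ∨ c = 1 + 4 ∨ c = -1 + 4 := by revert hc; revert c; decide
  have s1 : sign8 1 = 1 := by decide
  have s2 : sign8 (-1) = 1 := by decide
  have s3 : sign8 (1 + 4) ≠ 1 := by decide
  have s4 : sign8 (-1 + 4) ≠ 1 := by decide
  rcases hcases with rfl | rfl | rfl | rfl
  · rw [if_pos s1, hadd, one_mul]
  · rw [if_pos s2, AddChar.map_neg_eq_inv, inv_inv, add_comm, hadd, one_mul]
  · rw [if_neg s3, h4, inv_neg, ← hadd]; ring
  · rw [if_neg s4, h4, AddChar.map_neg_eq_inv, inv_neg, inv_inv, ← hadd]; ring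

theorem re_chi_one : 0 < (chi 1).re ∧ (chi 1).re ^ 2 = 1 / 2 := by
  have h1 : chi 1 = psi (1 / 8) := by
    have := psi_div_eight 1
    rw [map_one, PadicInt.coe_one] at this
    exact this.symm
  refine ⟨by rw [h1]; exact re_psi_eighth_pos, ?_⟩
  have h2 : chi 1 ^ 4 = -1 := by
    rw [← AddChar.map_nsmul_eq_pow, ← chi_four]; congr 1
  have h3 : (chi 1).re ^ 2 + (chi 1).im ^ 2 = 1 := by
    have : Complex.normSq (chi 1) = 1 := by rw [Complex.normSq_eq_norm_sq, norm_chi, one_pow]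
    rw [Complex.normSq_apply] at this
    linarith
  have h4 := congrArg Complex.re h2
  have h5 : (chi 1 ^ 4).re = ((chi 1).re ^ 2 - (chi 1).im ^ 2) ^ 2 -
      4 * (chi 1).re ^ 2 * (chi 1).im ^ 2 := by
    rw [show chi 1 ^ 4 = (chi 1 * chi 1) * (chi 1 * chi 1) by ring]
    simp only [Complex.mul_re, Complex.mul_im]
    ring
  rw [h5] at h4
  simp only [Complex.neg_re, Complex.one_re] at h4
  have h6 : (chi 1).im ^ 2 = 1 - (chi 1).re ^ 2 := by linarith
  rw [h6] at h4
  have h7 : (2 * (chi 1).re ^ 2 - 1) ^ 2 = 0 := by nlinarith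
  have h8 := pow_eq_zero_iff two_ne_zero |>.1 h7
  linarith

/-- The contribution of a sign to the phase of a Gauss sum. -/
def signPhase (s : ℤˣ) : ZMod 8 := if s = 1 then 0 else 4

theorem signPhase_mul (s t : ℤˣ) : signPhase (s * t) = signPhase s + signPhase t := by
  rcases Int.units_eq_one_or s with rfl | rfl <;> rcases Int.units_eq_one_or t with rfl | rfl <;>
    decide

theorem two_mul_signPhase (s : ℤˣ) : 2 * signPhase s = 0 := by
  rcases Int.units_eq_one_or s with rfl | rfl <;> decide

/-- Split t by parity. Even t give the integral two levels lower; from level 3 on, the odd t cancel,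
so the value is halved every two levels. Level 1 gives χ(u) Re χ(u), where the real part has the
sign of u, and level 2 gives χ(u)/2. The absolute value is recorded for `gauss_hypClass`. -/
theorem unaryGauss_phase {u : ℤ_[2]} (hu : IsUnit u) (m : ℕ) :
    ∃ r : ℝ, 0 < r ∧ r ^ 2 = (1 / 2) ^ (m + 1) ∧ unaryGauss u (m + 1) =
      r * chi (mod8 u + (m + 1 : ℕ) * signPhase (sign8 (mod8 u))) := by
  have hc := (isUnit_iff_mod8 u).1 hu
  induction m using Nat.twoStepInduction with
  | zero =>
    obtain ⟨h1, h2⟩ := re_chi_one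
    refine ⟨_, h1, by rw [h2]; norm_num, ?_⟩
    rw [unaryGauss_eq]
    have e1 (t : ℤ_[2]) : psi (u * t ^ 2 * 4 / 2 ^ (0 + 1 + 1)) = 1 := by
      rw [← psi_coe (u * t ^ 2)]
      congr 1; push_cast; ring
    have e2 (t : ℤ_[2]) : psi (u * (2 * t + 1) ^ 2 / 2 ^ (0 + 1 + 1)) = chi (mod8 u) * chi (mod8 u) := by
      rw [← psi_div_eight, ← AddChar.map_add_eq_mul]
      refine psi_congr (u * (t ^ 2 + t)) ?_
      push_cast; ring
    simp only [e1, e2]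
    have h3 := re_chi_of_sign (mod8 u) hc
    have h4 := chi_ne_zero (mod8 u)
    simp only [integral_const, probReal_univ, one_smul]
    have h5 : 1 + chi (mod8 u) * chi (mod8 u) = chi (mod8 u) * (chi (mod8 u) + (chi (mod8 u))⁻¹) := by
      field_simp
      ring
    rw [h5, h3, AddChar.map_add_eq_mul]
    unfold signPhase
    split_ifs
    · push_cast; simp; ring
    · push_cast; simp [chi_four]; ring
  | one =>
    refine ⟨1 / 2, by norm_num, by norm_num, ?_⟩
    rw [unaryGauss_eq, unaryGauss_add_two' u 0, unaryGauss_zero hu]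
    have e2 (t : ℤ_[2]) : psi (u * (2 * t + 1) ^ 2 / 2 ^ (0 + 1 + 1 + 1)) = chi (mod8 u) := by
      obtain ⟨z, hz⟩ := exists_odd_sq t
      have hz' := congrArg (fun x : ℤ_[2] => (x : ℚ_[2])) hz
      push_cast at hz'
      rw [coe_two, coe_eight] at hz'
      rw [hz', ← psi_div_eight]
      refine psi_congr (u * z) ?_
      push_cast; ring
    simp only [e2]
    rw [show ((0 + 1 + 1 : ℕ) : ZMod 8) = 2 by norm_num, two_mul_signPhase, add_zero]
    simp
    ring
  | more m ih _ =>
    obtain ⟨r, hr, hr2, h⟩ := ih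
    refine ⟨r / 2, by positivity, ?_, ?_⟩
    · rw [div_pow, hr2]; ring
    · rw [show m + 2 + 1 = m + 1 + 2 by ring, unaryGauss_eq, unaryGauss_add_two' u (m + 1), h]
      -- Shifting t by 2^(m+1) changes the argument by u/2 modulo integers, hence the sign of the
      -- integrand.
      have h0 : ∫ t : ℤ_[2], psi (u * (2 * t + 1) ^ 2 / 2 ^ (m + 1 + 2 + 1)) = 0 := by
        have h1 := integral_add_right_eq_self (μ := volume)
          (fun t : ℤ_[2] => psi (u * (2 * t + 1) ^ 2 / 2 ^ (m + 1 + 2 + 1))) ((2 : ℤ_[2]) ^ (m + 1))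
        have h2 (t : ℤ_[2]) : psi (u * (2 * ((t + 2 ^ (m + 1) : ℤ_[2]) : ℚ_[2]) + 1) ^ 2 /
            2 ^ (m + 1 + 2 + 1)) = - psi (u * (2 * t + 1) ^ 2 / 2 ^ (m + 1 + 2 + 1)) := by
          rw [← mul_neg_one, ← odd_unit_div_two hu, ← AddChar.map_add_eq_mul]
          refine psi_congr (u * (t + 2 ^ m)) ?_
          push_cast
          rw [coe_two]
          have h2 : (2 : ℚ_[2]) ^ m ≠ 0 := pow_ne_zero _ two_ne_zero
          simp only [pow_add]
          field_simp
          ring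
        simp only [h2] at h1
        rw [integral_neg] at h1
        linear_combination -h1 / 2
      rw [h0]
      have h2 : ((m + 1 + 2 : ℕ) : ZMod 8) * signPhase (sign8 (mod8 u)) =
          ((m + 1 : ℕ) : ZMod 8) * signPhase (sign8 (mod8 u)) := by
        have := two_mul_signPhase (sign8 (mod8 u))
        push_cast
        linear_combination this
      rw [h2]
      push_cast
      ring

end TwoAdic

namespace TwoAdic

open MeasureTheory

/-! ### Gauss sums of unimodular forms -/

theorem map_sum_eq_prod {M : Type*} [AddCommMonoid M] (φ : AddChar M ℂ) {α : Type*} (f : α → M)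
    (s : Finset α) : φ (∑ i ∈ s, f i) = ∏ i ∈ s, φ (f i) := by
  classical
  induction s using Finset.induction_on with
  | empty => simp
  | insert a s ha ih =>
    rw [Finset.sum_insert ha, Finset.prod_insert ha, AddChar.map_add_eq_mul, ih]

theorem gauss_formClass_padicInt (k : ℤ) (B : ℤ_[2] →ₗ[ℤ_[2]] ℤ_[2] →ₗ[ℤ_[2]] ℚ_[2]) :
    gauss k (formClass B) = ∫ t : ℤ_[2], psi ((2 : ℚ_[2]) ^ (-k - 1) * B t t) := by
  rw [gauss_formClass k B (LinearEquiv.funUnique Unit ℤ_[2] ℤ_[2])]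
  exact (volume_preserving_funUnique Unit ℤ_[2]).integral_comp
    (MeasurableEquiv.measurableEmbedding _) fun t => psi ((2 : ℚ_[2]) ^ (-k - 1) * B t t)

theorem gauss_eq_one {L : Type*} [AddCommGroup L] [Module ℤ_[2] L] [Module.Free ℤ_[2] L]
    [Module.Finite ℤ_[2] L] (k : ℤ) (B : L →ₗ[ℤ_[2]] L →ₗ[ℤ_[2]] ℚ_[2])
    (h : ∀ x, ∃ z : ℤ_[2], (2 : ℚ_[2]) ^ (-k - 1) * B x x = z) : gauss k (formClass B) = 1 := by
  rw [gauss_formClass k B (Module.finBasis ℤ_[2] L).equivFun.symm]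
  have h1 (x) : psi ((2 : ℚ_[2]) ^ (-k - 1) * B x x) = 1 := by
    obtain ⟨z, hz⟩ := h x
    rw [hz, psi_coe]
  simp only [h1]
  simp

theorem zpow_two_mul_of_nonneg {a : ℤ} (ha : 0 ≤ a) :
    (2 : ℚ_[2]) ^ a = ((2 ^ a.toNat : ℤ_[2]) : ℚ_[2]) := by
  obtain ⟨n, rfl⟩ := Int.eq_ofNat_of_zero_le ha
  push_cast
  rw [coe_two]
  simp

theorem gauss_intClass_of_lt {U : Type*} [AddCommGroup U] [Module ℤ_[2] U] [Module.Free ℤ_[2] U]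
    [Module.Finite ℤ_[2] U] {k i : ℤ} (h : k < i) (f : LinearMap.BilinForm ℤ_[2] U) :
    gauss k (intClass i f) = 1 := by
  refine gauss_eq_one k _ fun x => ⟨2 ^ (i - k - 1).toNat * f x x, ?_⟩
  rw [PadicInt.coe_mul, ← zpow_two_mul_of_nonneg (by omega), scaledForm_apply, ← mul_assoc,
    ← zpow_add₀ two_ne_zero]
  congr 2; ring

theorem gauss_intClass_of_le {U : Type*} [AddCommGroup U] [Module ℤ_[2] U] [Module.Free ℤ_[2] U]
    [Module.Finite ℤ_[2] U] {k i : ℤ} (h : k ≤ i) (f : LinearMap.BilinForm ℤ_[2] U)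
    (he : IsEvenForm f) : gauss k (intClass i f) = 1 := by
  refine gauss_eq_one k _ fun x => ?_
  obtain ⟨y, hy⟩ := even_iff_two_dvd.1 (he x)
  refine ⟨2 ^ (i - k).toNat * y, ?_⟩
  rw [PadicInt.coe_mul, ← zpow_two_mul_of_nonneg (by omega), scaledForm_apply, hy,
    PadicInt.coe_mul, coe_two, ← mul_assoc, ← mul_assoc, ← zpow_add₀ two_ne_zero,
    ← zpow_add_one₀ two_ne_zero]
  congr 2; ring

theorem isEvenForm_planeForm (a c : ℤ_[2]) : IsEvenForm (planeForm a c) := fun x => by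
  rw [even_iff_two_dvd]
  exact ⟨a * (x.1 * x.1) + x.1 * x.2 + c * (x.2 * x.2), by rw [planeForm_apply]; ring⟩

theorem isUnit_natCast_val {c : ZMod 8} (hc : c * c = 1) : IsUnit (c.val : ℤ_[2]) := by
  rw [isUnit_iff_mod8, mod8_natCast_val, hc]

theorem gauss_unaryClass (k : ℤ) (m : ℕ) (c : ZMod 8) :
    gauss k (unaryClass (k - m) c) = unaryGauss (c.val : ℤ_[2]) m := by
  rw [unaryClass, intClass, gauss_formClass_padicInt, unaryGauss]
  congr 1
  funext t
  congr 1
  rw [scaledForm_apply, unaryForm_apply, ← mul_assoc, ← zpow_add₀ two_ne_zero,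
    show -k - 1 + (k - m) = -((m + 1 : ℕ) : ℤ) by push_cast; ring, zpow_neg, zpow_natCast]
  push_cast
  field_simp

theorem gauss_unaryClass_self (k : ℤ) {c : ZMod 8} (hc : c * c = 1) :
    gauss k (unaryClass k c) = 0 := by
  have := gauss_unaryClass k 0 c
  rw [Nat.cast_zero, sub_zero] at this
  rw [this, unaryGauss_zero (isUnit_natCast_val hc)]

theorem gauss_unaryClass_phase (k : ℤ) (m : ℕ) {c : ZMod 8} (hc : c * c = 1) :
    ∃ r : ℝ, 0 < r ∧ r ^ 2 = (1 / 2) ^ (m + 1) ∧ gauss k (unaryClass (k - (m + 1 : ℕ)) c) =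
      r * chi (c + (m + 1 : ℕ) * signPhase (sign8 c)) := by
  rw [gauss_unaryClass]
  have := unaryGauss_phase (isUnit_natCast_val hc) m
  rwa [mod8_natCast_val] at this

/-- Cancel one entry 1 in `unaryClass_add_hypClass`: what is left is the product of the integrals of
the entries 1 and -1, which have equal absolute values and inverse phases. -/
theorem gauss_hypClass (k : ℤ) (m : ℕ) : gauss k (hypClass (k - (m + 1 : ℕ))) =
    ((1 / 2) ^ (m + 1) : ℝ) := by
  have s1 : signPhase (sign8 1) = 0 := by decide
  have s2 : signPhase (sign8 (-1)) = 0 := by decide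
  obtain ⟨r, hr, hr2, h⟩ := gauss_unaryClass_phase k m (c := 1) (by decide)
  obtain ⟨r', hr', hr2', h'⟩ := gauss_unaryClass_phase k m (c := -1) (by decide)
  have hrr : r' = r := by
    rw [← hr2] at hr2'
    exact (pow_left_inj₀ hr'.le hr.le two_ne_zero).1 hr2'
  subst hrr
  have h1 := congrArg (gauss k) (unaryClass_add_hypClass (k - (m + 1 : ℕ)))
  rw [AddChar.map_add_eq_mul, AddChar.map_add_eq_mul, AddChar.map_add_eq_mul, h, h', s1, s2,
    mul_zero, add_zero, add_zero] at h1
  have hr0 : (r' : ℂ) ≠ 0 := by exact_mod_cast hr.ne'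
  have h2 : (r' : ℂ) * chi 1 ≠ 0 := mul_ne_zero hr0 (chi_ne_zero 1)
  rw [mul_assoc] at h1
  have h3 := mul_left_cancel₀ h2 h1
  rw [← h3, ← hr2, AddChar.map_neg_eq_inv]
  have := chi_ne_zero 1
  field_simp
  push_cast
  ring

theorem gauss_hypClass_of_le {k i : ℤ} (h : k ≤ i) : gauss k (hypClass i) = 1 :=
  gauss_intClass_of_le h _ (isEvenForm_planeForm 0 0)

theorem hasPhase_unaryClass (k : ℤ) (m : ℕ) {c : ZMod 8} (hc : c * c = 1) :
    HasPhase (gauss k (unaryClass (k - (m + 1 : ℕ)) c))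
      (c + (m + 1 : ℕ) * signPhase (sign8 c)) := by
  obtain ⟨r, hr, -, h⟩ := gauss_unaryClass_phase k m hc
  exact ⟨r, hr, h⟩

theorem hasPhase_hypClass (k : ℤ) (m : ℕ) :
    HasPhase (gauss k (hypClass (k - (m + 1 : ℕ)))) 0 := by
  rw [gauss_hypClass]
  exact ⟨(1 / 2) ^ (m + 1), by positivity, by rw [AddChar.map_zero_eq_one, mul_one]⟩

/-- Dividing the phases in the triple relation gives 3 - (3 + 4(m+1)), since the entry 3 has sign -.
-/
theorem hasPhase_anisoClass (k : ℤ) (m : ℕ) :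
    HasPhase (gauss k (anisoClass (k - (m + 1 : ℕ)))) ((m + 1 : ℕ) * 4) := by
  have h1 := hasPhase_unaryClass k m (c := 1) (by decide)
  have h3 := hasPhase_unaryClass k m (c := 3 * 1) (by decide)
  have h := (h1.mul h1).mul h1
  rw [← AddChar.map_add_eq_mul, ← AddChar.map_add_eq_mul,
    unaryClass_triple _ 1 (by decide), AddChar.map_add_eq_mul] at h
  convert h.of_mul_left h3 using 1
  rw [show signPhase (sign8 1) = 0 by decide, show signPhase (sign8 (3 * 1)) = 4 by decide]
  generalize ((m + 1 : ℕ) : ZMod 8) = x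
  revert x; decide

section

variable {U : Type*} [AddCommGroup U] [Module ℤ_[2] U] [Module.Free ℤ_[2] U]
  [Module.Finite ℤ_[2] U]

theorem gauss_intClass_self {f : LinearMap.BilinForm ℤ_[2] U} (hs : ∀ x y, f x y = f y x)
    (hf : IsUnimodular f) (ho : ¬ IsEvenForm f) (k : ℤ) : gauss k (intClass k f) = 0 := by
  obtain ⟨c, hc, h, -⟩ := exists_unaryClass_sum _ f hs hf ho rfl
  have hpos : 0 < Module.finrank ℤ_[2] U := by
    rw [Nat.pos_iff_ne_zero]
    intro h0
    have : Subsingleton U := Module.finrank_zero_iff.1 h0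
    exact ho fun x => by rw [Subsingleton.elim x 0]; simp
  rw [h, map_sum_eq_prod]
  exact Finset.prod_eq_zero (Finset.mem_univ ⟨0, hpos⟩) (gauss_unaryClass_self k (hc _))

theorem signPhase_prod {α : Type*} (s : Finset α) (f : α → ℤˣ) :
    signPhase (∏ i ∈ s, f i) = ∑ i ∈ s, signPhase (f i) := by
  classical
  induction s using Finset.induction_on with
  | empty => simp [signPhase]
  | insert a s ha ih => rw [Finset.prod_insert ha, Finset.sum_insert ha, signPhase_mul, ih]

theorem hasPhase_of_odd {f : LinearMap.BilinForm ℤ_[2] U} {n : ℕ} {c : Fin n → ZMod 8}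
    (hc : ∀ j, c j * c j = 1) (h : ∀ i, intClass i f = ∑ j, unaryClass i (c j))
    (hsg : sign f = ∏ j, sign8 (c j)) (k : ℤ) (m : ℕ) :
    HasPhase (gauss k (intClass (k - (m + 1 : ℕ)) f))
      (∑ j, c j + (m + 1 : ℕ) * signPhase (sign f)) := by
  rw [h, map_sum_eq_prod, hsg, signPhase_prod, Finset.mul_sum, ← Finset.sum_add_distrib]
  exact hasPhase_prod _ _ _ fun j _ => hasPhase_unaryClass k m (hc j)

theorem hasPhase_of_even {f : LinearMap.BilinForm ℤ_[2] U} (hs : ∀ x y, f x y = f y x)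
    (hf : IsUnimodular f) (he : IsEvenForm f) (k : ℤ) (m : ℕ) :
    HasPhase (gauss k (intClass (k - (m + 1 : ℕ)) f)) ((m + 1 : ℕ) * signPhase (sign f)) := by
  obtain ⟨a, b, -, h, hsg⟩ := exists_plane_sum _ f hs hf he le_rfl
  rw [h, AddChar.map_add_eq_mul, AddChar.map_nsmul_eq_pow, AddChar.map_nsmul_eq_pow, hsg]
  convert ((hasPhase_hypClass k m).pow a).mul ((hasPhase_anisoClass k m).pow b) using 1
  have : signPhase ((-1) ^ b) = b * 4 := by
    clear h hsg
    induction b with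
    | zero => simp [signPhase]
    | succ b ih =>
      rw [pow_succ, signPhase_mul, ih, show signPhase (-1) = 4 by decide]
      push_cast
      ring
  rw [this]; ring

end

/-! ### Comparison of Gauss sums over different lattices -/

/-- The integral is invariant under translation by `C z`. Averaging over `z` inserts the product of
the integrals of ψ(β_j(x) z_j), which is the indicator function of the range of `A`. -/
theorem integral_eq_of_dual {ι κ : Type*} [Fintype ι] [Fintype κ] {F : (ι → ℤ_[2]) → ℂ}
    (hF : Continuous F) (A C : (κ → ℤ_[2]) →ₗ[ℤ_[2]] (ι → ℤ_[2])) (hA : Function.Injective A)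
    (β : κ → (ι → ℤ_[2]) → ℚ_[2]) (hβ : ∀ j, Continuous (β j))
    (hC : ∀ x z, F (x + C z) = F x * psi (∑ j, β j x * z j))
    (hr : ∀ x, x ∈ Set.range A ↔ ∀ j, ‖β j x‖ ≤ 1) :
    ∃ c : ℝ, 0 < c ∧ ∫ x, F x = c * ∫ y, F (A y) := by
  classical
  have hr' : Set.range A = ⋂ j, (β j) ⁻¹' Metric.closedBall 0 1 := by
    ext x
    rw [hr]; simp
  have ho : IsOpen (Set.range A) := by
    rw [hr']
    exact isOpen_iInter_of_finite fun j =>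
      (IsUltrametricDist.isOpen_closedBall (0 : ℚ_[2]) one_ne_zero).preimage (hβ j)
  obtain ⟨c, hc, h⟩ := exists_setIntegral_range (volume : Measure (ι → ℤ_[2]))
    (volume : Measure (κ → ℤ_[2])) A.toAddMonoidHom (LinearMap.continuous_on_pi A) hA ho
  refine ⟨c, hc, (Eq.trans ?_ (h F))⟩
  have h1 (z : κ → ℤ_[2]) : ∫ x, F x * psi (∑ j, β j x * z j) = ∫ x, F x := by
    simp only [← hC]
    exact integral_add_right_eq_self F (C z)
  have h2 : ∫ x, F x = ∫ z : κ → ℤ_[2], ∫ x, F x * psi (∑ j, β j x * z j) := by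
    simp [h1]
  have h3 (x : ι → ℤ_[2]) : ∫ z : κ → ℤ_[2], psi (∑ j, β j x * z j) =
      if x ∈ Set.range A then 1 else 0 := by
    have h4 (z : κ → ℤ_[2]) : psi (∑ j, β j x * z j) = ∏ j, psi (β j x * z j) :=
      map_sum_eq_prod psi (fun j => β j x * z j) Finset.univ
    simp only [h4]
    rw [integral_fintype_prod_volume_eq_prod fun j (t : ℤ_[2]) => psi (β j x * t)]
    simp only [integral_psi_mul]
    rw [Finset.prod_ite_zero]
    simp [hr]
  have h4 : Integrable (Function.uncurry fun (z : κ → ℤ_[2]) (x : ι → ℤ_[2]) =>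
      F x * psi (∑ j, β j x * z j)) (volume.prod volume) := by
    refine integrable_of_continuous _ ?_
    refine (hF.comp continuous_snd).mul (continuous_psi.comp ?_)
    exact continuous_finsetSum _ fun j _ => ((hβ j).comp continuous_snd).mul
      (continuous_coe_padicInt.comp ((continuous_apply j).comp continuous_fst))
  rw [h2, integral_integral_swap h4]
  simp only [integral_const_mul, h3]
  change _ = ∫ x in Set.range A, F x
  rw [← integral_indicator ho.measurableSet]
  congr 1
  funext x
  rw [Set.indicator_apply, mul_ite, mul_one, mul_zero]

end TwoAdic

namespace TwoAdic

open MeasureTheory TensorProduct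

/-! ### The oddity of a unimodular form -/

theorem exists_eq_pow_mul {d : ℤ_[2]} (hd : d ≠ 0) : ∃ (a : ℕ) (u : ℤ_[2]), IsUnit u ∧
    d = u * 2 ^ a :=
  ⟨d.valuation, PadicInt.unitCoeff hd, (PadicInt.unitCoeff hd).isUnit,
    PadicInt.unitCoeff_spec hd⟩

/-- The antisquare correction 4 occurs when `k` is odd and the sign is -, which is what `k *
signPhase` computes in `ZMod 8`. In this form it matches the phase of a Gauss integral. -/
theorem diagOddity_zpow_mul (k : ℤ) {u : ℤ_[2]} (hu : IsUnit u) :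
    diagOddity ((2 : ℚ_[2]) ^ k * u) = mod8 u + k * signPhase (sign8 (mod8 u)) := by
  have hu0 : (u : ℚ_[2]) ≠ 0 := by
    rw [Ne, PadicInt.coe_eq_zero]; exact hu.ne_zero
  have h2 : ((2 : ℚ_[2]) ^ k) ≠ 0 := zpow_ne_zero _ two_ne_zero
  have hv : ((2 : ℚ_[2]) ^ k * u).valuation = k := by
    have h3 : (u : ℚ_[2]).valuation = 0 := by
      rw [PadicInt.valuation_coe]
      have := PadicInt.norm_eq_zpow_neg_valuation hu.ne_zero
      rw [PadicInt.isUnit_iff.1 hu, eq_comm] at this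
      have h5 : u.valuation = 0 := by
        by_contra h0
        have h6 : ((2 : ℕ) : ℝ) ^ (-(u.valuation : ℤ)) < 1 :=
          zpow_lt_one_of_neg₀ (by norm_num) (by omega)
        exact h6.ne this
      simp [h5]
    have h4 := Padic.valuation_zpow (p := 2) 2 k
    have h5 : (2 : ℚ_[2]).valuation = 1 := by simp
    rw [Padic.valuation_mul h2 hu0, h3, h4, h5]
    ring
  have ho : oddPart ((2 : ℚ_[2]) ^ k * u) = u := by
    apply PadicInt.ext
    change (2 : ℚ_[2]) ^ k * u * (2 : ℚ_[2]) ^ (-((2 : ℚ_[2]) ^ k * u).valuation) = u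
    rw [hv, zpow_neg]
    field_simp
  rw [diagOddity, IsAntisquare, hv, ho, legendre_eq, signPhase]
  congr 1
  have hne : (2 : ℚ_[2]) ^ k * u ≠ 0 := mul_ne_zero h2 hu0
  rcases Int.units_eq_one_or (sign8 (mod8 u)) with hs | hs
  · have : ¬ (1 : ℤˣ) = -1 := by decide
    simp [hs, this]
  · have : ¬ (-1 : ℤˣ) = 1 := by decide
    rw [hs, if_neg this]
    rcases Int.even_or_odd k with hk | hk
    · rw [if_neg fun h => (Int.not_odd_iff_even.2 hk) h.2.1]
      obtain ⟨l, rfl⟩ := hk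
      have : ((8 : ℕ) : ZMod 8) = 0 := ZMod.natCast_self 8
      push_cast at this ⊢
      linear_combination (-(l : ZMod 8)) * this
    · rw [if_pos ⟨hne, hk, rfl⟩]
      obtain ⟨l, rfl⟩ := hk
      have : ((8 : ℕ) : ZMod 8) = 0 := ZMod.natCast_self 8
      push_cast at this ⊢
      linear_combination (-(l : ZMod 8)) * this

/-- Even powers of 2 do not change the parity of the valuation; this allows denominators of basis
vectors to be cleared. -/
theorem diagOddity_sq_mul (M : ℕ) {a : ℚ_[2]} (d : ℤ_[2]) (hd : d ≠ 0)
    (h : (d : ℚ_[2]) = 2 ^ (2 * M) * a) : diagOddity a = diagOddity d := by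
  obtain ⟨b, u, hu, rfl⟩ := exists_eq_pow_mul hd
  have h1 : a = (2 : ℚ_[2]) ^ ((b : ℤ) - 2 * M) * u := by
    rw [zpow_sub₀ two_ne_zero, zpow_natCast, show (2 * (M : ℤ)) = ((2 * M : ℕ) : ℤ) by push_cast; ring,
      zpow_natCast]
    push_cast at h
    rw [coe_two] at h
    field_simp
    linear_combination -h
  have h2 : ((u * 2 ^ b : ℤ_[2]) : ℚ_[2]) = (2 : ℚ_[2]) ^ (b : ℤ) * u := by
    push_cast
    rw [coe_two, zpow_natCast]; ring
  rw [h2, h1, diagOddity_zpow_mul _ hu, diagOddity_zpow_mul _ hu]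
  push_cast
  linear_combination (-(M : ZMod 8)) * two_mul_signPhase (sign8 (mod8 u))

section

variable {U : Type*} [AddCommGroup U] [Module ℤ_[2] U]

theorem exists_pow_smul_eq_tmul (t : ℚ_[2] ⊗[ℤ_[2]] U) :
    ∃ (M : ℕ) (w : U), (2 : ℚ_[2]) ^ M • t = 1 ⊗ₜ w := by
  induction t using TensorProduct.induction_on with
  | zero => exact ⟨0, 0, by simp⟩
  | tmul a x =>
    obtain ⟨M, z, hz⟩ : ∃ (M : ℕ) (z : ℤ_[2]), (2 : ℚ_[2]) ^ M * a = z := by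
      rcases eq_or_ne a 0 with rfl | ha
      · exact ⟨0, 0, by simp⟩
      refine ⟨(-a.valuation).toNat, 2 ^ (a.valuation + (-a.valuation).toNat).toNat * oddPart a, ?_⟩
      rw [PadicInt.coe_mul, ← zpow_two_mul_of_nonneg (by omega), oddPart, ← zpow_natCast]
      change _ = _ * (a * (2 : ℚ_[2]) ^ (-a.valuation))
      rw [mul_left_comm, ← zpow_add₀ two_ne_zero, mul_comm]
      congr 2
      ring
    refine ⟨M, z • x, ?_⟩
    rw [TensorProduct.smul_tmul', smul_eq_mul, hz, ← TensorProduct.smul_tmul, Algebra.smul_def,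
      mul_one]
    rfl
  | add t t' h h' =>
    obtain ⟨M, w, h⟩ := h
    obtain ⟨M', w', h'⟩ := h'
    refine ⟨M + M', (2 : ℤ_[2]) ^ M' • w + (2 : ℤ_[2]) ^ M • w', ?_⟩
    have key (n : ℕ) (y : U) : (1 : ℚ_[2]) ⊗ₜ[ℤ_[2]] ((2 : ℤ_[2]) ^ n • y) =
        (2 : ℚ_[2]) ^ n • ((1 : ℚ_[2]) ⊗ₜ[ℤ_[2]] y) := by
      rw [← TensorProduct.smul_tmul, TensorProduct.smul_tmul', Algebra.smul_def, smul_eq_mul,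
        map_pow]
      rfl
    rw [TensorProduct.tmul_add, key, key, ← h, ← h', smul_smul, smul_smul, smul_add, ← pow_add,
      ← pow_add, add_comm M']

variable [Module.Free ℤ_[2] U] [Module.Finite ℤ_[2] U]

/-- The level 2k is even so that 2k - a has the parity of a, which turns the phase of the integral
into the oddity of the entry. -/
theorem gauss_diagonal (k : ℕ) {u : ℤ_[2]} (hu : IsUnit u) {a : ℕ} (ha : a < 2 * k) :
    HasPhase (∫ t : ℤ_[2], psi ((2 : ℚ_[2]) ^ (-(2 * k : ℤ) - 1) * ((u * 2 ^ a : ℤ_[2]) * t ^ 2)))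
      (diagOddity ((u * 2 ^ a : ℤ_[2]) : ℚ_[2])) := by
  have h2 : ((u * 2 ^ a : ℤ_[2]) : ℚ_[2]) = (2 : ℚ_[2]) ^ (a : ℤ) * u := by
    push_cast
    rw [coe_two, zpow_natCast]; ring
  obtain ⟨m, hm⟩ : ∃ m, 2 * k = a + (m + 1) := ⟨2 * k - a - 1, by omega⟩
  obtain ⟨r, hr, -, h⟩ := unaryGauss_phase hu m
  refine ⟨r, hr, ?_⟩
  rw [h2, diagOddity_zpow_mul _ hu]
  convert h using 1
  · rw [unaryGauss]
    congr 1
    funext t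
    congr 1
    rw [show -(2 * (k : ℤ)) - 1 = -((a + (m + 1) + 1 : ℕ) : ℤ) by push_cast; omega, zpow_neg,
      zpow_natCast, zpow_natCast]
    field_simp
    ring
  · congr 3
    have h3 := congrArg (Nat.cast : ℕ → ZMod 8) hm
    push_cast at h3 ⊢
    linear_combination (-(k : ZMod 8) + a) * two_mul_signPhase (sign8 (mod8 u)) + 
      signPhase (sign8 (mod8 u)) * h3

/-- On the span of the w_i the integral factors over coordinates. A vector x lies in the span when
all f(x, w_j)/f(w_j, w_j) are integral, and at a high level `integral_eq_of_dual` imposes these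
conditions at the cost of a positive factor. -/
theorem exists_hasPhase_of_orthogonal {f : LinearMap.BilinForm ℤ_[2] U}
    (hs : ∀ x y, f x y = f y x) {n : ℕ} (w : Fin n → U)
    (hw : ∀ i j, i ≠ j → f (w i) (w j) = 0) (hd : ∀ i, f (w i) (w i) ≠ 0)
    (hz : ∀ y, (∀ j, f y (w j) = 0) → y = 0) :
    ∃ s : ℕ, HasPhase (gauss (2 * (s + 1 : ℕ)) (intClass 0 f))
      (∑ i, diagOddity (f (w i) (w i) : ℤ_[2])) := by
  choose a u hu hdu using fun i => exists_eq_pow_mul (hd i)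
  choose u' hu' using fun i => (hu i).exists_right_inv
  obtain ⟨s, hsa⟩ : ∃ s : ℕ, ∀ i, a i < s :=
    ⟨∑ i, a i + 1, fun i => Nat.lt_succ_of_le (Finset.single_le_sum (fun _ _ => Nat.zero_le _)
      (Finset.mem_univ i))⟩
  refine ⟨s, ?_⟩
  set m : ℕ := 2 * (s + 1) with hm
  -- With 2 q_i f(w_i, w_i) = 2^m, translation by 2 q_i z_i w_i changes the argument of ψ by z_i
  -- f(x, w_i)/f(w_i, w_i) and an integral quadratic term.
  let q (i : Fin n) : ℤ_[2] := u' i * 2 ^ (m - a i - 1)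
  have hq (i : Fin n) : 2 * q i * f (w i) (w i) = 2 ^ m := by
    have h1 : m = 1 + (m - a i - 1) + a i := by have := hsa i; omega
    conv_rhs => rw [h1, pow_add, pow_add]
    rw [hdu i]
    linear_combination 2 * 2 ^ (m - a i - 1) * 2 ^ (a i) * hu' i
  let e := (Module.finBasis ℤ_[2] U).equivFun.symm
  have hsum (c : Fin n → ℤ_[2]) (y : U) : f y (∑ i, c i • w i) = ∑ i, c i * f y (w i) := by
    simp
  have hsum' (c : Fin n → ℤ_[2]) (j : Fin n) :
      f (∑ i, c i • w i) (w j) = c j * f (w j) (w j) := by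
    rw [hs, hsum, Finset.sum_eq_single j _ (by simp)]
    intro i _ hij
    rw [hw j i hij.symm, mul_zero]
  let A₀ : (Fin n → ℤ_[2]) →ₗ[ℤ_[2]] U := Fintype.linearCombination ℤ_[2] w
  have hA₀ (c) : A₀ c = ∑ i, c i • w i := rfl
  let C₀ : (Fin n → ℤ_[2]) →ₗ[ℤ_[2]] U := Fintype.linearCombination ℤ_[2] fun i => (2 * q i) • w i
  have hC₀ (c) : C₀ c = ∑ i, (c i * (2 * q i)) • w i := by
    change ∑ i, c i • (2 * q i) • w i = _
    simp only [smul_smul]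
  let F : (Fin (Module.finrank ℤ_[2] U) → ℤ_[2]) → ℂ := fun x =>
    psi ((2 : ℚ_[2]) ^ (-(m : ℤ) - 1) * (f (e x) (e x) : ℤ_[2]))
  have hcont (y : U) : Continuous fun x => f (e x) y :=
    LinearMap.continuous_on_pi ((f.flip y).comp e.toLinearMap)
  have hF : Continuous F := by
    refine continuous_psi.comp (continuous_const.mul (continuous_coe_padicInt.comp ?_))
    have h1 (x) : f (e x) (e x) = ∑ i, x i * f (e x) (Module.finBasis ℤ_[2] U i) := by
      nth_rewrite 2 [show e x = ∑ i, x i • Module.finBasis ℤ_[2] U i from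
        Module.Basis.equivFun_symm_apply _ x]
      simp
    simp only [h1]
    exact continuous_finsetSum _ fun i _ => (continuous_apply i).mul (hcont _)
  have hd' (i) : ((f (w i) (w i) : ℤ_[2]) : ℚ_[2]) ≠ 0 := by
    rw [Ne, PadicInt.coe_eq_zero]; exact hd i
  obtain ⟨c, hc, h⟩ := integral_eq_of_dual (F := F) hF (e.symm.toLinearMap.comp A₀)
    (e.symm.toLinearMap.comp C₀) (by
      refine e.symm.injective.comp ?_
      rw [← LinearMap.ker_eq_bot, LinearMap.ker_eq_bot']
      intro c hc
      funext j
      have h1 := hsum' c j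
      rw [← hA₀, hc, map_zero, LinearMap.zero_apply] at h1
      exact (mul_eq_zero.1 h1.symm).resolve_right (hd j))
    (fun j x => (f (e x) (w j) : ℤ_[2]) / (f (w j) (w j) : ℤ_[2]))
    (fun j => (continuous_coe_padicInt.comp (hcont _)).div_const _)
    (by
      intro x z
      simp only [F, LinearMap.comp_apply, LinearEquiv.coe_coe, map_add, LinearEquiv.apply_symm_apply,
        LinearMap.add_apply]
      rw [← AddChar.map_add_eq_mul]
      have h1 : f (e x) (C₀ z) = ∑ i, z i * (2 * q i) * f (e x) (w i) := by
        rw [hC₀, hsum]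
      have h2 : f (C₀ z) (C₀ z) = 2 ^ (m + 1) * ∑ i, z i * z i * q i := by
        conv_lhs => rw [hC₀, hsum, Finset.sum_congr rfl fun i _ => by rw [hsum']]
        rw [Finset.mul_sum]
        refine Finset.sum_congr rfl fun i _ => ?_
        rw [pow_succ, ← hq i]; ring
      refine psi_congr (∑ i, z i * z i * q i) ?_
      rw [hs (C₀ z) (e x), h2, h1]
      have h3 : ∑ j, ((f (e x) (w j) : ℤ_[2]) : ℚ_[2]) / (f (w j) (w j) : ℤ_[2]) * z j =
          (2 : ℚ_[2]) ^ (-(m : ℤ)) * ((∑ i, z i * (2 * q i) * f (e x) (w i) : ℤ_[2]) : ℚ_[2]) := by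
        rw [PadicInt.coe_sum, Finset.mul_sum]
        refine Finset.sum_congr rfl fun i _ => ?_
        have h4 := congrArg (fun t : ℤ_[2] => (t : ℚ_[2])) (hq i)
        have := hd' i
        push_cast at h4 ⊢
        rw [coe_two] at h4 ⊢
        rw [zpow_neg, zpow_natCast, ← h4]
        have hq0 : (q i : ℚ_[2]) ≠ 0 := by
          intro h0
          rw [h0, mul_zero, zero_mul] at h4
          exact pow_ne_zero m two_ne_zero h4.symm
        field_simp
      rw [h3, zpow_sub₀ two_ne_zero]
      push_cast
      rw [coe_two, zpow_one, zpow_neg, zpow_natCast]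
      field_simp
      ring)
    (by
      intro x
      constructor
      · rintro ⟨c, rfl⟩ j
        simp only [LinearMap.comp_apply, LinearEquiv.coe_coe, LinearEquiv.apply_symm_apply]
        rw [hA₀, hsum', PadicInt.coe_mul, mul_div_cancel_right₀ _ (hd' j)]
        exact (c j).2
      · intro hx
        let c (j : Fin n) : ℤ_[2] := ⟨_, hx j⟩
        refine ⟨c, ?_⟩
        change e.symm (A₀ c) = x
        rw [LinearEquiv.symm_apply_eq, ← sub_eq_zero]
        refine hz _ fun j => ?_
        rw [map_sub, LinearMap.sub_apply, hA₀, hsum', sub_eq_zero]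
        apply PadicInt.ext
        rw [PadicInt.coe_mul]
        exact div_mul_cancel₀ _ (hd' j))
  have h1 : gauss (2 * (s + 1 : ℕ)) (intClass 0 f) = ∫ x, F x := by
    rw [intClass, gauss_formClass _ _ e]
    congr 1
    funext x
    simp only [F]
    rw [scaledForm_apply, zpow_zero, one_mul, hm]
    push_cast
    rfl
  have h2 : ∫ y, F (e.symm.toLinearMap.comp A₀ y) =
      ∏ i, ∫ t : ℤ_[2], psi ((2 : ℚ_[2]) ^ (-(2 * (s + 1 : ℕ) : ℤ) - 1) *
        ((u i * 2 ^ a i : ℤ_[2]) * t ^ 2)) := by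
    rw [← integral_fintype_prod_volume_eq_prod]
    congr 1
    funext y
    simp only [F, LinearMap.comp_apply, LinearEquiv.coe_coe, LinearEquiv.apply_symm_apply]
    rw [← map_sum_eq_prod, ← Finset.mul_sum]
    congr 1
    rw [hm]
    push_cast
    congr 1
    rw [hA₀, hsum, Finset.sum_congr rfl fun i _ => by rw [hsum'], PadicInt.coe_sum]
    refine Finset.sum_congr rfl fun i _ => ?_
    rw [hdu i]
    push_cast
    ring
  have h3 := hasPhase_prod Finset.univ _ _ fun i _ =>
    gauss_diagonal (s + 1) (hu i) (a := a i) (by have := hsa i; omega)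
  rw [h1, h, h2]
  obtain ⟨r, hr, h3⟩ := h3
  refine ⟨c * r, mul_pos hc hr, ?_⟩
  rw [h3]
  push_cast
  rw [mul_assoc]
  congr 3
  exact Finset.sum_congr rfl fun i _ => by rw [hdu i]; push_cast; rfl

/-- Powers of 2 scale the chosen orthogonal basis of U ⊗ ℚ_2 into U. Norms change by even powers of
2, so the oddity is unaffected, and unimodularity keeps the norms nonzero. -/
theorem exists_hasPhase_oddity {f : LinearMap.BilinForm ℤ_[2] U}
    (hs : ∀ x y, f x y = f y x) (hf : IsUnimodular f) :
    ∃ s : ℕ, HasPhase (gauss (2 * (s + 1 : ℕ)) (intClass 0 f)) (oddity f) := by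
  have hsym : LinearMap.IsSymm (LinearMap.BilinForm.baseChange ℚ_[2] f) :=
    LinearMap.BilinForm.IsSymm.baseChange ℚ_[2] ⟨hs⟩
  have h := exists_orthogonal_basis _ hsym
  rw [oddity, spaceOddity, dif_pos h]
  have hv := h.choose_spec
  set v := h.choose
  set Q := LinearMap.BilinForm.baseChange ℚ_[2] f with hQ
  choose M w hMw using fun i => exists_pow_smul_eq_tmul (v i)
  have hQf (x y : U) : Q (1 ⊗ₜ x) (1 ⊗ₜ y) = (f x y : ℤ_[2]) := by
    rw [hQ, LinearMap.BilinForm.baseChange_tmul, Algebra.smul_def, mul_one, mul_one]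
    rfl
  have hfw (i j) : ((f (w i) (w j) : ℤ_[2]) : ℚ_[2]) = 2 ^ M i * 2 ^ M j * Q (v i) (v j) := by
    rw [← hQf, ← hMw, ← hMw]
    simp [mul_assoc, mul_left_comm]
  have hz (y) (hy : ∀ j, f y (w j) = 0) : y = 0 := by
    apply hf.1
    rw [map_zero]
    ext x
    have h0 : Q (1 ⊗ₜ y) = 0 := by
      refine v.ext fun j => ?_
      have h1 : Q (1 ⊗ₜ y) (1 ⊗ₜ w j) = 0 := by rw [hQf, hy]; rfl
      rw [← hMw, map_smul, smul_eq_mul] at h1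
      exact (mul_eq_zero.1 h1).resolve_left (pow_ne_zero _ two_ne_zero)
    have h1 := hQf y x
    rw [h0, LinearMap.zero_apply, eq_comm, PadicInt.coe_eq_zero] at h1
    rw [h1]
    rfl
  have hw (i j) (hij : i ≠ j) : f (w i) (w j) = 0 := by
    have h1 := hfw i j
    rw [LinearMap.isOrthoᵢ_def.1 hv i j hij, mul_zero, PadicInt.coe_eq_zero] at h1
    exact h1
  have hd (i) : f (w i) (w i) ≠ 0 := by
    intro h0
    have h1 : w i = 0 := hz _ fun j => by
      rcases eq_or_ne i j with rfl | hij
      · exact h0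
      · exact hw i j hij
    have h2 := hMw i
    rw [h1, TensorProduct.tmul_zero, smul_eq_zero] at h2
    exact v.ne_zero i (h2.resolve_left (pow_ne_zero _ two_ne_zero))
  obtain ⟨s, h⟩ := exists_hasPhase_of_orthogonal hs w hw hd hz
  refine ⟨s, ?_⟩
  convert h using 1
  refine Finset.sum_congr rfl fun i _ => diagOddity_sq_mul (M i) _ (hd i) ?_
  rw [hfw, two_mul, pow_add]

/-- Both sides are the phase of one Gauss integral; its even level kills the contribution of the
sign. -/
theorem oddity_of_odd {f : LinearMap.BilinForm ℤ_[2] U}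
    (hs : ∀ x y, f x y = f y x) (hf : IsUnimodular f) {n : ℕ} {c : Fin n → ZMod 8}
    (hc : ∀ j, c j * c j = 1) (h : ∀ i, intClass i f = ∑ j, unaryClass i (c j))
    (hsg : sign f = ∏ j, sign8 (c j)) : oddity f = ∑ j, c j := by
  obtain ⟨s, h1⟩ := exists_hasPhase_oddity hs hf
  have h2 := hasPhase_of_odd hc h hsg (2 * (s + 1 : ℕ)) (2 * s + 1)
  rw [show (2 * (s + 1 : ℕ) : ℤ) - (2 * s + 1 + 1 : ℕ) = 0 by push_cast; ring] at h2
  rw [h1.unique h2]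
  push_cast
  linear_combination ((s : ZMod 8) + 1) * two_mul_signPhase (sign f)

theorem oddity_of_even {f : LinearMap.BilinForm ℤ_[2] U}
    (hs : ∀ x y, f x y = f y x) (hf : IsUnimodular f) (he : IsEvenForm f) : oddity f = 0 := by
  obtain ⟨s, h1⟩ := exists_hasPhase_oddity hs hf
  have h2 := hasPhase_of_even hs hf he (2 * (s + 1 : ℕ)) (2 * s + 1)
  rw [show (2 * (s + 1 : ℕ) : ℤ) - (2 * s + 1 + 1 : ℕ) = 0 by push_cast; ring] at h2
  rw [h1.unique h2]
  push_cast
  linear_combination ((s : ZMod 8) + 1) * two_mul_signPhase (sign f)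

end

end TwoAdic

namespace TwoAdic

/-! ### Forms with a Jordan decomposition -/

theorem LatticeType.ne_I_iff {t : LatticeType} : t ≠ LatticeType.I ↔ t = LatticeType.II := by
  cases t <;> simp

theorem latticeType_eq_II_iff {U : Type*} [AddCommGroup U] [Module ℤ_[2] U]
    {f : LinearMap.BilinForm ℤ_[2] U} : latticeType f = LatticeType.II ↔ IsEvenForm f := by
  rw [latticeType]; split_ifs with h <;> simp [h]

theorem latticeType_eq_I_iff {U : Type*} [AddCommGroup U] [Module ℤ_[2] U]
    {f : LinearMap.BilinForm ℤ_[2] U} : latticeType f = LatticeType.I ↔ ¬ IsEvenForm f := by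
  rw [latticeType]; split_ifs with h <;> simp [h]

/-- The class of an even unimodular form, rescaled by `2 ^ i`. -/
def evenClass (i : ℤ) (d : ℕ) (σ : ℤˣ) : FormClass :=
  if σ = 1 then (d / 2) • hypClass i else (d / 2 - 1) • hypClass i + anisoClass i

theorem nsmul_eq_evenClass (i : ℤ) (m n : ℕ) :
    m • hypClass i + n • anisoClass i = evenClass i (2 * (m + n)) ((-1) ^ n) := by
  have h0 : ¬ (-1 : ℤˣ) = 1 := by decide
  rw [evenClass, Nat.mul_div_cancel_left _ two_pos]
  rcases Nat.even_or_odd n with h | h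
  · rw [if_pos h.neg_one_pow, nsmul_hypClass_add_nsmul_anisoClass i m n (m + n) 0 rfl
      (by rw [h.neg_one_pow, pow_zero]), zero_smul, add_zero]
  · have := h.pos
    rw [h.neg_one_pow, if_neg h0, nsmul_hypClass_add_nsmul_anisoClass i m n (m + n - 1) 1 (by omega)
      (by rw [h.neg_one_pow, pow_one]), one_smul]

/-- The rank one constituents of the terms of scales in `T`. -/
abbrev Slot (S : Symbol) (T : Finset ℤ) : Type := Σ i : T, Fin (S.dim i)

/-- The scale of a slot. -/
def Slot.scale {S : Symbol} {T : Finset ℤ} (p : Slot S T) : ℤ := p.1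

theorem prod_slot {M : Type*} [CommMonoid M] (S : Symbol) (T : Finset ℤ)
    (g : ∀ i, Fin (S.dim i) → M) : ∏ p : Slot S T, g p.1 p.2 = ∏ i ∈ T, ∏ j, g i j := by
  rw [Fintype.prod_sigma]
  exact Finset.prod_coe_sort T fun i => ∏ j, g i j

theorem sum_slot {M : Type*} [AddCommMonoid M] (S : Symbol) (T : Finset ℤ)
    (g : ∀ i, Fin (S.dim i) → M) : ∑ p : Slot S T, g p.1 p.2 = ∑ i ∈ T, ∑ j, g i j := by
  rw [Fintype.sum_sigma]
  exact Finset.sum_coe_sort T fun i => ∑ j, g i j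

theorem compartment_subset (t : ℤ → LatticeType) (i : ℤ) :
    compartment t i ⊆ {j | t j = LatticeType.I} := fun j hj => hj j Set.right_mem_uIcc

open Classical in
-- Compartments lie in the finite set of scales of type I, so the `finsum` is a genuine sum and not
-- its default value 0.
theorem finsum_compartment {M : Type*} [AddCommMonoid M] {t : ℤ → LatticeType} {T : Finset ℤ}
    (hT : ∀ i, t i = LatticeType.I → i ∈ T) (o : ℤ → M) (i : ℤ) :
    ∑ᶠ j ∈ compartment t i, o j = ∑ j ∈ T, if j ∈ compartment t i then o j else 0 := by
  rw [← Finset.sum_filter, ← finsum_mem_coe_finset]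
  refine finsum_mem_congr (Set.ext fun j => ?_) fun _ _ => rfl
  rw [Finset.mem_coe, Finset.mem_filter]
  exact ⟨fun h => ⟨hT j (compartment_subset t i h), h⟩, fun h => h.2⟩

namespace JordanDecomposition

variable {L : Type*} [AddCommGroup L] [Module ℤ_[2] L] {B : L →ₗ[ℤ_[2]] L →ₗ[ℤ_[2]] ℚ_[2]} (J : JordanDecomposition B)

theorem form_symm (hB : ∀ x y, B x y = B y x) (i : ℤ) (x y : J.constituent i) :
    J.form i x y = J.form i y x := by
  have h := hB x y
  rw [J.form_scaled i x y, J.form_scaled i y x] at h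
  exact PadicInt.ext (mul_left_cancel₀ (zpow_ne_zero _ two_ne_zero) h)

variable [Module.Free ℤ_[2] L] [Module.Finite ℤ_[2] L]

theorem subsingleton_of_dim_eq_zero {i : ℤ} (h : J.symbol.dim i = 0) :
    Subsingleton (J.constituent i) := Module.finrank_zero_iff.1 h

/-- A Noetherian module has no infinite independent family of nonzero submodules. -/
theorem finite_dim : {i | J.symbol.dim i ≠ 0}.Finite := by
  refine (WellFoundedGT.finite_ne_bot_of_iSupIndep J.isInternal.submodule_iSupIndep).subset ?_
  intro i hi h
  refine hi ?_
  change Module.finrank ℤ_[2] (J.constituent i) = 0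
  rw [h, finrank_bot]

theorem formClass_eq_sum (s : Finset ℤ) (hs : ∀ i, J.symbol.dim i ≠ 0 → i ∈ s) :
    formClass B = ∑ i ∈ s, intClass i (J.form i) := by
  have h1 : s.sup J.constituent = ⊤ := by
    rw [← top_le_iff, ← J.isInternal.submodule_iSup_eq_top]
    refine iSup_le fun i => ?_
    by_cases hi : i ∈ s
    · exact Finset.le_sup (f := J.constituent) hi
    · have h0 : J.symbol.dim i = 0 := by
        by_contra h
        exact hi (hs i h)
      have := J.subsingleton_of_dim_eq_zero h0
      rw [Submodule.subsingleton_iff_eq_bot.1 this]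
      exact bot_le
  rw [← formClass_restrict_top B, ← formClass_restrict_congr B h1,
    formClass_restrict_finset_sup B _ J.isInternal.submodule_iSupIndep J.orthogonal]
  refine Finset.sum_congr rfl fun i _ => ?_
  rw [intClass]
  congr 1
  ext x y
  rw [restrictForm_apply, scaledForm_apply, J.form_scaled]

theorem type_of_dim_eq_zero {i : ℤ} (h : J.symbol.dim i = 0) :
    J.symbol.type i = LatticeType.II := by
  have := J.subsingleton_of_dim_eq_zero h
  exact latticeType_eq_II_iff.2 fun x => by rw [Subsingleton.elim x 0]; simp

theorem sign_of_dim_eq_zero {i : ℤ} (h : J.symbol.dim i = 0) : J.symbol.sign i = 1 := by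
  have := J.subsingleton_of_dim_eq_zero h
  exact sign_of_subsingleton _

theorem exists_odd (hB : ∀ x y, B x y = B y x) {i : ℤ} (h : J.symbol.type i = LatticeType.I) :
    ∃ c : Fin (J.symbol.dim i) → ZMod 8, (∀ j, c j * c j = 1) ∧
      (∀ k, intClass k (J.form i) = ∑ j, unaryClass k (c j)) ∧
      J.symbol.sign i = ∏ j, sign8 (c j) ∧ oddity (J.form i) = ∑ j, c j := by
  obtain ⟨c, hc, h1, h2⟩ := exists_unaryClass_sum _ (J.form i) (J.form_symm hB i) (J.unimodular i)
    (latticeType_eq_I_iff.1 h) rfl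
  exact ⟨c, hc, h1, h2, oddity_of_odd (J.form_symm hB i) (J.unimodular i) hc h1 h2⟩

theorem intClass_of_even (hB : ∀ x y, B x y = B y x) {i : ℤ}
    (h : J.symbol.type i = LatticeType.II) :
    intClass i (J.form i) = evenClass i (J.symbol.dim i) (J.symbol.sign i) := by
  obtain ⟨m, n, h1, h2, h3⟩ := exists_plane_sum _ (J.form i) (J.form_symm hB i) (J.unimodular i)
    (latticeType_eq_II_iff.1 h) le_rfl
  rw [h2, nsmul_eq_evenClass, ← h1, ← h3]
  rfl

open Classical in
-- A normal form governed by the symbol: even terms contribute classes that depend on `S` alone, and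
-- odd terms merge into one diagonal form whose signs and compartment sums are read off `S`.
-- Indexing slots by `S` instead of `J.symbol` puts two decompositions with one symbol on the same
-- index type.
theorem exists_slots (hB : ∀ x y, B x y = B y x) {S : Symbol} (hJ : J.symbol = S) {s T : Finset ℤ}
    (hs : ∀ i, S.dim i ≠ 0 → i ∈ s) (hT : ∀ i, i ∈ T ↔ S.type i = LatticeType.I) :
    ∃ c : Slot S T → ZMod 8, (∀ p, c p * c p = 1) ∧
      formClass B = ∑ i ∈ s \ T, evenClass i (S.dim i) (S.sign i) + diagClass Slot.scale c ∧
      (∀ i, ∏ p ∈ Finset.univ.filter (fun p : Slot S T => p.scale = i), sign8 (c p) =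
        if i ∈ T then S.sign i else 1) ∧
      ∀ p : Slot S T, ∑ p' ∈ Finset.univ.filter (Joined Slot.scale p), c p' =
        S.compartmentOddity p.scale := by
  subst hJ
  have hdim (i) (hi : i ∈ T) : J.symbol.dim i ≠ 0 := fun h0 => by
    have := J.type_of_dim_eq_zero h0
    rw [(hT i).1 hi] at this
    cases this
  have h0 (i : ℤ) : ∃ c : Fin (J.symbol.dim i) → ZMod 8, i ∈ T → (∀ j, c j * c j = 1) ∧
      (∀ k, intClass k (J.form i) = ∑ j, unaryClass k (c j)) ∧
      J.symbol.sign i = ∏ j, sign8 (c j) ∧ oddity (J.form i) = ∑ j, c j := by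
    by_cases hi : i ∈ T
    · obtain ⟨c, hc⟩ := J.exists_odd hB ((hT i).1 hi)
      exact ⟨c, fun _ => hc⟩
    · exact ⟨0, fun h => absurd h hi⟩
  choose c hc using h0
  -- Odd terms have positive dimension, so the scales of slots fill `T`, and joined slots are those
  -- of one compartment.
  have hrange (i : ℤ) : i ∈ Set.range (Slot.scale (S := J.symbol) (T := T)) ↔ i ∈ T := by
    constructor
    · rintro ⟨p, rfl⟩
      exact p.1.2
    · intro hi
      exact ⟨⟨⟨i, hi⟩, ⟨0, Nat.pos_of_ne_zero (hdim i hi)⟩⟩, rfl⟩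
  refine ⟨fun p => c p.1 p.2, fun p => (hc p.1 p.1.2).1 p.2, ?_, fun i => ?_, fun p => ?_⟩
  · have hTs : T ⊆ s := fun i hi => hs i (hdim i hi)
    rw [J.formClass_eq_sum s hs, ← Finset.sum_sdiff hTs]
    congr 1
    · refine Finset.sum_congr rfl fun i hi => J.intClass_of_even hB ?_
      rw [← LatticeType.ne_I_iff, Ne, ← hT]
      exact (Finset.mem_sdiff.1 hi).2
    · refine Eq.trans (Finset.sum_congr rfl fun i hi => (hc i hi).2.1 i) ?_
      exact (sum_slot J.symbol T fun i j => unaryClass i (c i j)).symm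
  · rw [Finset.prod_filter]
    refine (prod_slot J.symbol T fun i' j => if i' = i then sign8 (c i' j) else 1).trans ?_
    split_ifs with hi
    · rw [Finset.prod_eq_single_of_mem i hi]
      · simp only [if_true]
        exact (hc i hi).2.2.1.symm
      · intro i' _ hne
        simp [hne]
    · refine Finset.prod_eq_one fun i' hi' => ?_
      have : i' ≠ i := fun h => hi (h ▸ hi')
      simp [this]
  · have hjoin (p') : Joined Slot.scale p p' ↔ p'.scale ∈ compartment J.symbol.type p.scale := by
      simp only [Joined, hrange, hT]
      rfl
    rw [Finset.sum_filter]
    simp only [hjoin]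
    refine (sum_slot J.symbol T fun i' j =>
      if i' ∈ compartment J.symbol.type p.scale then c i' j else 0).trans ?_
    refine Eq.trans ?_ (finsum_compartment (fun i => (hT i).2) (fun j => oddity (J.form j)) p.scale).symm
    refine Finset.sum_congr rfl fun i hi => ?_
    split_ifs
    · exact (hc i hi).2.2.2.symm
    · simp

end JordanDecomposition

theorem formClass_eq_of_symbol_eq {L L' : Type*}
    [AddCommGroup L] [Module ℤ_[2] L] [Module.Free ℤ_[2] L] [Module.Finite ℤ_[2] L]
    [AddCommGroup L'] [Module ℤ_[2] L'] [Module.Free ℤ_[2] L'] [Module.Finite ℤ_[2] L']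
    {B : L →ₗ[ℤ_[2]] L →ₗ[ℤ_[2]] ℚ_[2]} {B' : L' →ₗ[ℤ_[2]] L' →ₗ[ℤ_[2]] ℚ_[2]}
    (hB : ∀ x y, B x y = B y x) (hB' : ∀ x y, B' x y = B' y x)
    (J : JordanDecomposition B) (J' : JordanDecomposition B') (h : J'.symbol = J.symbol) :
    formClass B = formClass B' := by
  classical
  let s := J.finite_dim.toFinset
  have hs (i) (hi : J.symbol.dim i ≠ 0) : i ∈ s := J.finite_dim.mem_toFinset.2 hi
  let T := s.filter fun i => J.symbol.type i = LatticeType.I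
  have hT (i) : i ∈ T ↔ J.symbol.type i = LatticeType.I := by
    rw [Finset.mem_filter]
    refine ⟨fun h => h.2, fun h => ⟨hs i fun h0 => ?_, h⟩⟩
    have := J.type_of_dim_eq_zero h0
    rw [h] at this
    cases this
  obtain ⟨c, hc, h1, h2, h3⟩ := J.exists_slots hB rfl hs hT
  obtain ⟨c', hc', h1', h2', h3'⟩ := J'.exists_slots hB' h hs hT
  rw [h1, h1']
  congr 1
  refine diagClass_eq _ c c' hc hc' (fun i => ?_) fun p => ?_
  · convert (h2 i).trans (h2' i).symm
  · convert (h3 p).trans (h3' p).symm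

end TwoAdic

namespace TwoAdic

/-! ### The tensor product with a hyperbolic plane -/

section Double

variable {L L' : Type*} [AddCommGroup L] [Module ℤ_[2] L] [AddCommGroup L'] [Module ℤ_[2] L']

/-- The tensor product of a form with the hyperbolic plane. -/
def doubleForm (B : L →ₗ[ℤ_[2]] L →ₗ[ℤ_[2]] ℚ_[2]) : (L × L) →ₗ[ℤ_[2]] (L × L) →ₗ[ℤ_[2]] ℚ_[2] :=
  B.compl₁₂ (LinearMap.fst _ _ _) (LinearMap.snd _ _ _) +
    B.compl₁₂ (LinearMap.snd _ _ _) (LinearMap.fst _ _ _)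

theorem doubleForm_apply (B : L →ₗ[ℤ_[2]] L →ₗ[ℤ_[2]] ℚ_[2]) (x y : L × L) :
    doubleForm B x y = B x.1 y.2 + B x.2 y.1 := rfl

theorem Isometric.double {B : L →ₗ[ℤ_[2]] L →ₗ[ℤ_[2]] ℚ_[2]}
    {B' : L' →ₗ[ℤ_[2]] L' →ₗ[ℤ_[2]] ℚ_[2]} (h : Isometric B B') :
    Isometric (doubleForm B) (doubleForm B') := by
  obtain ⟨e, he⟩ := h
  exact ⟨e.prodCongr e, fun x y => by simp [doubleForm_apply, he]⟩

theorem formClass_double_coordForm [Module.Free ℤ_[2] L] [Module.Finite ℤ_[2] L]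
    (B : L →ₗ[ℤ_[2]] L →ₗ[ℤ_[2]] ℚ_[2]) :
    formClass (doubleForm (coordForm B).2) = formClass (doubleForm B) :=
  formClass_eq_iff.2 (Isometric.double (isometric_coordForm B))

/-- The tensor product with the hyperbolic plane, on isometry classes. -/
def double : FormClass →+ FormClass where
  toFun := Quotient.lift (fun X => formClass (doubleForm X.2))
    fun _ _ h => formClass_eq_iff.2 (Isometric.double h)
  map_zero' := (formClass_double_coordForm (0 : PUnit →ₗ[ℤ_[2]] PUnit →ₗ[ℤ_[2]] ℚ_[2])).trans
    (formClass_of_subsingleton _)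
  map_add' x y := by
    induction x using Quotient.inductionOn with
    | h X =>
    induction y using Quotient.inductionOn with
    | h Y =>
    refine (formClass_double_coordForm (prodForm X.2 Y.2)).trans ?_
    change _ = formClass (doubleForm X.2) + formClass (doubleForm Y.2)
    rw [← formClass_prodForm, formClass_eq_iff]
    refine ⟨LinearEquiv.prodProdProdComm _ _ _ _ _, fun x y => ?_⟩
    simp [doubleForm_apply]
    ring

theorem double_formClass [Module.Free ℤ_[2] L] [Module.Finite ℤ_[2] L]
    (B : L →ₗ[ℤ_[2]] L →ₗ[ℤ_[2]] ℚ_[2]) : double (formClass B) = formClass (doubleForm B) :=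
  formClass_double_coordForm B

end Double

/-- Rescaling one of the two isotropic basis vectors absorbs the unit, so doubling keeps only
dimension and scale. -/
theorem double_unaryClass (i : ℤ) {c : ZMod 8} (hc : c * c = 1) :
    double (unaryClass i c) = hypClass i := by
  rw [unaryClass, intClass, double_formClass, hypClass, intClass]
  refine formClass_eq_iff.2 ⟨(LinearEquiv.smulOfUnit (isUnit_natCast_val hc).unit).prodCongr
    (LinearEquiv.refl ℤ_[2] ℤ_[2]), fun x y => ?_⟩
  rw [doubleForm_apply, scaledForm_apply, scaledForm_apply, scaledForm_apply, planeForm_apply,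
    unaryForm_apply, unaryForm_apply]
  simp [LinearEquiv.smulOfUnit, Units.smul_def]
  ring

theorem gauss_hypClass_ne_zero (k i : ℤ) : gauss k (hypClass i) ≠ 0 := by
  rcases le_or_gt k i with h | h
  · rw [gauss_hypClass_of_le h]; exact one_ne_zero
  · obtain ⟨m, rfl⟩ : ∃ m : ℕ, i = k - (m + 1 : ℕ) := ⟨(k - i - 1).toNat, by omega⟩
    exact (hasPhase_hypClass k m).ne_zero

/-- Doubling `unaryClass_add_hypClass` turns every unary class into a hyperbolic plane, and a
nonzero factor cancels. -/
theorem gauss_double_hypClass (k i : ℤ) :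
    gauss k (double (hypClass i)) = gauss k (hypClass i) ^ 2 := by
  have h := congrArg (fun x => gauss k (double x)) (unaryClass_add_hypClass i)
  simp only [map_add, AddChar.map_add_eq_mul] at h
  rw [double_unaryClass i (by decide), double_unaryClass i (by decide), mul_assoc] at h
  rw [sq, mul_left_cancel₀ (gauss_hypClass_ne_zero k i) h]

theorem gauss_double_anisoClass (k i : ℤ) :
    gauss k (double (anisoClass i)) = gauss k (hypClass i) ^ 2 := by
  have h := congrArg (fun x => gauss k (double x)) (unaryClass_triple i 1 (by decide))
  simp only [map_add, AddChar.map_add_eq_mul] at h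
  rw [double_unaryClass i (by decide), double_unaryClass i (by decide), mul_assoc] at h
  rw [sq, mul_left_cancel₀ (gauss_hypClass_ne_zero k i) h]

theorem gauss_double_intClass {U : Type*} [AddCommGroup U] [Module ℤ_[2] U]
    [Module.Free ℤ_[2] U] [Module.Finite ℤ_[2] U] {f : LinearMap.BilinForm ℤ_[2] U}
    (hs : ∀ x y, f x y = f y x) (hf : IsUnimodular f) (k i : ℤ) :
    gauss k (double (intClass i f)) = gauss k (hypClass i) ^ Module.finrank ℤ_[2] U := by
  by_cases he : IsEvenForm f
  · obtain ⟨m, n, h1, h2, -⟩ := exists_plane_sum _ f hs hf he le_rfl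
    rw [h1, h2, map_add, map_nsmul, map_nsmul, AddChar.map_add_eq_mul, AddChar.map_nsmul_eq_pow,
      AddChar.map_nsmul_eq_pow, gauss_double_hypClass, gauss_double_anisoClass, ← pow_mul,
      ← pow_mul, ← pow_add]
    congr 1; ring
  · obtain ⟨c, hc, h, -⟩ := exists_unaryClass_sum _ f hs hf he rfl
    rw [h, map_sum, map_sum_eq_prod]
    simp only [double_unaryClass i (hc _)]
    simp

theorem gauss_hypClass_eq (k i : ℤ) :
    gauss k (hypClass i) = (((1 / 2) ^ (k - i).toNat : ℝ) : ℂ) := by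
  rcases le_or_gt k i with h | h
  · rw [gauss_hypClass_of_le h, show (k - i).toNat = 0 by omega]; simp
  · obtain ⟨m, rfl⟩ : ∃ m : ℕ, i = k - (m + 1 : ℕ) := ⟨(k - i - 1).toNat, by omega⟩
    rw [gauss_hypClass, show (k - (k - (m + 1 : ℕ))).toNat = m + 1 by omega]

/-! ### Invariants of a form with a Jordan decomposition -/

namespace JordanDecomposition

variable {L : Type*} [AddCommGroup L] [Module ℤ_[2] L] [Module.Free ℤ_[2] L]
  [Module.Finite ℤ_[2] L] {B : L →ₗ[ℤ_[2]] L →ₗ[ℤ_[2]] ℚ_[2]} (J : JordanDecomposition B)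

theorem gauss_double (hB : ∀ x y, B x y = B y x) (s : Finset ℤ)
    (hs : ∀ i, J.symbol.dim i ≠ 0 → i ∈ s) (k : ℤ) :
    gauss k (double (formClass B)) =
      (((1 / 2) ^ (∑ i ∈ s, (k - i).toNat * J.symbol.dim i) : ℝ) : ℂ) := by
  rw [J.formClass_eq_sum s hs, map_sum, map_sum_eq_prod, ← Finset.prod_pow_eq_pow_sum]
  push_cast
  refine Finset.prod_congr rfl fun i _ => ?_
  rw [gauss_double_intClass (J.form_symm hB i) (J.unimodular i), gauss_hypClass_eq, pow_mul]
  push_cast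
  rfl

theorem gauss_eq_zero (hB : ∀ x y, B x y = B y x) {k : ℤ}
    (h : J.symbol.type k = LatticeType.I) : gauss k (formClass B) = 0 := by
  have hk : k ∈ insert k J.finite_dim.toFinset := Finset.mem_insert_self _ _
  rw [J.formClass_eq_sum (insert k J.finite_dim.toFinset) fun i hi =>
    Finset.mem_insert_of_mem (J.finite_dim.mem_toFinset.2 hi), map_sum_eq_prod]
  exact Finset.prod_eq_zero hk (gauss_intClass_self (J.form_symm hB k) (J.unimodular k)
    (latticeType_eq_I_iff.1 h) k)

theorem oddity_of_type_II (hB : ∀ x y, B x y = B y x) {i : ℤ}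
    (h : J.symbol.type i = LatticeType.II) : oddity (J.form i) = 0 :=
  oddity_of_even (J.form_symm hB i) (J.unimodular i) (latticeType_eq_II_iff.1 h)

theorem hasPhase_gauss_term (hB : ∀ x y, B x y = B y x) {k : ℤ}
    (h : J.symbol.type k = LatticeType.II) (i : ℤ) :
    HasPhase (gauss k (intClass i (J.form i))) (if i < k then oddity (J.form i) +
      ((k - i : ℤ) : ZMod 8) * signPhase (J.symbol.sign i) else 0) := by
  split_ifs with hi
  · obtain ⟨m, hm⟩ : ∃ m : ℕ, i = k - (m + 1 : ℕ) := ⟨(k - i - 1).toNat, by omega⟩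
    have h1 : ((k - i : ℤ) : ZMod 8) = (m + 1 : ℕ) := by
      rw [show k - i = ((m + 1 : ℕ) : ℤ) by omega, Int.cast_natCast]
    rw [h1]
    rcases ht : J.symbol.type i with _ | _
    · obtain ⟨c, hc, h2, h3, h4⟩ := J.exists_odd hB ht
      have := hasPhase_of_odd hc h2 h3 k m
      rw [← hm] at this
      rw [h4]
      exact this
    · have := hasPhase_of_even (J.form_symm hB i) (J.unimodular i) (latticeType_eq_II_iff.1 ht) k m
      rw [← hm] at this
      rw [J.oddity_of_type_II hB ht, zero_add]
      exact this
  · rcases (not_lt.1 hi).eq_or_lt with rfl | hlt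
    · rw [gauss_intClass_of_le le_rfl _ (latticeType_eq_II_iff.1 h)]
      exact hasPhase_one
    · rw [gauss_intClass_of_lt hlt]
      exact hasPhase_one

theorem hasPhase_gauss (hB : ∀ x y, B x y = B y x) (s : Finset ℤ)
    (hs : ∀ i, J.symbol.dim i ≠ 0 → i ∈ s) {k : ℤ} (h : J.symbol.type k = LatticeType.II) :
    HasPhase (gauss k (formClass B)) (∑ i ∈ s, if i < k then oddity (J.form i) +
      ((k - i : ℤ) : ZMod 8) * signPhase (J.symbol.sign i) else 0) := by
  rw [J.formClass_eq_sum s hs, map_sum_eq_prod]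
  exact hasPhase_prod _ _ _ fun i _ => J.hasPhase_gauss_term hB h i

theorem oddity_of_dim_eq_one (hB : ∀ x y, B x y = B y x) {i : ℤ}
    (h : J.symbol.type i = LatticeType.I) (h1 : J.symbol.dim i = 1) :
    oddity (J.form i) * oddity (J.form i) = 1 ∧ J.symbol.sign i = sign8 (oddity (J.form i)) := by
  obtain ⟨c, hc, -, h3, h4⟩ := J.exists_odd hB h
  revert c
  rw [h1]
  intro c hc h3 h4
  rw [h4, h3]
  simp [hc]

end JordanDecomposition

/-! ### Types and dimensions are isometry invariants -/

section

variable {L L' : Type*}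
  [AddCommGroup L] [Module ℤ_[2] L] [Module.Free ℤ_[2] L] [Module.Finite ℤ_[2] L]
  [AddCommGroup L'] [Module ℤ_[2] L'] [Module.Free ℤ_[2] L'] [Module.Finite ℤ_[2] L']
  {B : L →ₗ[ℤ_[2]] L →ₗ[ℤ_[2]] ℚ_[2]} {B' : L' →ₗ[ℤ_[2]] L' →ₗ[ℤ_[2]] ℚ_[2]}

/-- The Gauss integral at level k is zero for type I, and has a phase, hence is nonzero, for type
II. -/
theorem symbol_type_eq (hB : ∀ x y, B x y = B y x) (hB' : ∀ x y, B' x y = B' y x)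
    (J : JordanDecomposition B) (J' : JordanDecomposition B') (h : formClass B = formClass B') :
    J.symbol.type = J'.symbol.type := by
  funext k
  rcases ht : J.symbol.type k with _ | _ <;> rcases ht' : J'.symbol.type k with _ | _
  · rfl
  · have h1 := J.gauss_eq_zero hB ht
    rw [h] at h1
    exact absurd h1 (J'.hasPhase_gauss hB' J'.finite_dim.toFinset
      (fun i hi => J'.finite_dim.mem_toFinset.2 hi) ht').ne_zero
  · have h1 := J'.gauss_eq_zero hB' ht'
    rw [← h] at h1
    exact absurd h1 (J.hasPhase_gauss hB J.finite_dim.toFinset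
      (fun i hi => J.finite_dim.mem_toFinset.2 hi) ht).ne_zero
  · rfl

/-- As a function of k, the positive part of k - i has second difference 1 at k = i and 0 elsewhere.
This extracts dimensions from the exponents in `gauss_double`. -/
theorem sum_toNat_second_difference (s : Finset ℤ) (d : ℤ → ℕ) (k : ℤ) (hk : k ∉ s → d k = 0) :
    ∑ i ∈ s, (k + 1 - i).toNat * d i + ∑ i ∈ s, (k - 1 - i).toNat * d i =
      2 * ∑ i ∈ s, (k - i).toNat * d i + d k := by
  have h1 : d k = ∑ i ∈ s, if i = k then d i else 0 := by
    rw [Finset.sum_ite_eq']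
    split_ifs with h
    · rfl
    · exact hk h
  rw [h1, Finset.mul_sum, ← Finset.sum_add_distrib, ← Finset.sum_add_distrib]
  refine Finset.sum_congr rfl fun i _ => ?_
  rw [← add_mul, ← mul_assoc]
  split_ifs with h
  · subst h
    rw [show (i + 1 - i).toNat = 1 by omega, show (i - 1 - i).toNat = 0 by omega,
      show (i - i).toNat = 0 by omega]
    ring
  · rw [show (k + 1 - i).toNat + (k - 1 - i).toNat = 2 * (k - i).toNat by omega, add_zero]

theorem symbol_dim_eq (hB : ∀ x y, B x y = B y x) (hB' : ∀ x y, B' x y = B' y x)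
    (J : JordanDecomposition B) (J' : JordanDecomposition B') (h : formClass B = formClass B') :
    J.symbol.dim = J'.symbol.dim := by
  let s := J.finite_dim.toFinset ∪ J'.finite_dim.toFinset
  have hs (i) (hi : J.symbol.dim i ≠ 0) : i ∈ s :=
    Finset.mem_union_left _ (J.finite_dim.mem_toFinset.2 hi)
  have hs' (i) (hi : J'.symbol.dim i ≠ 0) : i ∈ s :=
    Finset.mem_union_right _ (J'.finite_dim.mem_toFinset.2 hi)
  have key (k : ℤ) : ∑ i ∈ s, (k - i).toNat * J.symbol.dim i =
      ∑ i ∈ s, (k - i).toNat * J'.symbol.dim i := by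
    have h1 := J.gauss_double hB s hs k
    rw [h, J'.gauss_double hB' s hs' k, Complex.ofReal_inj] at h1
    exact (pow_right_injective₀ (by norm_num : (0 : ℝ) < 1 / 2) (by norm_num) h1).symm
  funext k
  have h1 := sum_toNat_second_difference s J.symbol.dim k fun hk => by
    by_contra h0; exact hk (hs k h0)
  have h2 := sum_toNat_second_difference s J'.symbol.dim k fun hk => by
    by_contra h0; exact hk (hs' k h0)
  rw [key, key, key] at h1
  omega

end

end TwoAdic

namespace TwoAdic

/-! ### Symbols with equal phases -/

theorem sum_ite_lt_add_one {M : Type*} [AddCommMonoid M] (s : Finset ℤ) (g : ℤ → M) (k : ℤ)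
    (hk : k ∉ s → g k = 0) : (∑ i ∈ s, if i < k + 1 then g i else 0) =
      (∑ i ∈ s, if i < k then g i else 0) + g k := by
  have h1 : g k = ∑ i ∈ s, if i = k then g i else 0 := by
    rw [Finset.sum_ite_eq']
    split_ifs with h
    · rfl
    · exact hk h
  rw [h1]
  rw [← Finset.sum_add_distrib]
  refine Finset.sum_congr rfl fun i _ => ?_
  rcases lt_trichotomy i k with h | h | h
  · rw [if_pos (by omega), if_pos h, if_neg h.ne, add_zero]
  · rw [if_pos (by omega), if_neg (by omega), if_pos h, zero_add]
  · rw [if_neg (by omega), if_neg (by omega), if_neg h.ne', add_zero]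

theorem signPhase_injective : Function.Injective signPhase := by
  intro a b
  revert a b
  decide

theorem mem_compartment_iff {t : ℤ → LatticeType} {a b i j : ℤ} (ha : t a = LatticeType.II)
    (hb : t b = LatticeType.II) (hab : ∀ x, a < x → x < b → t x = LatticeType.I) (hai : a < i)
    (hib : i < b) : j ∈ compartment t i ↔ a < j ∧ j < b := by
  constructor
  · intro hj
    constructor
    · by_contra h
      have := hj a (Set.mem_uIcc.2 (by omega))
      rw [ha] at this
      cases this
    · by_contra h
      have := hj b (Set.mem_uIcc.2 (by omega))
      rw [hb] at this
      cases this
  · intro hj x hx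
    rw [Set.mem_uIcc] at hx
    exact hab x (by omega) (by omega)

namespace Symbol

/-- The relations between a symbol and the oddities of its terms. -/
structure HasOddities (S : Symbol) (o : ℤ → ZMod 8) (s : Finset ℤ) : Prop where
  mem : ∀ i, S.dim i ≠ 0 → i ∈ s
  sign_eq_one : ∀ i, S.dim i = 0 → S.sign i = 1
  type_eq : ∀ i, S.dim i = 0 → S.type i = LatticeType.II
  oddity_eq_zero : ∀ i, S.type i = LatticeType.II → o i = 0
  oddity_of_dim_eq_one : ∀ i, S.type i = LatticeType.I → S.dim i = 1 →
    o i * o i = 1 ∧ S.sign i = sign8 (o i)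
  compartmentOddity_eq : ∀ i, S.compartmentOddity i = ∑ᶠ j ∈ compartment S.type i, o j

/-- The parity of the number of minus signs below `k`, encoded as 0 or 4. -/
def signSum (S : Symbol) (s : Finset ℤ) (k : ℤ) : ZMod 8 :=
  ∑ i ∈ s, if i < k then signPhase (S.sign i) else 0

/-- The exponent of the Gauss integral at level `k`; it is an isometry invariant only where the type
is II. -/
def phase (S : Symbol) (o : ℤ → ZMod 8) (s : Finset ℤ) (k : ℤ) : ZMod 8 :=
  ∑ i ∈ s, if i < k then o i + ((k - i : ℤ) : ZMod 8) * signPhase (S.sign i) else 0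

/-- No sign can walk from scales up to `k` to scales above `k`. -/
def IsBreak (S : Symbol) (k : ℤ) : Prop :=
  (S.type k = LatticeType.II ∧ S.type (k + 1) = LatticeType.II) ∨
  (S.type k = LatticeType.I ∧ S.type (k + 1) = LatticeType.I ∧ S.compartmentDim k ≤ 2 ∧
    S.compartmentOddity k ≠ 2 ∧ S.compartmentOddity k ≠ -2)

theorem two_mul_signSum (S : Symbol) (s : Finset ℤ) (k : ℤ) : 2 * S.signSum s k = 0 := by
  rw [signSum, Finset.mul_sum]
  refine Finset.sum_eq_zero fun i _ => ?_
  rw [mul_ite, mul_zero, two_mul_signPhase, ite_self]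

namespace HasOddities

variable {S S' : Symbol} {o o' : ℤ → ZMod 8} {s : Finset ℤ}

theorem dim_ne_zero (h : S.HasOddities o s) {i : ℤ} (hi : S.type i = LatticeType.I) :
    S.dim i ≠ 0 := fun h0 => by
  have := h.type_eq i h0
  rw [hi] at this
  cases this

theorem mem_of_type (h : S.HasOddities o s) {i : ℤ} (hi : S.type i = LatticeType.I) : i ∈ s :=
  h.mem i (h.dim_ne_zero hi)

theorem type_of_not_mem (h : S.HasOddities o s) {i : ℤ} (hi : i ∉ s) :
    S.type i = LatticeType.II := by
  rw [← LatticeType.ne_I_iff]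
  exact fun h0 => hi (h.mem_of_type h0)

theorem signPhase_of_not_mem (h : S.HasOddities o s) {i : ℤ} (hi : i ∉ s) :
    signPhase (S.sign i) = 0 := by
  rw [h.sign_eq_one i (by by_contra h0; exact hi (h.mem i h0))]
  rfl

theorem signSum_add_one (h : S.HasOddities o s) (k : ℤ) :
    S.signSum s (k + 1) = S.signSum s k + signPhase (S.sign k) :=
  sum_ite_lt_add_one s (fun i => signPhase (S.sign i)) k h.signPhase_of_not_mem

/-- One step adds the oddity of term `k` and one more sign phase for every term up to `k`. -/
theorem phase_add_one (h : S.HasOddities o s) (k : ℤ) :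
    S.phase o s (k + 1) = S.phase o s k + o k + S.signSum s (k + 1) := by
  have h1 := sum_ite_lt_add_one s o k fun hk => h.oddity_eq_zero k (h.type_of_not_mem hk)
  have h2 (k : ℤ) : S.phase o s k = (∑ i ∈ s, if i < k then o i else 0) +
      ∑ i ∈ s, if i < k then ((k - i : ℤ) : ZMod 8) * signPhase (S.sign i) else 0 := by
    rw [← Finset.sum_add_distrib]
    refine Finset.sum_congr rfl fun i _ => ?_
    split_ifs <;> simp
  have h3 : (∑ i ∈ s, if i < k + 1 then ((k + 1 - i : ℤ) : ZMod 8) * signPhase (S.sign i) else 0) =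
      (∑ i ∈ s, if i < k then ((k - i : ℤ) : ZMod 8) * signPhase (S.sign i) else 0) +
      S.signSum s (k + 1) := by
    rw [signSum, ← Finset.sum_add_distrib]
    refine Finset.sum_congr rfl fun i _ => ?_
    rcases lt_trichotomy i k with h | rfl | h
    · rw [if_pos (by omega), if_pos h, if_pos (by omega)]
      push_cast
      ring
    · simp
    · rw [if_neg (by omega), if_neg (by omega), if_neg (by omega), add_zero]
  rw [h2, h2]
  linear_combination h1 + h3

theorem compartmentOddity_eq_sub (h : S.HasOddities o s) {a b i : ℤ}
    (ha : S.type a = LatticeType.II) (hb : S.type b = LatticeType.II)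
    (hab : ∀ x, a < x → x < b → S.type x = LatticeType.I) (hai : a < i) (hib : i < b) :
    S.compartmentOddity i =
      (∑ j ∈ s, if j < b then o j else 0) - ∑ j ∈ s, if j < a then o j else 0 := by
  classical
  rw [h.compartmentOddity_eq, finsum_compartment (fun _ => h.mem_of_type), ← Finset.sum_sub_distrib]
  refine Finset.sum_congr rfl fun j _ => ?_
  simp only [mem_compartment_iff ha hb hab hai hib]
  rcases eq_or_ne j a with rfl | hja
  · simp [h.oddity_eq_zero _ ha]
  · rcases lt_or_gt_of_ne hja with h1 | h1
    · rw [if_neg (by omega), if_pos (by omega), if_pos h1, sub_self]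
    · rw [if_neg (not_lt.2 h1.le), sub_zero]
      simp [h1]

theorem sum_dim_le_compartmentDim (h : S.HasOddities o s) (F : Finset ℤ) (i : ℤ)
    (hF : ∀ j ∈ F, j ∈ compartment S.type i) : ∑ j ∈ F, S.dim j ≤ S.compartmentDim i := by
  classical
  rw [compartmentDim, finsum_compartment (fun _ => h.mem_of_type), ← Finset.sum_filter]
  exact Finset.sum_le_sum_of_subset fun j hj => Finset.mem_filter.2
    ⟨h.mem_of_type (compartment_subset _ _ (hF j hj)), hF j hj⟩

/-- Terms of type I have dimension at least 1, so two of them exhaust a compartment of dimension at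
most 2. -/
theorem types_of_compartmentDim_le (h : S.HasOddities o s) {k : ℤ}
    (hk : S.type k = LatticeType.I) (hk' : S.type (k + 1) = LatticeType.I)
    (hd : S.compartmentDim k ≤ 2) : S.dim k = 1 ∧ S.dim (k + 1) = 1 ∧
      S.type (k - 1) = LatticeType.II ∧ S.type (k + 2) = LatticeType.II := by
  have h0 := h.dim_ne_zero hk
  have h1 := h.dim_ne_zero hk'
  have hc : ∀ x, (x = k ∨ x = k + 1) → S.type x = LatticeType.I := by
    rintro x (rfl | rfl)
    · exact hk
    · exact hk'
  have hm0 : k ∈ compartment S.type k := fun x hx => hc x (by rw [Set.mem_uIcc] at hx; omega)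
  have hm1 : k + 1 ∈ compartment S.type k := fun x hx => hc x (by rw [Set.mem_uIcc] at hx; omega)
  have key (j : ℤ) (hj : j ≠ k) (hj' : j ≠ k + 1) : j ∉ compartment S.type k := fun hj'' => by
    have := h.sum_dim_le_compartmentDim {k, k + 1, j} k (by simp [hm0, hm1, hj''])
    rw [Finset.sum_insert (by simp [hj.symm]), Finset.sum_pair hj'.symm] at this
    have := h.dim_ne_zero (compartment_subset _ _ hj'')
    omega
  have h2 := h.sum_dim_le_compartmentDim {k, k + 1} k (by simp [hm0, hm1])
  rw [Finset.sum_pair (by omega)] at h2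
  refine ⟨by omega, by omega, ?_, ?_⟩
  · rw [← LatticeType.ne_I_iff]
    refine fun h3 => key (k - 1) (by omega) (by omega) fun x hx => ?_
    rw [Set.mem_uIcc] at hx
    rcases (show x = k ∨ x = k - 1 by omega) with rfl | rfl
    · exact hk
    · exact h3
  · rw [← LatticeType.ne_I_iff]
    refine fun h3 => key (k + 2) (by omega) (by omega) fun x hx => ?_
    rw [Set.mem_uIcc] at hx
    rcases (show x = k ∨ x = k + 1 ∨ x = k + 2 by omega) with rfl | rfl | rfl
    · exact hk
    · exact hk'
    · exact h3

theorem compartmentOddity_pair (h : S.HasOddities o s) {k : ℤ}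
    (hk : S.type k = LatticeType.I) (hk' : S.type (k + 1) = LatticeType.I)
    (hd : S.compartmentDim k ≤ 2) : S.compartmentOddity k = o k + o (k + 1) := by
  obtain ⟨-, -, h1, h2⟩ := h.types_of_compartmentDim_le hk hk' hd
  have ho (i : ℤ) := sum_ite_lt_add_one s o i fun hi => h.oddity_eq_zero i (h.type_of_not_mem hi)
  rw [h.compartmentOddity_eq_sub (i := k) h1 h2 (fun x hx hx' => by
    rcases (show x = k ∨ x = k + 1 by omega) with rfl | rfl
    · exact hk
    · exact hk') (by omega) (by omega)]
  have e1 := ho (k - 1)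
  have e2 := ho k
  have e3 := ho (k + 1)
  rw [sub_add_cancel, h.oddity_eq_zero _ h1] at e1
  rw [show k + 1 + 1 = k + 2 by ring] at e3
  rw [e3, e2, e1]
  ring

theorem phase_add_two_sub (h : S.HasOddities o s) {k : ℤ} (hk : S.type (k - 1) = LatticeType.II) :
    S.phase o s (k + 2) - S.phase o s (k - 1) =
      o k + o (k + 1) + S.signSum s k + signPhase (S.sign (k + 1)) := by
  have p1 := h.phase_add_one (k - 1)
  have p2 := h.phase_add_one k
  have p3 := h.phase_add_one (k + 1)
  have s2 := h.signSum_add_one k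
  have s3 := h.signSum_add_one (k + 1)
  rw [sub_add_cancel, h.oddity_eq_zero _ hk] at p1
  rw [show k + 1 + 1 = k + 2 by ring] at p3 s3
  rw [p3, p2, p1, s3, s2]
  linear_combination S.two_mul_signSum s k + two_mul_signPhase (S.sign k)

/-- Phases determine the oddity of such a pair only up to 4, which suffices to decide whether it is
±2, so breaks are invariants. -/
theorem two_mul_compartmentOddity (h : S.HasOddities o s) {k : ℤ}
    (hk : S.type k = LatticeType.I) (hk' : S.type (k + 1) = LatticeType.I)
    (hd : S.compartmentDim k ≤ 2) :
    2 * S.compartmentOddity k = 2 * (S.phase o s (k + 2) - S.phase o s (k - 1)) := by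
  obtain ⟨-, -, h1, -⟩ := h.types_of_compartmentDim_le hk hk' hd
  rw [h.phase_add_two_sub h1, h.compartmentOddity_pair hk hk' hd]
  linear_combination -S.two_mul_signSum s k - two_mul_signPhase (S.sign (k + 1))

/-- An oddity other than ±2 is 0 if the two signs agree and 4 if they differ, so it cancels the sign
phase of term k + 1 and supplies that of term k. -/
theorem signSum_eq_of_pair (h : S.HasOddities o s) {k : ℤ}
    (hk : S.type k = LatticeType.I) (hk' : S.type (k + 1) = LatticeType.I)
    (hd : S.compartmentDim k ≤ 2) (h2 : S.compartmentOddity k ≠ 2)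
    (h2' : S.compartmentOddity k ≠ -2) :
    S.signSum s (k + 1) = S.phase o s (k + 2) - S.phase o s (k - 1) := by
  obtain ⟨hd0, hd1, h1, -⟩ := h.types_of_compartmentDim_le hk hk' hd
  obtain ⟨hu, hs⟩ := h.oddity_of_dim_eq_one _ hk hd0
  obtain ⟨hu', hs'⟩ := h.oddity_of_dim_eq_one _ hk' hd1
  rw [h.compartmentOddity_pair hk hk' hd] at h2 h2'
  have key : ∀ x y : ZMod 8, x * x = 1 → y * y = 1 → x + y ≠ 2 → x + y ≠ -2 →
      x + y + signPhase (sign8 y) = signPhase (sign8 x) := by decide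
  rw [h.phase_add_two_sub h1, h.signSum_add_one, hs, hs', ← key _ _ hu hu' h2 h2']
  ring

/-- Equality of the invariants that are visible in dimensions, types and phases. -/
structure Agree (S S' : Symbol) (o o' : ℤ → ZMod 8) (s : Finset ℤ) : Prop where
  left : S.HasOddities o s
  right : S'.HasOddities o' s
  dim : S.dim = S'.dim
  type : S.type = S'.type
  phase : ∀ k, S.type k = LatticeType.II → S.phase o s k = S'.phase o' s k

theorem Agree.symm (h : Agree S S' o o' s) : Agree S' S o' o s :=
  ⟨h.right, h.left, h.dim.symm, h.type.symm, fun k hk =>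
    (h.phase k (by rw [h.type]; exact hk)).symm⟩

theorem Agree.compartmentDim (h : Agree S S' o o' s) (k : ℤ) :
    S.compartmentDim k = S'.compartmentDim k := by
  rw [Symbol.compartmentDim, Symbol.compartmentDim, h.dim, h.type]

theorem Agree.isBreak (h : Agree S S' o o' s) {k : ℤ} (hk : S.IsBreak k) : S'.IsBreak k := by
  rcases hk with hk | ⟨hk, hk', hd, h2, h2'⟩
  · left
    rwa [← h.type]
  · right
    obtain ⟨-, -, h3, h4⟩ := h.left.types_of_compartmentDim_le hk hk' hd
    have e := h.left.two_mul_compartmentOddity hk hk' hd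
    rw [h.phase _ h3, h.phase _ h4, ← h.right.two_mul_compartmentOddity (by rwa [← h.type])
      (by rwa [← h.type]) (by rwa [← h.compartmentDim])] at e
    have key : ∀ x y : ZMod 8, 2 * x = 2 * y → x ≠ 2 → x ≠ -2 → y ≠ 2 ∧ y ≠ -2 := by decide
    rw [← h.type, ← h.compartmentDim]
    exact ⟨hk, hk', hd, key _ _ e h2 h2'⟩

/-- At a break the sign sum is a difference of phases at two scales of type II: k and k + 1, or k -
1 and k + 2. -/
theorem Agree.signSum (h : Agree S S' o o' s) {k : ℤ} (hk : S.IsBreak k) :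
    S.signSum s (k + 1) = S'.signSum s (k + 1) := by
  have hb := h.isBreak hk
  rcases hk with ⟨hk, hk'⟩ | ⟨hk, hk', hd, h2, h2'⟩
  · have e := h.left.phase_add_one k
    have e' := h.right.phase_add_one k
    rw [h.left.oddity_eq_zero k hk] at e
    rw [h.right.oddity_eq_zero k (by rwa [← h.type])] at e'
    linear_combination e' - e + h.phase _ hk' - h.phase _ hk
  · rcases hb with ⟨hb, -⟩ | ⟨hb, hb', hbd, hb2, hb2'⟩
    · rw [← h.type, hk] at hb
      cases hb
    · obtain ⟨-, -, h3, h4⟩ := h.left.types_of_compartmentDim_le hk hk' hd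
      rw [h.left.signSum_eq_of_pair hk hk' hd h2 h2', h.right.signSum_eq_of_pair hb hb' hbd hb2 hb2',
        h.phase _ h3, h.phase _ h4]

/-- Without breaks, successive nontrivial scales interact. If the term after `i` is trivial, hence
of type II, then its neighbours `i` and `i + 2` must have type I, which is rule (3); adjacent
nontrivial terms fall under (1) or (2). -/
theorem eqvGen_interact (h : S.HasOddities o s) (n : ℕ) : ∀ i, S.dim i ≠ 0 → S.dim (i + n) ≠ 0 →
    (∀ k, i ≤ k → k < i + n → ¬ S.IsBreak k) → Relation.EqvGen S.Interact i (i + n) := by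
  induction n using Nat.strong_induction_on with
  | h n ih =>
  intro i hi hn hb
  rcases n with _ | n
  · rw [Nat.cast_zero, add_zero]
    exact Relation.EqvGen.refl i
  have hbi := hb i le_rfl (by push_cast; omega)
  rw [IsBreak, not_or] at hbi
  by_cases h1 : S.dim (i + 1) = 0
  · have ht1 := h.type_eq _ h1
    have ht : S.type i = LatticeType.I := by
      by_contra ht
      exact hbi.1 ⟨LatticeType.ne_I_iff.1 ht, ht1⟩
    rcases n with _ | n
    · push_cast at hn
      exact absurd h1 hn
    have hbi' := hb (i + 1) (by omega) (by push_cast; omega)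
    rw [IsBreak, not_or] at hbi'
    have ht2 : S.type (i + 2) = LatticeType.I := by
      by_contra ht2
      exact hbi'.1 ⟨ht1, by rw [show i + 1 + 1 = i + 2 by ring]; exact LatticeType.ne_I_iff.1 ht2⟩
    have hd2 := h.dim_ne_zero ht2
    have e : i + ((n + 1 + 1 : ℕ) : ℤ) = i + 2 + n := by push_cast; ring
    rw [e] at hn hb ⊢
    exact (Relation.EqvGen.rel _ _ ⟨hi, hd2, Or.inr (Or.inr ⟨rfl, ht, ht2, h1⟩)⟩).trans _ _ _
      (ih n (by omega) (i + 2) hd2 hn fun k hk => hb k (by omega))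
  · have e : i + ((n + 1 : ℕ) : ℤ) = i + 1 + n := by push_cast; ring
    rw [e] at hn hb ⊢
    refine Relation.EqvGen.trans _ _ _ (Relation.EqvGen.rel _ _ ⟨hi, h1, ?_⟩)
      (ih n (by omega) (i + 1) h1 hn fun k hk => hb k (by omega))
    by_cases ht : S.type i = S.type (i + 1)
    · right; left
      have ht0 : S.type i = LatticeType.I := by
        by_contra h0
        have h0 := LatticeType.ne_I_iff.1 h0
        exact hbi.1 ⟨h0, ht ▸ h0⟩
      refine ⟨rfl, ht0, ht ▸ ht0, ?_⟩
      by_contra hcon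
      simp only [not_or, not_lt] at hcon
      exact hbi.2 ⟨ht0, ht ▸ ht0, hcon.1, hcon.2.1, hcon.2.2⟩
    · exact Or.inl ⟨rfl, ht⟩

theorem sign_eq_one_of_isCanonical (h : S.HasOddities o s) (hc : S.IsCanonical) {i j : ℤ}
    (hi : S.dim i ≠ 0) (hij : i < j) (hb : ∀ k, i ≤ k → k < j → ¬ S.IsBreak k) :
    S.sign j = 1 := by
  by_cases hj : S.dim j = 0
  · exact h.sign_eq_one j hj
  · rcases Int.units_eq_one_or (S.sign j) with h1 | h1
    · exact h1
    · obtain ⟨n, rfl⟩ : ∃ n : ℕ, j = i + n := ⟨(j - i).toNat, by omega⟩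
      have := hc _ hj h1 i (h.eqvGen_interact n i hi hj hb).symm
      omega

theorem signSum_of_isCanonical (h : S.HasOddities o s) (hc : S.IsCanonical) {i : ℤ}
    (hi : S.dim i ≠ 0) (n : ℕ) (hb : ∀ k, i ≤ k → k < i + n → ¬ S.IsBreak k) :
    S.signSum s (i + n + 1) = S.signSum s i + signPhase (S.sign i) := by
  induction n with
  | zero => rw [Nat.cast_zero, add_zero, h.signSum_add_one]
  | succ n ih =>
    push_cast at hb ⊢
    rw [h.signSum_add_one, ← add_assoc, ih fun k hk hk' => hb k hk (by omega),
      h.sign_eq_one_of_isCanonical (j := i + n + 1) hc hi (by omega) fun k hk hk' => hb k hk (by omega)]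
    exact add_zero _

theorem exists_type_right (h : S.HasOddities o s) (i : ℤ) :
    ∃ n : ℕ, ∀ m : ℕ, n ≤ m → S.type (i + m) = LatticeType.II := by
  obtain ⟨M, hM⟩ := s.bddAbove
  refine ⟨(M - i).toNat + 1, fun m hm => h.type_of_not_mem fun hmem => ?_⟩
  have := hM hmem
  omega

theorem exists_type_left (h : S.HasOddities o s) (i : ℤ) :
    ∃ n : ℕ, S.type (i - n) = LatticeType.II := by
  obtain ⟨M, hM⟩ := s.bddBelow
  refine ⟨(i - M).toNat + 1, h.type_of_not_mem fun hmem => ?_⟩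
  have := hM hmem
  push_cast at this
  omega

/-- At the least scale where the signs differ, go to the first break at or after it. Canonical form
makes all signs in between +, so the sign sums at the break differ by that one sign, although breaks
and their sign sums are invariants. -/
theorem Agree.sign (h : Agree S S' o o' s) (hc : S.IsCanonical) (hc' : S'.IsCanonical) :
    S.sign = S'.sign := by
  classical
  by_contra hne
  obtain ⟨i₀, hi₀⟩ := Function.ne_iff.1 hne
  have hdim (i) (hi : S.sign i ≠ S'.sign i) : S.dim i ≠ 0 := fun h0 =>
    hi (by rw [h.left.sign_eq_one i h0, h.right.sign_eq_one i (by rwa [← h.dim])])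
  let D := s.filter fun i => S.sign i ≠ S'.sign i
  have hD (i) : i ∈ D ↔ S.sign i ≠ S'.sign i := by
    rw [Finset.mem_filter]
    exact ⟨fun h => h.2, fun hi => ⟨h.left.mem i (hdim i hi), hi⟩⟩
  obtain ⟨i, hi, hmin⟩ := D.exists_minimal ⟨i₀, (hD i₀).2 hi₀⟩
  rw [hD] at hi
  have hlt (j) (hj : j < i) : S.sign j = S'.sign j := by
    by_contra hne
    exact absurd (hmin ((hD j).2 hne) hj.le) (not_le.2 hj)
  -- Beyond the last nontrivial scale all types are II, so there is a break.
  have hex : ∃ n : ℕ, S.IsBreak (i + n) := by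
    obtain ⟨n, hn⟩ := h.left.exists_type_right i
    refine ⟨n, Or.inl ⟨hn n le_rfl, ?_⟩⟩
    have := hn (n + 1) (by omega)
    rwa [Nat.cast_add, Nat.cast_one, ← add_assoc] at this
  have hnb (k) (hk : i ≤ k) (hk' : k < i + Nat.find hex) : ¬ S.IsBreak k := by
    have := Nat.find_min hex (m := (k - i).toNat) (by omega)
    rwa [show i + ((k - i).toNat : ℤ) = k by omega] at this
  have e1 := h.left.signSum_of_isCanonical hc (hdim i hi) (Nat.find hex) hnb
  have e2 := h.right.signSum_of_isCanonical hc' (by rw [← h.dim]; exact hdim i hi) (Nat.find hex)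
    fun k hk hk' hb => hnb k hk hk' (h.symm.isBreak hb)
  have e3 := h.signSum (Nat.find_spec hex)
  have e4 : S.signSum s i = S'.signSum s i := by
    refine Finset.sum_congr rfl fun j _ => ?_
    split_ifs with hj
    · rw [hlt j hj]
    · rfl
  rw [e1, e2, e4] at e3
  exact hi (signPhase_injective (add_left_cancel e3))

/-- Once the signs are known, a phase at type II gives the sum of the oddities below it; a
compartment oddity is the difference of two such sums at the type II scales bounding it. -/
theorem Agree.compartmentOddity (h : Agree S S' o o' s) (hs : S.sign = S'.sign) :
    S.compartmentOddity = S'.compartmentOddity := by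
  classical
  funext i
  rcases ht : S.type i with _ | _
  · have hr : ∃ n : ℕ, S.type (i + n) = LatticeType.II := by
      obtain ⟨n, hn⟩ := h.left.exists_type_right i
      exact ⟨n, hn n le_rfl⟩
    have hl := h.left.exists_type_left i
    have hr1 := Nat.find_spec hr
    have hl1 := Nat.find_spec hl
    have hr0 : Nat.find hr ≠ 0 := fun h0 => by
      rw [h0, Nat.cast_zero, add_zero, ht] at hr1
      cases hr1
    have hl0 : Nat.find hl ≠ 0 := fun h0 => by
      rw [h0, Nat.cast_zero, sub_zero, ht] at hl1
      cases hl1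
    have hI (x) (hx : i - Nat.find hl < x) (hx' : x < i + Nat.find hr) :
        S.type x = LatticeType.I := by
      by_contra h0
      rw [← Ne, LatticeType.ne_I_iff] at h0
      rcases le_total i x with hix | hix
      · refine Nat.find_min hr (m := (x - i).toNat) (by omega) ?_
        rwa [show i + ((x - i).toNat : ℤ) = x by omega]
      · refine Nat.find_min hl (m := (i - x).toNat) (by omega) ?_
        rwa [show i - ((i - x).toNat : ℤ) = x by omega]
    have key (k : ℤ) (hk : S.type k = LatticeType.II) :
        (∑ j ∈ s, if j < k then o j else 0) = ∑ j ∈ s, if j < k then o' j else 0 := by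
      have e := h.phase k hk
      rw [Symbol.phase, Symbol.phase, hs, ← sub_eq_zero, ← Finset.sum_sub_distrib] at e
      rw [← sub_eq_zero, ← Finset.sum_sub_distrib, ← e]
      refine Finset.sum_congr rfl fun j _ => ?_
      split_ifs <;> ring
    have hl2 : i - (Nat.find hl : ℤ) < i := by omega
    have hr2 : i < i + (Nat.find hr : ℤ) := by omega
    rw [h.left.compartmentOddity_eq_sub hl1 hr1 hI hl2 hr2]
    rw [key _ hl1, key _ hr1]
    exact (h.right.compartmentOddity_eq_sub (by rw [← h.type]; exact hl1)
      (by rw [← h.type]; exact hr1) (fun x hx hx' => by rw [← h.type]; exact hI x hx hx')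
      hl2 hr2).symm
  · have key (t : ℤ → LatticeType) (u : ℤ → ZMod 8) (ht : t i = LatticeType.II) :
        ∑ᶠ j ∈ compartment t i, u j = 0 := by
      have : compartment t i = ∅ := Set.eq_empty_of_forall_notMem fun j hj => by
        have := hj i Set.left_mem_uIcc
        rw [ht] at this
        cases this
      rw [this, finsum_mem_empty]
    rw [h.left.compartmentOddity_eq, h.right.compartmentOddity_eq, key _ _ ht,
      key _ _ (by rwa [← h.type])]

theorem Agree.eq (h : Agree S S' o o' s) (hc : S.IsCanonical) (hc' : S'.IsCanonical) : S = S' :=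
  Symbol.ext h.dim (h.sign hc hc') h.type (h.compartmentOddity (h.sign hc hc'))

end HasOddities

end Symbol

/-! ### Canonical symbols of isometric lattices -/

theorem JordanDecomposition.hasOddities {L : Type*} [AddCommGroup L] [Module ℤ_[2] L]
    [Module.Free ℤ_[2] L] [Module.Finite ℤ_[2] L] {B : L →ₗ[ℤ_[2]] L →ₗ[ℤ_[2]] ℚ_[2]}
    (J : JordanDecomposition B) (hB : ∀ x y, B x y = B y x) {s : Finset ℤ}
    (hs : ∀ i, J.symbol.dim i ≠ 0 → i ∈ s) :
    J.symbol.HasOddities (fun i => oddity (J.form i)) s where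
  mem := hs
  sign_eq_one _ := J.sign_of_dim_eq_zero
  type_eq _ := J.type_of_dim_eq_zero
  oddity_eq_zero _ := J.oddity_of_type_II hB
  oddity_of_dim_eq_one _ := J.oddity_of_dim_eq_one hB
  compartmentOddity_eq _ := rfl

theorem symbol_eq_of_formClass_eq {L L' : Type*}
    [AddCommGroup L] [Module ℤ_[2] L] [Module.Free ℤ_[2] L] [Module.Finite ℤ_[2] L]
    [AddCommGroup L'] [Module ℤ_[2] L'] [Module.Free ℤ_[2] L'] [Module.Finite ℤ_[2] L']
    {B : L →ₗ[ℤ_[2]] L →ₗ[ℤ_[2]] ℚ_[2]} {B' : L' →ₗ[ℤ_[2]] L' →ₗ[ℤ_[2]] ℚ_[2]}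
    (hB : ∀ x y, B x y = B y x) (hB' : ∀ x y, B' x y = B' y x)
    (J : JordanDecomposition B) (J' : JordanDecomposition B') (h : formClass B = formClass B')
    (hc : J.symbol.IsCanonical) (hc' : J'.symbol.IsCanonical) : J.symbol = J'.symbol := by
  let s := J.finite_dim.toFinset ∪ J'.finite_dim.toFinset
  have hs (i) (hi : J.symbol.dim i ≠ 0) : i ∈ s :=
    Finset.mem_union_left _ (J.finite_dim.mem_toFinset.2 hi)
  have hs' (i) (hi : J'.symbol.dim i ≠ 0) : i ∈ s :=
    Finset.mem_union_right _ (J'.finite_dim.mem_toFinset.2 hi)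
  have ht := symbol_type_eq hB hB' J J' h
  refine Symbol.HasOddities.Agree.eq ⟨J.hasOddities hB hs, J'.hasOddities hB' hs',
    symbol_dim_eq hB hB' J J' h, ht, fun k hk => ?_⟩ hc hc'
  have h1 := J.hasPhase_gauss hB s hs hk
  rw [h] at h1
  exact h1.unique (J'.hasPhase_gauss hB' s hs' (by rwa [← ht]))

end TwoAdic


theorem mainTheorem5 {L L' : Type*}
    [AddCommGroup L] [Module ℤ_[2] L] [Module.Free ℤ_[2] L] [Module.Finite ℤ_[2] L]
    [AddCommGroup L'] [Module ℤ_[2] L'] [Module.Free ℤ_[2] L'] [Module.Finite ℤ_[2] L']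
    (B : L →ₗ[ℤ_[2]] L →ₗ[ℤ_[2]] ℚ_[2]) (B' : L' →ₗ[ℤ_[2]] L' →ₗ[ℤ_[2]] ℚ_[2])
    (hsymm : ∀ x y, B x y = B y x) (hsymm' : ∀ x y, B' x y = B' y x)
    (hnondeg : ∀ x, (∀ y, B x y = 0) → x = 0)
    (hnondeg' : ∀ x, (∀ y, B' x y = 0) → x = 0)
    (S S' : TwoAdic.Symbol)
    (hS : TwoAdic.IsSymbolOf S B) (hS' : TwoAdic.IsSymbolOf S' B')
    (hcan : S.IsCanonical) (hcan' : S'.IsCanonical) :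
    TwoAdic.Isometric B B' ↔ S = S' := by
  obtain ⟨J, rfl⟩ := hS
  obtain ⟨J', rfl⟩ := hS'
  rw [← TwoAdic.formClass_eq_iff]
  exact ⟨fun h => TwoAdic.symbol_eq_of_formClass_eq hsymm hsymm' J J' h hcan hcan',
    fun h => TwoAdic.formClass_eq_of_symbol_eq hsymm hsymm' J J' h.symm⟩
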